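/- For $\varepsilon>0$, a finite set $S\subset\mathbb Z$ is called $\varepsilon$-invariant if $|(S+1)\triangle S|<\varepsilon|S|$. For a measurable semimetric $\rho:X\times X\to[0,\infty)$ on a probability space $(X,\mu)$, let $\mathbb H_\varepsilon(X,\mu,\rho)=\log_2 k$, where $k$ is the least positive integer such that $X=X_0\cup X_1\cup\dots\cup X_k$ with all $X_i$ measurable, $\mu(X_0)<\varepsilon$ and $\operatorname{diam}_\rho(X_i)<\varepsilon$ for $i\ge1$ (and $\mathbb H_\varepsilon=+\infty$ if there is no such $k$). The semimetric $\rho$ is admissible if it is separable on a subset of full measure, and summable if $\int_{X^2}\rho\,d\mu^2<\infty$. For an automorphism $T$ of $(X,\mu)$, $\rho$ is generating if there is a subset of full measure such that for any two distinct points $x,y$ of it there is $m\in\mathbb Z$ with $\rho(T^mx,T^my)>0$; for a nonempty finite $S\subset\mathbb Z$ put $T^S_{av}\rho(x,y)=\frac1{|S|}\sum_{m\in S}\rho(T^mx,T^my)$. The graph of ordered pairs has levels $V_n=\{0,1\}^{2^n}$, $n\ge0$; each $v\in V_{n+1}$ receives from level $n$ an edge of colour $0$ from its prefix of length $2^n$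 and an edge of colour $1$ from its suffix of length $2^n$ (two distinct edges if the two coincide). Let $X$ be the space of infinite paths $(e_n)_{n\ge0}$, where $e_n$ goes from $V_n$ to $V_{n+1}$. A Borel probability measure on $X$ is central if any two cylinders given by finite paths with the same terminal vertex have equal measure. The adic transformation maps a path $(e_i)$, with $n$ the least index such that $e_n$ has colour $0$, to the path $(u_i)$ with $u_i=e_i$ for $i>n$, with $u_n$ of colour $1$ and $u_i$ of colour $0$ for $i<n$. **Lemma.** Let $\{S_n^i\}_{i=1}^{k_n}$, $n\ge1$, be finite families of finite subsets of $\mathbb Z$ such that every $S_n^i$ is $\frac1n$-invariant, and let $\phi(n)$ be positive numbers with $\phi(n)\to\infty$. Then there are an atomless central probability measure $\mu$ on $X$, an ergodic automorphism $T$ of the Lebesgue space $(X,\mu)$ that coincides $\mu$-almost everywhere with the adic transformation, and a strictly increasing sequence $n_j$ such that for every generating admissible summable measurable semimetric $\rho$ on $(X,\mu)$ and all sufficiently small $\varepsilon>0$ (depending on $\rho$), as $j\to\infty$, both ratios $$\frac{|S_{n_j}^i|/\phi(n_j)}{\mathbb H_\varepsilon\bigl(X,\mu,T_{av}^{S_{n_j}^i}\rho\bigr)}\qquad\text{and}\qquad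 \frac{\mathbb H_\varepsilon\bigl(X,\mu,T_{av}^{S_{n_j}^i}\rho\bigr)}{|S_{n_j}^i|}$$ tend to $0$, uniformly in $i\in\{1,\dots,k_{n_j}\}$. -/

import Mathlib

open MeasureTheory Filter Set
open scoped ENNReal symmDiff

noncomputable section

namespace PairsGraph

/-! ### The graph of ordered pairs, its path space, central measures and the adic transformation -/

/-- The `n`-th level of the graph: binary words of length `2 ^ n`. -/
abbrev Vertex (n : ℕ) : Type := Fin (2 ^ n) → Bool

/-- The prefix (`c = false`) or the suffix (`c = true`) of length `2 ^ n` of a word of length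
`2 ^ (n + 1)`. -/
def half {n : ℕ} (c : Bool) (v : Vertex (n + 1)) : Vertex n :=
  fun i => v ⟨(if c then 2 ^ n else 0) + i.val, by
    have h := i.isLt
    have h2 : 2 ^ (n + 1) = 2 ^ n + 2 ^ n := by ring
    split <;> omega⟩

/-- Edges between levels `n` and `n + 1`: triples (initial vertex, terminal vertex, colour) such
that the initial vertex is the prefix (colour `false`, i.e. `0`) or the suffix (colour `true`,
i.e. `1`) of the terminal one. If it is both, there are two distinct edges. -/
abbrev Edge (n : ℕ) : Type :=
  {e : Vertex n × Vertex (n + 1) × Bool // e.1 = half e.2.2 e.2.1}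

/-- The initial vertex of an edge. -/
def Edge.source {n : ℕ} (e : Edge n) : Vertex n := e.1.1

/-- The terminal vertex of an edge. -/
def Edge.target {n : ℕ} (e : Edge n) : Vertex (n + 1) := e.1.2.1

/-- The colour of an edge. -/
def Edge.colour {n : ℕ} (e : Edge n) : Bool := e.1.2.2

/-- The space of infinite paths, with the σ-algebra generated by the cylinders (the one induced
from the product of the finite discrete spaces of edges). -/
abbrev PathSpace : Type :=
  {x : (n : ℕ) → Edge n // ∀ n, Edge.source (x (n + 1)) = Edge.target (x n)}

/-- The cylinder of all paths with the same first `n` edges as `x`. -/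
def cylinder (x : PathSpace) (n : ℕ) : Set PathSpace :=
  {y | ∀ i < n, y.1 i = x.1 i}

/-- A measure on the path space is central if two cylinders given by finite paths with the same
terminal vertex have the same measure. -/
def IsCentral (μ : Measure PathSpace) : Prop :=
  ∀ (n : ℕ) (x y : PathSpace), Edge.target (x.1 n) = Edge.target (y.1 n) →
    μ (cylinder x (n + 1)) = μ (cylinder y (n + 1))

/-- `y` is the image of the path `x` under the adic transformation: `n` is the first index at which
`x` has colour `0`; `y` agrees with `x` after `n`, has colour `1` at `n` and colour `0` before `n`.
(Paths all of whose edges have colour `1` have no image.) -/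
def IsAdicImage (x y : PathSpace) : Prop :=
  ∃ n : ℕ, Edge.colour (x.1 n) = false ∧ (∀ i < n, Edge.colour (x.1 i) = true) ∧
    (∀ i, n < i → y.1 i = x.1 i) ∧ Edge.colour (y.1 n) = true ∧
    ∀ i < n, Edge.colour (y.1 i) = false

/-- The path space is a standard Borel space, so that every atomless probability measure makes it
a Lebesgue space. -/
instance : StandardBorelSpace PathSpace := by
  have h : MeasurableSet
      {x : (n : ℕ) → Edge n | ∀ n, Edge.source (x (n + 1)) = Edge.target (x n)} := by
    rw [Set.ofPred_forall]
    refine MeasurableSet.iInter fun n => ?_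
    exact measurableSet_eq_fun
      ((measurable_of_countable (Edge.source (n := n + 1))).comp (measurable_pi_apply (n + 1)))
      ((measurable_of_countable (Edge.target (n := n))).comp (measurable_pi_apply n))
  exact h.standardBorel

end PairsGraph

namespace ScalingEntropy

/-! ### Semimetrics and their `ε`-entropy -/

/-- Measurable semimetrics on `(X, μ)`. -/
structure IsMeasurableSemimetric {X : Type*} [MeasurableSpace X] (μ : Measure X)
    (ρ : X → X → ℝ) : Prop where
  nonneg : ∀ x y, 0 ≤ ρ x y
  self : ∀ x, ρ x x = 0
  symm : ∀ x y, ρ x y = ρ y x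
  triangle : ∀ x y z, ρ x z ≤ ρ x y + ρ y z
  aemeasurable : AEMeasurable (fun p : X × X => ρ p.1 p.2) (μ.prod μ)

/-- A semimetric is admissible if it is separable on a subset of full measure. -/
def IsAdmissible {X : Type*} [MeasurableSpace X] (μ : Measure X) (ρ : X → X → ℝ) : Prop :=
  ∃ X₀ : Set X, μ X₀ᶜ = 0 ∧ ∃ D : Set X, D ⊆ X₀ ∧ D.Countable ∧
    ∀ x ∈ X₀, ∀ r : ℝ, 0 < r → ∃ d ∈ D, ρ x d < r

/-- A semimetric is summable if it has finite integral over `X × X`. -/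
def IsSummable {X : Type*} [MeasurableSpace X] (μ : Measure X) (ρ : X → X → ℝ) : Prop :=
  Integrable (fun p : X × X => ρ p.1 p.2) (μ.prod μ)

/-- The action of `m : ℤ` through the invertible transformation `T`, i.e. `T ^ m`. -/
def act {X : Type*} [MeasurableSpace X] (T : X ≃ᵐ X) (m : ℤ) : X → X :=
  ⇑((T.toEquiv : Equiv.Perm X) ^ m)

/-- A semimetric is generating if its shifts by the powers of `T` together separate the points of
a subset of full measure. -/
def IsGenerating {X : Type*} [MeasurableSpace X] (μ : Measure X) (T : X ≃ᵐ X)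
    (ρ : X → X → ℝ) : Prop :=
  ∃ X₀ : Set X, μ X₀ᶜ = 0 ∧
    ∀ x ∈ X₀, ∀ y ∈ X₀, x ≠ y → ∃ m : ℤ, 0 < ρ (act T m x) (act T m y)

/-- The semimetric averaged over `S`: `(1 / |S|) ∑ m ∈ S, ρ (T ^ m x) (T ^ m y)`. -/
def average {X : Type*} [MeasurableSpace X] (T : X ≃ᵐ X) (S : Finset ℤ) (ρ : X → X → ℝ) :
    X → X → ℝ :=
  fun x y => (S.card : ℝ)⁻¹ * ∑ m ∈ S, ρ (act T m x) (act T m y)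

/-- The diameter of a set with respect to a semimetric. -/
def diam {X : Type*} (ρ : X → X → ℝ) (A : Set X) : ℝ≥0∞ :=
  ⨆ x ∈ A, ⨆ y ∈ A, ENNReal.ofReal (ρ x y)

/-- `X` is the union of measurable sets `A 0, …, A k` with `μ (A 0) < ε` and with
`diam (A i) < ε` for `i > 0`. -/
def HasCover {X : Type*} [MeasurableSpace X] (μ : Measure X) (ρ : X → X → ℝ) (ε : ℝ) (k : ℕ) :
    Prop :=
  ∃ A : Fin (k + 1) → Set X, (∀ i, MeasurableSet (A i)) ∧ (⋃ i, A i) = univ ∧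
    μ (A 0) < ENNReal.ofReal ε ∧ ∀ i, i ≠ 0 → diam ρ (A i) < ENNReal.ofReal ε

/-- The `ε`-entropy: `log₂ k` for the least positive `k` for which there is such a cover, and `∞`
if there is none. -/
def epsEntropy {X : Type*} [MeasurableSpace X] (μ : Measure X) (ρ : X → X → ℝ) (ε : ℝ) : ℝ≥0∞ :=
  ⨅ (k : ℕ) (_ : 1 ≤ k ∧ HasCover μ ρ ε k), ENNReal.ofReal (Real.logb 2 k)

/-- A finite set of integers is `ε`-invariant if `|(S + 1) ∆ S| < ε |S|`. -/
def IsInvariantUpTo (ε : ℝ) (S : Finset ℤ) : Prop :=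
  (((S.image (fun m => m + 1)) ∆ S).card : ℝ) < ε * S.card

/-- The ratio of `a j i` to `b j i` tends to zero as `j → ∞`, uniformly in `i`. -/
def UniformlyNegligible {ι : ℕ → Type*} (a b : (j : ℕ) → ι j → ℝ≥0∞) : Prop :=
  ∀ η : ℝ, 0 < η → ∀ᶠ j in atTop, ∀ i : ι j, a j i / b j i < ENNReal.ofReal η

end ScalingEntropy

end

open scoped Topology

/-! ### Compactness: separation by finitely many coordinates. -/

namespace ScalingEntropy

/-! Fix a sequence `R` of bits and build random words recursively: a word of level `n + 1` is two
copies of one word of level `n` if `R n = true`, and two independent words otherwise. A word of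
level `n` then consists of `height R n` independent fair letters, each occurring `mult R n` times,
with `height * mult = 2 ^ n`. Together with a uniform position in the block this gives a central
measure, `pathLaw R`. It is realised by coordinates (colours, letters), the letters being indexed by
the xor of a place with the present position, so that `adic` acts as the dyadic odometer on colours
and as an xor translation on letters. Ergodicity (`ergodic_adic`) holds as soon as `R` is `false`
infinitely often: each such level halves the variance of the frequency of a fixed subword.

The averaged entropy over an almost invariant set `S` is comparable to `|S| / mult R L`, provided
that `S` is very invariant at scale `2 ^ L` and, for the lower bound, that no repetition occurs
between `L` and a level whose blocks are much longer than the extent of `S`.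

Upper bound (`epsEntropy_average_le`): up to an error of small integral, `ρ` is controlled by the
cylinders of a fixed level (`exists_cylinder_bound`). An itinerary of words of level `L` along `S`
passes through at most `2 |S| / 2 ^ L` blocks, each with at most `2 ^ height R L` possible words,
whence the bound `L + 2 |S| / mult R L`.

Lower bound (`le_epsEntropy_average`): since `ρ` is generating, a difference of present letters is
seen by `ρ` along finitely many shifts, outside a set of small measure (`exists_separating_shifts`).
A set of small diameter for the average therefore lies in a small Hamming ball of letters along `S`.
A Chernoff estimate (`expect_mismatch_le`) bounds its measure by `2 ^ (-|S| / (8 mult R L))`.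

It remains to take `R` to be `true` exactly at very sparse levels `r j` and to choose the indices `n
j` alternately with them (`exists_levels`). With `L = r j + 1` one has `mult R L = 2 ^ (j + 1)`.
This tends to infinity, so the entropy is negligible against `|S|`; and `φ (n j) ≥ 4 ^ j` outweighs
it, so `|S| / φ (n j)` is negligible against the entropy. -/

theorem exists_separating_coordinates {X ι κ : Type*} [MeasurableSpace X] [StandardBorelSpace X]
    [Countable ι] [Fintype κ] [MeasurableSpace κ] [MeasurableSingletonClass κ]
    {μ : Measure X} [IsFiniteMeasure μ]
    {F : X → ι → ℝ} (hF : Measurable F) {Y : Set X} (hY : MeasurableSet Y) (hμ : μ Yᶜ = 0)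
    (hinj : InjOn F Y) {l : X → κ} (hl : Measurable l) {δ : ℝ≥0∞} (hδ : δ ≠ 0) :
    ∃ (I : Finset ι) (r : ℝ) (G : Set X), 0 < r ∧ MeasurableSet G ∧ G ⊆ Y ∧ μ Gᶜ ≤ δ ∧
      ∀ x ∈ G, ∀ y ∈ G, l x ≠ l y → ∃ i ∈ I, r ≤ |F x i - F y i| := by
  classical
  set ν := μ.map F with hν
  let A : κ → Set X := fun k => Y ∩ l ⁻¹' {k}
  have hA : ∀ k, MeasurableSet (A k) := fun k => hY.inter (hl (measurableSet_singleton k))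
  -- Injective measurable images of Borel sets are Borel (Lusin–Souslin), so inner regularity of the
  -- law of `F` applies to them.
  have hB : ∀ k, MeasurableSet (F '' A k) := fun k =>
    (hA k).image_of_measurable_injOn hF (hinj.mono inter_subset_left)
  have hδ' : δ / (Fintype.card κ + 1) ≠ 0 := by
    simp only [ne_eq, ENNReal.div_eq_zero_iff, not_or]
    exact ⟨hδ, by finiteness⟩
  have hK : ∀ k, ∃ K ⊆ F '' A k, IsCompact K ∧ ν (F '' A k) < ν K + δ / (Fintype.card κ + 1) :=
    fun k => (hB k).exists_isCompact_lt_add (measure_ne_top _ _) hδ'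
  choose K hKs hKc hKm using hK
  have hlab : ∀ k, ∀ x ∈ Y, F x ∈ K k → l x = k := by
    intro k x hx hxk
    obtain ⟨y, ⟨hy, hyk⟩, he⟩ := hKs k hxk
    rw [← hinj hy hx he]; exact hyk
  -- The compact sets of different labels are disjoint, so every pair in `P` differs in some
  -- coordinate by more than some `1 / (n + 1)`. A finite subcover makes the coordinates finite in
  -- number and the gap uniform.
  let P : Set ((ι → ℝ) × (ι → ℝ)) := ⋃ p : {p : κ × κ // p.1 ≠ p.2}, K p.1.1 ×ˢ K p.1.2
  have hP : IsCompact P := isCompact_iUnion fun p => (hKc _).prod (hKc _)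
  let U : ι × ℕ → Set ((ι → ℝ) × (ι → ℝ)) := fun q => {u | 1 / ((q.2 : ℝ) + 1) < |u.1 q.1 - u.2 q.1|}
  have hU : ∀ q, IsOpen (U q) := fun q => isOpen_lt continuous_const (by fun_prop)
  have hPU : P ⊆ ⋃ q, U q := by
    intro u hu
    obtain ⟨⟨⟨k, k'⟩, hkk⟩, hu1, hu2⟩ := mem_iUnion.1 hu
    have hne : u.1 ≠ u.2 := by
      intro he
      obtain ⟨y, hy, hye⟩ := hKs k hu1
      obtain ⟨y', hy', hye'⟩ := hKs k' hu2
      have : y = y' := hinj hy.1 hy'.1 (by rw [hye, hye', he])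
      exact hkk (by have h1 := hy.2; have h2 := hy'.2; rw [this] at h1; exact h1.symm.trans h2)
    obtain ⟨i, hi⟩ := Function.ne_iff.1 hne
    obtain ⟨n, hn⟩ := exists_nat_one_div_lt (abs_pos.2 (sub_ne_zero.2 hi))
    exact mem_iUnion.2 ⟨(i, n), hn⟩
  obtain ⟨t, ht⟩ := hP.elim_finite_subcover U hU hPU
  let N := t.sup Prod.snd
  refine ⟨t.image Prod.fst, 1 / ((N : ℝ) + 1), ⋃ k, (A k ∩ F ⁻¹' K k), by positivity,
    MeasurableSet.iUnion fun k => (hA k).inter (hF (hKc k).measurableSet), ?_, ?_, ?_⟩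
  · exact iUnion_subset fun k => inter_subset_left.trans inter_subset_left
  · have hsub : (⋃ k, (A k ∩ F ⁻¹' K k))ᶜ ⊆ Yᶜ ∪ ⋃ k, F ⁻¹' (F '' A k \ K k) := by
      intro x hx
      by_cases hxY : x ∈ Y
      · right
        refine mem_iUnion.2 ⟨l x, ⟨x, ⟨hxY, rfl⟩, rfl⟩, fun hxK => hx ?_⟩
        exact mem_iUnion.2 ⟨l x, ⟨hxY, rfl⟩, hxK⟩
      · exact Or.inl hxY
    calc μ (⋃ k, (A k ∩ F ⁻¹' K k))ᶜ ≤ μ Yᶜ + ∑ k, μ (F ⁻¹' (F '' A k \ K k)) :=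
          (measure_mono hsub).trans ((measure_union_le _ _).trans
            (add_le_add le_rfl (measure_iUnion_fintype_le _ _)))
      _ ≤ 0 + ∑ k : κ, δ / (Fintype.card κ + 1) := by
          rw [hμ]
          gcongr with k
          rw [← Measure.map_apply hF ((hB k).diff (hKc k).measurableSet),
            measure_sdiff (hKs k) (hKc k).measurableSet.nullMeasurableSet (measure_ne_top _ _)]
          exact tsub_le_iff_left.2 (hKm k).le
      _ ≤ δ := by
          rw [zero_add, Finset.sum_const, Finset.card_univ, nsmul_eq_mul, mul_comm,
            ENNReal.div_eq_inv_mul, mul_comm _ δ, mul_assoc]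
          refine mul_le_of_le_one_right' ?_
          rw [mul_comm, ← ENNReal.div_eq_inv_mul.trans (mul_comm _ _)]
          exact ENNReal.div_le_of_le_mul (by rw [one_mul]; exact le_self_add)
  · intro x hx y hy hxy
    obtain ⟨k, hxk, hxK⟩ := mem_iUnion.1 hx
    obtain ⟨k', hyk, hyK⟩ := mem_iUnion.1 hy
    have hkk : k ≠ k' := by
      rw [← hlab k x hxk.1 hxK, ← hlab k' y hyk.1 hyK]; exact hxy
    have : (F x, F y) ∈ P := mem_iUnion.2 ⟨⟨(k, k'), hkk⟩, hxK, hyK⟩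
    obtain ⟨q, hq, hqU⟩ := mem_iUnion₂.1 (ht this)
    refine ⟨q.1, Finset.mem_image_of_mem _ hq, le_trans ?_ (le_of_lt hqU)⟩
    have : q.2 ≤ N := Finset.le_sup (f := Prod.snd) hq
    have : (q.2 : ℝ) ≤ N := by exact_mod_cast this
    gcongr

/-! ### Integer powers of an automorphism. -/

section act

variable {X : Type*} [MeasurableSpace X] (T : X ≃ᵐ X)

theorem act_zero (x : X) : act T 0 x = x := rfl

theorem act_one (x : X) : act T 1 x = T x := rfl

theorem act_add (m n : ℤ) (x : X) : act T (m + n) x = act T m (act T n x) := by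
  simp [act, zpow_add]

theorem measurePreserving_act {μ : Measure X} (hT : MeasurePreserving T μ μ) (m : ℤ) :
    MeasurePreserving (act T m) μ μ := by
  induction m using Int.induction_on with
  | zero => exact MeasurePreserving.id μ
  | succ n ih =>
    have : act T (n + 1) = act T n ∘ T := funext fun x => act_add T n 1 x
    rw [this]; exact ih.comp hT
  | pred n ih =>
    have : act T (-n - 1) = act T (-n) ∘ T.symm := funext fun x => act_add T (-n) (-1) x
    rw [this]; exact ih.comp (hT.symm T)

end act

/-! ### Consequences of admissibility, summability and generation. -/

section semimetric

variable {X : Type*} [MeasurableSpace X] {μ : Measure X} {ρ : X → X → ℝ}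

theorem IsMeasurableSemimetric.abs_sub_le (h : IsMeasurableSemimetric μ ρ) (d x y : X) :
    |ρ d x - ρ d y| ≤ ρ x y := by
  have h1 := h.triangle d x y
  have h2 := h.triangle d y x
  rw [h.symm x y] at *
  rw [abs_le]; constructor <;> linarith

/-- A dense sequence whose distance functions are measurable on a set of full measure. -/
theorem exists_dense_seq [IsProbabilityMeasure μ] (h : IsMeasurableSemimetric μ ρ)
    (ha : IsAdmissible μ ρ) :
    ∃ (d : ℕ → X) (g : ℕ → X → ℝ) (Y : Set X), (∀ i, Measurable (g i)) ∧ MeasurableSet Y ∧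
      μ Yᶜ = 0 ∧ (∀ x ∈ Y, ∀ i, g i x = ρ (d i) x) ∧
      ∀ x ∈ Y, ∀ r : ℝ, 0 < r → ∃ i, ρ (d i) x < r := by
  classical
  obtain ⟨X₀, hX₀, D, hD, hDc, hDd⟩ := ha
  have h1 : ∀ᵐ x ∂μ, AEMeasurable (ρ x) μ :=
    (h.aemeasurable.aestronglyMeasurable.prodMk_left).mono fun x hx => hx.aemeasurable
  set Z : Set X := X₀ ∩ {x | AEMeasurable (ρ x) μ} with hZ
  have hZμ : ∀ᵐ x ∂μ, x ∈ Z := by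
    filter_upwards [h1, (mem_ae_iff.2 hX₀ : X₀ ∈ ae μ)] with x h1 h2 using ⟨h2, h1⟩
  obtain ⟨y₀, hy₀⟩ := hZμ.exists
  obtain ⟨d₀, hd₀, -⟩ := hDd y₀ hy₀.1 1 one_pos
  obtain ⟨e, he⟩ := hDc.exists_eq_range ⟨d₀, hd₀⟩
  -- The sections of `ρ` at the dense points need not be measurable. Each dense point is replaced by
  -- nearby points of `Z`, one for every radius `1 / (n + 1)` at which such a point exists.
  have hf : ∀ p : ℕ × ℕ, ∃ z ∈ Z, ∀ y ∈ Z, ρ y (e p.1) < 1 / ((p.2 : ℝ) + 1) →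
      ρ z (e p.1) < 1 / ((p.2 : ℝ) + 1) := by
    intro p
    by_cases hp : ∃ y ∈ Z, ρ y (e p.1) < 1 / ((p.2 : ℝ) + 1)
    · obtain ⟨y, hy, hy'⟩ := hp
      exact ⟨y, hy, fun _ _ _ => hy'⟩
    · push Not at hp
      exact ⟨y₀, hy₀, fun y hy hlt => absurd hlt (not_lt.2 (hp y hy))⟩
  choose f hfZ hf using hf
  let d : ℕ → X := fun i => f (Nat.unpair i)
  have hd : ∀ i, AEMeasurable (ρ (d i)) μ := fun i => (hfZ _).2
  have hae : ∀ᵐ x ∂μ, x ∈ Z ∧ ∀ i, (hd i).mk (ρ (d i)) x = ρ (d i) x := by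
    filter_upwards [hZμ, ae_all_iff.2 fun i => (hd i).ae_eq_mk] with x hx h2
    exact ⟨hx, fun i => (h2 i).symm⟩
  have hsub := subset_toMeasurable μ {x | ¬ (x ∈ Z ∧ ∀ i, (hd i).mk (ρ (d i)) x = ρ (d i) x)}
  refine ⟨d, fun i => (hd i).mk _, (toMeasurable μ _)ᶜ, fun i => (hd i).measurable_mk,
    (measurableSet_toMeasurable μ _).compl, by rw [compl_compl, measure_toMeasurable]; exact hae,
    fun x hx i => ?_, fun x hx r hr => ?_⟩
  · by_contra hc
    exact hx (hsub fun hh => hc (hh.2 i))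
  · have hxZ : x ∈ Z := by
      by_contra hc
      exact hx (hsub fun hh => hc hh.1)
    obtain ⟨n, hn⟩ := exists_nat_one_div_lt (half_pos hr)
    obtain ⟨d', hd', hxd⟩ := hDd x hxZ.1 _ (by positivity : (0 : ℝ) < 1 / ((n : ℝ) + 1))
    obtain ⟨i, rfl⟩ : d' ∈ range e := he ▸ hd'
    refine ⟨Nat.pair i n, ?_⟩
    have h3 := hf (i, n) x hxZ hxd
    simp only [d, Nat.unpair_pair]
    calc ρ (f (i, n)) x ≤ ρ (f (i, n)) (e i) + ρ (e i) x := h.triangle _ _ _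
      _ < r := by rw [h.symm (e i) x]; dsimp only at h3; linarith

/-- Outside a set of small measure, a generating semimetric separates, along finitely many shifts
and by a definite amount, the points distinguished by a given two-valued function. -/
theorem exists_separating_shifts [StandardBorelSpace X] [IsProbabilityMeasure μ] {T : X ≃ᵐ X}
    (hT : MeasurePreserving T μ μ)
    (h : IsMeasurableSemimetric μ ρ) (ha : IsAdmissible μ ρ) (hg : IsGenerating μ T ρ)
    {b : X → Bool} (hb : Measurable b) {δ : ℝ≥0∞} (hδ : δ ≠ 0) :
    ∃ (J : Finset ℤ) (r : ℝ) (G : Set X), 0 < r ∧ MeasurableSet G ∧ μ Gᶜ ≤ δ ∧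
      ∀ x ∈ G, ∀ y ∈ G, b x ≠ b y → ∃ l ∈ J, r ≤ ρ (act T l x) (act T l y) := by
  classical
  obtain ⟨d, g, Y, hgm, hY, hYμ, hgρ, hdense⟩ := exists_dense_seq h ha
  obtain ⟨X₀, hX₀, hsep⟩ := hg
  have hact := measurePreserving_act T hT
  let F : X → ℕ × ℤ → ℝ := fun x q => g q.1 (act T q.2 x)
  have hF : Measurable F := measurable_pi_lambda _ fun q => (hgm _).comp (hact _).measurable
  let Z : Set X := (toMeasurable μ X₀ᶜ)ᶜ ∩ ⋂ l : ℤ, act T l ⁻¹' Y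
  have hZ : MeasurableSet Z := (measurableSet_toMeasurable μ _).compl.inter
    (MeasurableSet.iInter fun l => (hact l).measurable hY)
  have hZμ : μ Zᶜ = 0 := by
    simp only [Z, compl_inter, compl_iInter, compl_compl]
    refine measure_union_null (by rw [measure_toMeasurable, hX₀]) (measure_iUnion_null fun l => ?_)
    rw [← preimage_compl, (hact l).measure_preimage hY.compl.nullMeasurableSet, hYμ]
  -- Equal distances to all `d i` force the distance of `T ^ m x` and `T ^ m y` to be at most twice
  -- the distance from `T ^ m x` to the dense sequence, hence zero for every `m`.
  have hinj : InjOn F Z := by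
    intro x hx y hy hxy
    by_contra hne
    have hx0 : x ∈ X₀ := by
      by_contra hc; exact hx.1 (subset_toMeasurable _ _ hc)
    have hy0 : y ∈ X₀ := by
      by_contra hc; exact hy.1 (subset_toMeasurable _ _ hc)
    obtain ⟨m, hm⟩ := hsep x hx0 y hy0 hne
    have hxm : act T m x ∈ Y := mem_iInter.1 hx.2 m
    have hym : act T m y ∈ Y := mem_iInter.1 hy.2 m
    obtain ⟨i, hi⟩ := hdense _ hxm _ (half_pos hm)
    have h1 : ρ (d i) (act T m x) = ρ (d i) (act T m y) := by
      rw [← hgρ _ hxm, ← hgρ _ hym]; exact congrFun hxy (i, m)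
    have h2 := h.triangle (act T m x) (d i) (act T m y)
    rw [h.symm _ (d i)] at h2
    linarith
  obtain ⟨I, r, G, hr, hG, hGZ, hGμ, hGs⟩ :=
    exists_separating_coordinates hF hZ hZμ hinj hb hδ
  refine ⟨I.image Prod.snd, r, G, hr, hG, hGμ, fun x hx y hy hxy => ?_⟩
  obtain ⟨q, hq, hqr⟩ := hGs x hx y hy hxy
  refine ⟨q.2, Finset.mem_image_of_mem _ hq, hqr.trans ?_⟩
  simp only [F]
  rw [hgρ _ (mem_iInter.1 (hGZ hx).2 q.2), hgρ _ (mem_iInter.1 (hGZ hy).2 q.2)]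
  exact h.abs_sub_le _ _ _

/-- Up to an error with small integral, an admissible summable semimetric is dominated by the
partition into the cylinders of a sufficiently high level. -/
theorem exists_cylinder_bound [StandardBorelSpace X] [IsProbabilityMeasure μ]
    (h : IsMeasurableSemimetric μ ρ) (ha : IsAdmissible μ ρ) (hs : IsSummable μ ρ)
    {Φ : X → ℕ → Bool} (hΦ : Measurable Φ) (hinj : Function.Injective Φ) {δ : ℝ} (hδ : 0 < δ)
    {η : ℝ≥0∞} (hη : η ≠ 0) :
    ∃ (N : ℕ) (w : X → ℝ≥0∞), Measurable w ∧ ∫⁻ x, w x ∂μ ≤ η ∧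
      ∀ x y, (∀ i < N, Φ x i = Φ y i) → ENNReal.ofReal (ρ x y) ≤ ENNReal.ofReal δ + w x + w y := by
  classical
  obtain ⟨d, g, Y, hgm, hY, hYμ, hgρ, hdense⟩ := exists_dense_seq h ha
  -- an integrable distance function
  obtain ⟨z, f, hf, hfint, hfz⟩ : ∃ (z : X) (f : X → ℝ≥0∞), Measurable f ∧ ∫⁻ x, f x ∂μ ≠ ∞ ∧
      ∀ᵐ x ∂μ, f x = ENNReal.ofReal (ρ z x) := by
    obtain ⟨z, hz⟩ := (hs.prod_right_ae).exists
    have hm : AEMeasurable (fun x => ENNReal.ofReal (ρ z x)) μ :=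
      hz.aestronglyMeasurable.aemeasurable.ennreal_ofReal
    refine ⟨z, hm.mk _, hm.measurable_mk, ?_, hm.ae_eq_mk.symm⟩
    rw [← lintegral_congr_ae hm.ae_eq_mk]
    exact ((lintegral_ofReal_le_lintegral_enorm _).trans_lt hz.2).ne
  obtain ⟨κ, hκ, hκf⟩ := exists_pos_setLIntegral_lt_of_measure_lt hfint
    (ε := η / 2) (ENNReal.half_pos hη).ne'
  -- the height above which `f` has a small integral
  obtain ⟨C, hC⟩ : ∃ C : ℕ, μ {x | (C : ℝ≥0∞) < f x} < κ := by
    have hlt : ∀ᵐ x ∂μ, f x < ∞ := ae_lt_top hf hfint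
    have ht := tendsto_measure_iInter_atTop (μ := μ) (s := fun C : ℕ => {x | (C : ℝ≥0∞) < f x})
      (fun C => (measurableSet_lt measurable_const hf).nullMeasurableSet)
      (fun a b hab x (hx : (b : ℝ≥0∞) < f x) => show (a : ℝ≥0∞) < f x from
        lt_of_le_of_lt (by exact_mod_cast hab) hx) ⟨0, measure_ne_top _ _⟩
    have h0 : μ (⋂ C : ℕ, {x | (C : ℝ≥0∞) < f x}) = 0 := by
      refine measure_mono_null (fun x hx => ?_) hlt
      intro hx'
      obtain ⟨n, hn⟩ := ENNReal.exists_nat_gt hx'.ne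
      exact absurd (mem_iInter.1 hx n) (not_lt.2 hn.le)
    rw [h0] at ht
    exact ((tendsto_order.1 ht).2 κ hκ).exists
  -- Chosen so that the constant `2 * C` on a set of measure `θ` costs at most `η / 2`.
  set θ : ℝ≥0∞ := η / 2 / (2 * C + 1) with hθ
  have hθ0 : θ ≠ 0 := by
    simp only [hθ, ne_eq, ENNReal.div_eq_zero_iff, not_or]
    refine ⟨⟨hη, by finiteness⟩, by finiteness⟩
  -- finitely many balls cover up to a small set
  obtain ⟨p, hp⟩ : ∃ p : ℕ, μ {x | ∀ i < p, δ / 2 ≤ g i x} < θ / 2 := by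
    have ht := tendsto_measure_iInter_atTop (μ := μ)
      (s := fun p : ℕ => {x | ∀ i < p, δ / 2 ≤ g i x})
      (fun p => by
        have : {x | ∀ i < p, δ / 2 ≤ g i x} = ⋂ i, ⋂ _ : i < p, {x | δ / 2 ≤ g i x} := by
          ext; simp
        rw [this]
        exact (MeasurableSet.iInter fun i => MeasurableSet.iInter fun _ =>
          measurableSet_le measurable_const (hgm i)).nullMeasurableSet)
      (fun a b hab x hx i hi => hx i (hi.trans_le hab)) ⟨0, measure_ne_top _ _⟩
    have h0 : μ (⋂ p : ℕ, {x | ∀ i < p, δ / 2 ≤ g i x}) = 0 := by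
      refine measure_mono_null (fun x hx => show x ∉ Y from fun hxY => ?_) hYμ
      obtain ⟨i, hi⟩ := hdense x hxY _ (half_pos hδ)
      have := mem_iInter.1 hx (i + 1) i (Nat.lt_succ_self i)
      rw [hgρ x hxY] at this
      linarith
    rw [h0] at ht
    exact ((tendsto_order.1 ht).2 _ (ENNReal.half_pos hθ0)).exists
  let F : X → ℕ → ℝ := fun x i => if Φ x i = true then 1 else 0
  have hΦi : ∀ i, MeasurableSet {x | Φ x i = true} := fun i =>
    ((measurable_pi_apply i).comp hΦ) (measurableSet_singleton true)
  have hF : Measurable F := measurable_pi_lambda _ fun i =>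
    Measurable.ite (hΦi i) measurable_const measurable_const
  have hFi : ∀ x y i, Φ x i = Φ y i ↔ F x i = F y i := by
    intro x y i
    simp only [F]
    cases Φ x i <;> cases Φ y i <;> simp
  have hFinj : InjOn F Y := fun x _ y _ hxy =>
    hinj (funext fun i => (hFi x y i).2 (congrFun hxy i))
  -- The label records which of the first `p` balls of radius `δ / 2` contain the point. Two points
  -- with the same label in a common ball are at distance less than `δ`.
  let l : X → Fin p → Bool := fun x i => if g i x < δ / 2 then true else false
  have hl : Measurable l := measurable_pi_lambda _ fun i =>
    Measurable.ite (measurableSet_lt (hgm i) measurable_const) measurable_const measurable_const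
  obtain ⟨I, r, G, hr, hG, hGY, hGμ, hGs⟩ :=
    exists_separating_coordinates hF hY hYμ hFinj hl (ENNReal.half_pos hθ0).ne'
  let E : Set X := Gᶜ ∪ {x | ∀ i < p, δ / 2 ≤ g i x}
  have hEμ : μ E ≤ θ := (measure_union_le _ _).trans
    ((add_le_add hGμ hp.le).trans (ENNReal.add_halves θ).le)
  have hnull : μ {x | ¬ f x = ENNReal.ofReal (ρ z x)} = 0 := hfz
  let Q := toMeasurable μ {x | ¬ f x = ENNReal.ofReal (ρ z x)}
  have hQ : μ Q = 0 := by rw [measure_toMeasurable, hnull]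
  let E' := toMeasurable μ E
  -- If one of two points lies in `E`, their distance is at most `f x + f y`. The parts below height
  -- `C` cost `2 * C` in all, charged to a point of `E`; the parts above are paid by each point
  -- separately. The infinite value on the null set `Q` disposes of the points where `f` is not the
  -- distance to `z`.
  let w : X → ℝ≥0∞ := fun x => E'.indicator (fun _ => 2 * (C : ℝ≥0∞)) x +
    {x | (C : ℝ≥0∞) < f x}.indicator f x + Q.indicator (fun _ => ∞) x
  have hCm : MeasurableSet {x | (C : ℝ≥0∞) < f x} := measurableSet_lt measurable_const hf
  have hw1 : Measurable (E'.indicator (fun _ : X => 2 * (C : ℝ≥0∞))) :=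
    measurable_const.indicator (measurableSet_toMeasurable _ _)
  have hw2 : Measurable ({x | (C : ℝ≥0∞) < f x}.indicator f) := hf.indicator hCm
  have hw3 : Measurable (Q.indicator (fun _ : X => ∞)) :=
    measurable_const.indicator (measurableSet_toMeasurable _ _)
  refine ⟨I.sup id + 1, w, (hw1.add hw2).add hw3, ?_, ?_⟩
  · simp only [w]
    rw [lintegral_add_right _ hw3, lintegral_add_right _ hw2,
      lintegral_indicator (measurableSet_toMeasurable _ _), lintegral_indicator hCm,
      lintegral_indicator (measurableSet_toMeasurable _ _), setLIntegral_const, setLIntegral_const,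
      hQ, mul_zero, add_zero, measure_toMeasurable, ← ENNReal.add_halves η]
    gcongr
    · calc 2 * (C : ℝ≥0∞) * μ E ≤ (2 * C + 1) * θ := by gcongr; exact le_self_add
        _ = η / 2 := ENNReal.mul_div_cancel (by simp) (by finiteness)
    · exact (hκf _ hC).le
  · intro x y hxy
    by_cases hxQ : x ∈ Q
    · simp [w, hxQ]
    by_cases hyQ : y ∈ Q
    · simp [w, hyQ]
    have hxf : f x = ENNReal.ofReal (ρ z x) := by
      by_contra hc; exact hxQ (subset_toMeasurable _ _ hc)
    have hyf : f y = ENNReal.ofReal (ρ z y) := by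
      by_contra hc; exact hyQ (subset_toMeasurable _ _ hc)
    by_cases hE : x ∈ E ∨ y ∈ E
    · have h1 : ENNReal.ofReal (ρ x y) ≤ f x + f y := by
        rw [hxf, hyf, ← ENNReal.ofReal_add (h.nonneg _ _) (h.nonneg _ _)]
        refine ENNReal.ofReal_le_ofReal ?_
        have := h.triangle x z y
        rwa [h.symm x z] at this
      have h2 : ∀ u, f u ≤ C + {x | (C : ℝ≥0∞) < f x}.indicator f u := by
        intro u
        by_cases hu : (C : ℝ≥0∞) < f u
        · rw [indicator_of_mem (by exact hu)]; exact le_add_self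
        · exact (not_lt.1 hu).trans le_self_add
      have h3 : 2 * (C : ℝ≥0∞) ≤ E'.indicator (fun _ => 2 * (C : ℝ≥0∞)) x +
          E'.indicator (fun _ => 2 * (C : ℝ≥0∞)) y := by
        rcases hE with hE | hE
        · rw [indicator_of_mem (subset_toMeasurable _ _ hE)]; exact le_self_add
        · rw [indicator_of_mem (a := y) (subset_toMeasurable _ _ hE)]; exact le_add_self
      calc ENNReal.ofReal (ρ x y) ≤ f x + f y := h1
        _ ≤ (C + {x | (C : ℝ≥0∞) < f x}.indicator f x) +
            (C + {x | (C : ℝ≥0∞) < f x}.indicator f y) := add_le_add (h2 x) (h2 y)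
        _ = 2 * C + {x | (C : ℝ≥0∞) < f x}.indicator f x +
            {x | (C : ℝ≥0∞) < f x}.indicator f y := by ring
        _ ≤ (E'.indicator (fun _ => 2 * (C : ℝ≥0∞)) x +
          E'.indicator (fun _ => 2 * (C : ℝ≥0∞)) y) + {x | (C : ℝ≥0∞) < f x}.indicator f x +
            {x | (C : ℝ≥0∞) < f x}.indicator f y := by gcongr
        _ = (E'.indicator (fun _ => 2 * (C : ℝ≥0∞)) x + {x | (C : ℝ≥0∞) < f x}.indicator f x) +
          (E'.indicator (fun _ => 2 * (C : ℝ≥0∞)) y +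
            {x | (C : ℝ≥0∞) < f x}.indicator f y) := by ring
        _ ≤ w x + w y := add_le_add le_self_add le_self_add
        _ ≤ ENNReal.ofReal δ + w x + w y := add_le_add le_add_self le_rfl
    · push Not at hE
      obtain ⟨hxE, hyE⟩ := hE
      simp only [E, mem_union, mem_compl_iff, not_or, not_not, mem_ofPred_eq, not_forall,
        not_le] at hxE hyE
      have hlxy : l x = l y := by
        by_contra hne
        obtain ⟨i, hi, hir⟩ := hGs x hxE.1 y hyE.1 hne
        have hiN : i < I.sup id + 1 := Nat.lt_succ_of_le (Finset.le_sup (f := id) hi)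
        rw [(hFi x y i).1 (hxy i hiN), sub_self, abs_zero] at hir
        linarith
      obtain ⟨i, hi, hix⟩ := hxE.2
      have hiy : g i y < δ / 2 := by
        have := congrFun hlxy ⟨i, hi⟩
        simp only [l, hix, if_true] at this
        by_contra hc
        simp [hc] at this
      rw [hgρ _ (hGY hxE.1)] at hix
      rw [hgρ _ (hGY hyE.1)] at hiy
      have h1 := h.triangle x (d i) y
      rw [h.symm x (d i)] at h1
      calc ENNReal.ofReal (ρ x y) ≤ ENNReal.ofReal δ := ENNReal.ofReal_le_ofReal (by linarith)
        _ ≤ _ := by rw [add_assoc]; exact le_self_add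

end semimetric

end ScalingEntropy

namespace PairsGraph

/-! ### Words -/

/-- The position in a word of length `2 ^ (n + 1)` of the `i`-th letter of one of its halves. -/
def halfIdx {n : ℕ} (c : Bool) (i : Fin (2 ^ n)) : Fin (2 ^ (n + 1)) :=
  ⟨(if c then 2 ^ n else 0) + i.val, by
    have h := i.isLt
    have h2 : 2 ^ (n + 1) = 2 ^ n + 2 ^ n := by ring
    split <;> omega⟩

theorem half_apply {n : ℕ} (c : Bool) (v : Vertex (n + 1)) (i : Fin (2 ^ n)) :
    half c v i = v (halfIdx c i) := rfl

/-- The concatenation of two words. -/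
def join {n : ℕ} (u v : Vertex n) : Vertex (n + 1) := fun i =>
  if h : i.val < 2 ^ n then u ⟨i, h⟩ else v ⟨i - 2 ^ n, by
    have h1 := i.isLt
    have h2 : 2 ^ (n + 1) = 2 ^ n + 2 ^ n := by ring
    omega⟩

@[simp] theorem half_false_join {n : ℕ} (u v : Vertex n) : half false (join u v) = u := by
  funext i
  simp [half, join]

@[simp] theorem half_true_join {n : ℕ} (u v : Vertex n) : half true (join u v) = v := by
  funext i
  simp [half, join]

@[simp] theorem join_half {n : ℕ} (w : Vertex (n + 1)) : join (half false w) (half true w) = w := by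
  funext i
  by_cases h : i.val < 2 ^ n
  · simp [half, join, h]
  · simp only [join, h, half, dite_false]
    congr 1
    ext
    simp only [if_true]
    omega

/-- A word is the concatenation of its two halves. -/
def vertexEquiv (n : ℕ) : Vertex (n + 1) ≃ Vertex n × Vertex n where
  toFun w := (half false w, half true w)
  invFun p := join p.1 p.2
  left_inv := join_half
  right_inv p := by simp

theorem sum_vertex_succ {M : Type*} [AddCommMonoid M] {n : ℕ} (F : Vertex (n + 1) → M) :
    ∑ w, F w = ∑ u : Vertex n, ∑ v : Vertex n, F (join u v) := by
  rw [← Fintype.sum_prod_type', ← (vertexEquiv n).symm.sum_comp]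
  rfl

theorem sum_fin_two_pow_succ {M : Type*} [AddCommMonoid M] {n : ℕ} (f : Fin (2 ^ (n + 1)) → M) :
    ∑ i, f i = ∑ i : Fin (2 ^ n), f (halfIdx false i) + ∑ i : Fin (2 ^ n), f (halfIdx true i) := by
  have h2 : 2 ^ n + 2 ^ n = 2 ^ (n + 1) := by ring
  rw [← (finCongr h2).sum_comp, Fin.sum_univ_add]
  congr 1
  all_goals exact Finset.sum_congr rfl fun i _ => congrArg f (Fin.ext (by simp [halfIdx]))

theorem card_filter_fin_two_pow_succ {n : ℕ} (P : Fin (2 ^ (n + 1)) → Prop) [DecidablePred P] :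
    (Finset.univ.filter P).card = (Finset.univ.filter fun i => P (halfIdx false i)).card +
      (Finset.univ.filter fun i => P (halfIdx true i)).card := by
  simp only [Finset.card_filter]
  exact sum_fin_two_pow_succ _

/-! ### The distributions of the words -/

/-- The distribution of the word of level `n`: a word of level `n + 1` consists of two copies of
the same word if `R n = true` and of two independent words otherwise. -/
noncomputable def mass (R : ℕ → Bool) : (n : ℕ) → Vertex n → ℝ
  | 0, _ => 1 / 2
  | n + 1, w => if R n then
      (if half false w = half true w then mass R n (half false w) else 0)
      else mass R n (half false w) * mass R n (half true w)

/-- The expectation with respect to the distribution of the word of level `n`. -/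
noncomputable def expect (R : ℕ → Bool) (n : ℕ) (F : Vertex n → ℝ) : ℝ := ∑ w, mass R n w * F w

variable {R : ℕ → Bool} {n : ℕ}

theorem mass_nonneg (w : Vertex n) : 0 ≤ mass R n w := by
  induction n with
  | zero => norm_num [mass]
  | succ n ih =>
    rw [mass]
    split_ifs
    · exact ih _
    · exact le_rfl
    · exact mul_nonneg (ih _) (ih _)

theorem expect_succ_of_true (h : R n = true) (F : Vertex (n + 1) → ℝ) :
    expect R (n + 1) F = expect R n fun u => F (join u u) := by
  simp only [expect, sum_vertex_succ, mass, h, if_true, half_false_join, half_true_join]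
  refine Finset.sum_congr rfl fun u _ => ?_
  simp [ite_mul]

theorem expect_succ_of_false (h : R n = false) (F : Vertex (n + 1) → ℝ) :
    expect R (n + 1) F = expect R n fun u => expect R n fun v => F (join u v) := by
  simp [expect, sum_vertex_succ, mass, h, Finset.mul_sum, mul_assoc]

theorem expect_mono {F G : Vertex n → ℝ} (h : ∀ w, F w ≤ G w) : expect R n F ≤ expect R n G :=
  Finset.sum_le_sum fun w _ => mul_le_mul_of_nonneg_left (h w) (mass_nonneg w)

theorem expect_nonneg {F : Vertex n → ℝ} (h : ∀ w, 0 ≤ F w) : 0 ≤ expect R n F :=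
  Finset.sum_nonneg fun w _ => mul_nonneg (mass_nonneg w) (h w)

theorem expect_add (F G : Vertex n → ℝ) :
    expect R n (fun w => F w + G w) = expect R n F + expect R n G := by
  simp [expect, mul_add, Finset.sum_add_distrib]

theorem expect_const_mul (c : ℝ) (F : Vertex n → ℝ) :
    expect R n (fun w => c * F w) = c * expect R n F := by
  simp only [expect, Finset.mul_sum]
  exact Finset.sum_congr rfl fun w _ => by ring

theorem expect_mul_const (F : Vertex n → ℝ) (c : ℝ) :
    expect R n (fun w => F w * c) = expect R n F * c := by
  rw [mul_comm, ← expect_const_mul]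
  simp only [mul_comm]

theorem expect_const (c : ℝ) : expect R n (fun _ => c) = c := by
  induction n with
  | zero =>
    simp [expect, mass]
  | succ n ih =>
    cases h : R n
    · simp [expect_succ_of_false h, ih]
    · simp [expect_succ_of_true h, ih]

theorem sum_mass : ∑ w, mass R n w = 1 := by
  simpa [expect] using expect_const (R := R) (n := n) 1

/-- The number of independent letters in the word of level `n`. -/
def height (R : ℕ → Bool) : ℕ → ℕ
  | 0 => 1
  | n + 1 => if R n then height R n else 2 * height R n

/-- The number of times each independent letter occurs in the word of level `n`. -/
def mult (R : ℕ → Bool) : ℕ → ℕ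
  | 0 => 1
  | n + 1 => if R n then 2 * mult R n else mult R n

theorem height_mul_mult (n : ℕ) : height R n * mult R n = 2 ^ n := by
  induction n with
  | zero => rfl
  | succ n ih =>
    rw [height, mult, pow_succ, ← ih]
    split_ifs <;> ring

theorem mult_pos (n : ℕ) : 0 < mult R n :=
  Nat.pos_of_ne_zero fun h => by
    have := height_mul_mult (R := R) n
    rw [h, mul_zero] at this
    exact (pow_ne_zero n two_ne_zero) this.symm

theorem mass_eq_zero_or (w : Vertex n) : mass R n w = 0 ∨ mass R n w = (1 / 2) ^ height R n := by
  induction n with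
  | zero => right; simp [mass, height]
  | succ n ih =>
    rw [mass, height]
    split_ifs
    · exact ih _
    · exact Or.inl rfl
    · rcases ih (half false w) with h | h <;> rcases ih (half true w) with h' | h' <;>
        simp [h, h', two_mul, pow_add]

/-- Each word of positive mass has mass exactly `2 ^ (-height)`, and the total mass is `1`. -/
theorem card_support_mass_le (n : ℕ) :
    Fintype.card {w : Vertex n // mass R n w ≠ 0} ≤ 2 ^ height R n := by
  classical
  have h1 : ∑ w : {w : Vertex n // mass R n w ≠ 0}, mass R n w ≤ 1 := by
    rw [← sum_mass (R := R) (n := n), ← Finset.sum_subtype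
      (Finset.univ.filter fun w => mass R n w ≠ 0) (by simp) (mass R n)]
    exact Finset.sum_le_univ_sum_of_nonneg fun w => mass_nonneg w
  have h2 : ∀ w : {w : Vertex n // mass R n w ≠ 0}, mass R n w = (1 / 2) ^ height R n :=
    fun w => (mass_eq_zero_or _).resolve_left w.2
  simp only [h2, Finset.sum_const, Finset.card_univ, nsmul_eq_mul] at h1
  rw [one_div, inv_pow, ← div_eq_mul_inv, div_le_one (by positivity)] at h1
  exact_mod_cast h1

/-! ### Large deviations -/

/-- The number of positions in `A` at which the words `t` and `w` differ. -/
def mismatch {n : ℕ} (A t w : Vertex n) : ℕ :=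
  (Finset.univ.filter fun q => A q = true ∧ w q ≠ t q).card

theorem mismatch_succ (A t w : Vertex (n + 1)) :
    mismatch A t w = mismatch (half false A) (half false t) (half false w) +
      mismatch (half true A) (half true t) (half true w) :=
  card_filter_fin_two_pow_succ _

/-- An exponentially decreasing function of the density `d / m`. -/
noncomputable def weight (m d : ℕ) : ℝ := (1 / 4 : ℝ) ^ ((d : ℝ) / m)

theorem weight_nonneg (m d : ℕ) : 0 ≤ weight m d := by unfold weight; positivity

theorem weight_le_one (m d : ℕ) : weight m d ≤ 1 :=
  Real.rpow_le_one (by norm_num) (by norm_num) (by positivity)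

theorem weight_add (m d e : ℕ) : weight m (d + e) = weight m d * weight m e := by
  unfold weight
  rw [← Real.rpow_add (by norm_num)]
  push_cast
  ring_nf

/-- Squaring compensates the doubling of the multiplicity at a repeated level. -/
theorem weight_two_mul_sq (m d : ℕ) : weight (2 * m) d ^ 2 = weight m d := by
  unfold weight
  rw [← Real.rpow_natCast, ← Real.rpow_mul (by norm_num)]
  push_cast
  congr 1
  rw [mul_comm (2 : ℝ), ← div_div, div_mul_cancel₀ _ two_ne_zero]

/-- The exponential moment for Chernoff's method, uniform in `t`. A single fair letter gives `(1 + 1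
/ 4) / 2 = 5 / 8`, and independent halves multiply. For a repeated half, the two copies are compared
with possibly different halves of `t`; `2ab ≤ a² + b²` decouples them, and squaring turns the weight
for `2 * m` into the weight for `m`. -/
theorem expect_weight_le (t : Vertex n) :
    expect R n (fun w => weight (mult R n) (mismatch (fun _ => true) t w)) ≤
      (5 / 8) ^ height R n := by
  induction n with
  | zero =>
    have e : ∀ w : Vertex 0, w = fun _ => w 0 := fun w => funext fun i => by
      congr 1; exact Fin.ext (by have := i.isLt; omega)
    have h : ∀ w : Vertex 0, mismatch (fun _ => true) t w = if w 0 = t 0 then 0 else 1 := by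
      intro w
      rw [e w, e t]
      unfold mismatch
      split_ifs with h <;> simp [h]
    have hu : (Finset.univ : Finset (Vertex 0)) = {fun _ => true, fun _ => false} := by
      ext w
      rw [e w]
      cases w 0 <;> simp
    have hne : (fun _ => true : Vertex 0) ≠ fun _ => false := fun h => by
      simpa using congrFun h 0
    simp only [expect, h, hu, mass, height, mult, weight, Finset.sum_pair hne]
    cases t 0 <;> norm_num
  | succ n ih =>
    cases h : R n
    · rw [expect_succ_of_false h]
      simp only [mismatch_succ, half_false_join, half_true_join, weight_add, mult, h, height,
        Bool.false_eq_true, if_false]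
      simp only [expect_const_mul, expect_mul_const]
      refine (mul_le_mul (ih _) (ih _) (expect_nonneg fun _ => weight_nonneg _ _)
        (by positivity)).trans (le_of_eq ?_)
      exact (two_mul (height R n)) ▸ (pow_add _ _ _).symm
    · rw [expect_succ_of_true h]
      simp only [mismatch_succ, half_false_join, half_true_join, weight_add, mult, h, height,
        if_true]
      calc _ ≤ expect R n fun w => (1 / 2) * weight (mult R n)
              (mismatch (half false fun _ => true) (half false t) w) + (1 / 2) *
              weight (mult R n) (mismatch (half true fun _ => true) (half true t) w) := by
            refine expect_mono fun w => ?_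
            have h1 := weight_two_mul_sq (mult R n)
              (mismatch (half false fun _ => true) (half false t) w)
            have h2 := weight_two_mul_sq (mult R n)
              (mismatch (half true fun _ => true) (half true t) w)
            nlinarith [sq_nonneg (weight (2 * mult R n) (mismatch (half false fun _ => true)
              (half false t) w) - weight (2 * mult R n) (mismatch (half true fun _ => true)
              (half true t) w))]
        _ ≤ _ := by
            rw [expect_add, expect_const_mul, expect_const_mul]
            have h1 := ih (half false t)
            have h2 := ih (half true t)
            have e : ∀ c, half c (fun _ : Fin (2 ^ (n + 1)) => true) = fun _ => true := fun _ => rfl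
            rw [e, e]
            linarith

/-- The number of blocks of level `L` that are contained in a subset of a block of level
`L + k`. -/
def fullCount (L : ℕ) : (k : ℕ) → Vertex (L + k) → ℕ
  | 0, A => if ∀ q, A q = true then 1 else 0
  | k + 1, A => fullCount L k (half (n := L + k) false A) + fullCount L k (half (n := L + k) true A)

theorem mult_add {L k : ℕ} (h : ∀ i, L ≤ i → i < L + k → R i = false) :
    mult R (L + k) = mult R L := by
  induction k with
  | zero => rfl
  | succ k ih =>
    rw [← add_assoc, mult, h (L + k) (by omega) (by omega)]
    exact ih fun i h1 h2 => h i h1 (by omega)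

/-- Above level `L` the blocks are independent, so the moments multiply. A block inside `A`
contributes the factor of `expect_weight_le`; any other block is bounded by `1`. -/
theorem expect_weight_le_fullCount {L k : ℕ} (h : ∀ i, L ≤ i → i < L + k → R i = false)
    (A t : Vertex (L + k)) :
    expect R (L + k) (fun w => weight (mult R L) (mismatch A t w)) ≤
      (5 / 8) ^ (height R L * fullCount L k A) := by
  induction k with
  | zero =>
    rw [fullCount]
    split_ifs with hA
    · obtain rfl : A = fun _ => true := funext hA
      rw [mul_one]
      exact expect_weight_le t
    · rw [mul_zero, pow_zero, ← expect_const (R := R) (n := L + 0) 1]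
      exact expect_mono fun w => weight_le_one _ _
  | succ k ih =>
    have ih := ih fun i h1 h2 => h i h1 (by omega)
    have h0 : R (L + k) = false := h _ (by omega) (by omega)
    change expect R (L + k + 1) _ ≤ _
    rw [expect_succ_of_false h0]
    simp only [mismatch_succ, half_false_join, half_true_join, weight_add]
    simp only [expect_const_mul, expect_mul_const]
    rw [fullCount, mul_add, pow_add]
    exact mul_le_mul (ih _ _) (ih _ _) (expect_nonneg fun _ => weight_nonneg _ _) (by positivity)

/-- The places counted are those whose whole block of length `2 ^ L` lies in `A`. This connects the
recursive count with the description of blocks by quotients, which suits sets of integers. -/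
theorem card_full_le {L k : ℕ} (A : Vertex (L + k)) :
    (Finset.univ.filter fun q : Fin (2 ^ (L + k)) => ∀ q' : Fin (2 ^ (L + k)),
      q'.val / 2 ^ L = q.val / 2 ^ L → A q' = true).card ≤ fullCount L k A * 2 ^ L := by
  induction k with
  | zero =>
    rw [fullCount]
    split_ifs with hA
    · refine (Finset.card_le_univ _).trans ?_
      simp
    · rw [zero_mul, Nat.le_zero, Finset.card_eq_zero, Finset.filter_eq_empty_iff]
      intro q _ hq
      refine hA fun q' => hq q' ?_
      exact (Nat.div_eq_of_lt q'.isLt).trans (Nat.div_eq_of_lt q.isLt).symm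
  | succ k ih =>
    have hd : 2 ^ (L + k) = 2 ^ L * 2 ^ k := pow_add _ _ _
    rw [fullCount, add_mul, card_filter_fin_two_pow_succ (n := L + k)]
    refine add_le_add (le_trans (Finset.card_le_card ?_) (ih _))
      (le_trans (Finset.card_le_card ?_) (ih _)) <;>
    · intro q hq
      simp only [Finset.mem_filter, Finset.mem_univ, true_and] at hq ⊢
      intro q' hq'
      rw [half_apply]
      apply hq
      simp [halfIdx, hd, Nat.mul_add_div, hq']

/-- Words close to a given one, in the Hamming distance on a set consisting mostly of whole blocks,
have small probability. -/
theorem expect_mismatch_le {L k : ℕ} (h : ∀ i, L ≤ i → i < L + k → R i = false)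
    (A t : Vertex (L + k)) {s : ℕ} (hs : s ≤ 2 * (Finset.univ.filter fun q : Fin (2 ^ (L + k)) =>
      ∀ q' : Fin (2 ^ (L + k)), q'.val / 2 ^ L = q.val / 2 ^ L → A q' = true).card) :
    expect R (L + k) (fun w => if 16 * mismatch A t w ≤ s then 1 else 0) ≤
      (1 / 2 : ℝ) ^ ((s : ℝ) / (8 * mult R L)) := by
  set m := mult R L with hm
  have hm0 : (0 : ℝ) < m := by exact_mod_cast mult_pos L
  have h4 : (4 : ℝ) ^ ((s : ℝ) / (16 * m)) = (1 / 2 : ℝ) ^ (-((s : ℝ) / (8 * m))) := by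
    rw [show (4 : ℝ) = (1 / 2 : ℝ) ^ (-2 : ℝ) by
      rw [Real.rpow_neg (by norm_num)]; norm_num, ← Real.rpow_mul (by norm_num)]
    congr 1
    field_simp
    ring
  -- Markov's inequality for the exponential moment: on the event in question the weight is at least
  -- `4 ^ (-s / (16 m))`.
  have h1 : expect R (L + k) (fun w => if 16 * mismatch A t w ≤ s then 1 else 0) ≤
      (4 : ℝ) ^ ((s : ℝ) / (16 * m)) * (5 / 8) ^ (height R L * fullCount L k A) := by
    refine le_trans ?_ (mul_le_mul_of_nonneg_left (expect_weight_le_fullCount h A t)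
      (by positivity))
    rw [← expect_const_mul]
    refine expect_mono fun w => ?_
    split_ifs with hw
    · unfold weight
      rw [show (1 / 4 : ℝ) = 4⁻¹ by norm_num, Real.inv_rpow (by norm_num), ← Real.rpow_neg
        (by norm_num), ← Real.rpow_add (by norm_num)]
      refine Real.one_le_rpow (by norm_num) ?_
      have hw' : (16 : ℝ) * mismatch A t w ≤ s := by exact_mod_cast hw
      rw [← sub_eq_add_neg, sub_nonneg, div_le_div_iff₀ hm0 (by positivity)]
      nlinarith
    · exact mul_nonneg (by positivity) (weight_nonneg _ _)
  -- Full blocks cover at least `s / 2` places and `height * m = 2 ^ L`, so they contain at least `s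
  -- / (2 m)` independent letters.
  have h2 : (s : ℝ) / (4 * m) ≤ (height R L * fullCount L k A : ℕ) / 2 := by
    have h3 := hs.trans (Nat.mul_le_mul_left 2 (card_full_le A))
    rw [← height_mul_mult (R := R) L] at h3
    have h3' : (s : ℝ) ≤ 2 * (fullCount L k A * (height R L * m)) := by exact_mod_cast h3
    rw [div_le_div_iff₀ (by positivity) two_pos]
    push_cast
    nlinarith
  have h3 : (5 / 8 : ℝ) ^ (height R L * fullCount L k A) ≤ (1 / 2 : ℝ) ^ ((s : ℝ) / (4 * m)) := by
    -- Since `(5 / 8) ^ 2 = 25 / 64 ≤ 1 / 2`, the moment is at most `2 ^ (-s / (4 m))`. This beats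
    -- the Markov factor `2 ^ (s / (8 m))` and leaves `2 ^ (-s / (8 m))`.
    have : (5 / 8 : ℝ) ≤ (1 / 2 : ℝ) ^ (1 / 2 : ℝ) := by
      rw [← Real.sqrt_eq_rpow]
      exact Real.le_sqrt_of_sq_le (by norm_num)
    refine (pow_le_pow_left₀ (by norm_num) this _).trans ?_
    rw [← Real.rpow_natCast, ← Real.rpow_mul (by norm_num)]
    refine Real.rpow_le_rpow_of_exponent_ge (by norm_num) (by norm_num) (h2.trans ?_)
    rw [div_eq_mul_inv, one_div, mul_comm]
  refine h1.trans ((mul_le_mul_of_nonneg_left h3 (by positivity)).trans ?_)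
  rw [h4, ← Real.rpow_add (by norm_num)]
  apply le_of_eq
  congr 1
  field_simp
  ring

/-! ### The law of large numbers for the frequencies of words -/

/-- The frequency of the blocks equal to `w₀` in a word. -/
noncomputable def freq {n : ℕ} (w₀ : Vertex n) : (k : ℕ) → Vertex (n + k) → ℝ
  | 0, w => if w = w₀ then 1 else 0
  | k + 1, w => (freq w₀ k (half (n := n + k) false w) + freq w₀ k (half (n := n + k) true w)) / 2

theorem expect_freq (w₀ : Vertex n) (k : ℕ) : expect R (n + k) (freq w₀ k) = mass R n w₀ := by
  induction k with
  | zero => simp [expect, freq]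
  | succ k ih =>
    change expect R (n + k + 1) _ = _
    cases h : R (n + k)
    · rw [expect_succ_of_false h]
      simp only [freq, half_false_join, half_true_join, expect_add, expect_const,
        div_eq_mul_inv, expect_mul_const, ih]
      ring
    · rw [expect_succ_of_true h]
      simp only [freq, half_false_join, half_true_join, add_self_div_two]
      exact ih

/-- The variance of the frequency of a word. -/
noncomputable def freqVar (R : ℕ → Bool) {n : ℕ} (w₀ : Vertex n) (k : ℕ) : ℝ :=
  expect R (n + k) fun w => (freq w₀ k w - mass R n w₀) ^ 2

theorem freqVar_nonneg (w₀ : Vertex n) (k : ℕ) : 0 ≤ freqVar R w₀ k :=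
  expect_nonneg fun _ => sq_nonneg _

/-- A repeated half has the same frequency as the half itself; two independent halves average two
uncorrelated centred copies. -/
theorem freqVar_succ (w₀ : Vertex n) (k : ℕ) :
    freqVar R w₀ (k + 1) = if R (n + k) then freqVar R w₀ k else freqVar R w₀ k / 2 := by
  unfold freqVar
  change expect R (n + k + 1) _ = _
  cases h : R (n + k)
  · rw [expect_succ_of_false h]
    have hc : expect R (n + k) (fun w => freq w₀ k w - mass R n w₀) = 0 := by
      simp [sub_eq_add_neg, expect_add, expect_freq, expect_const]
    have e : ∀ u v : Vertex (n + k), (freq w₀ (k + 1) (join u v) - mass R n w₀) ^ 2 =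
        ((freq w₀ k u - mass R n w₀) ^ 2 * (1 / 4) + (freq w₀ k u - mass R n w₀) * (1 / 2) *
          (freq w₀ k v - mass R n w₀)) + (freq w₀ k v - mass R n w₀) ^ 2 * (1 / 4) := by
      intro u v
      simp only [freq, half_false_join, half_true_join]
      ring
    simp only [e, expect_add, expect_const, expect_const_mul, hc, expect_mul_const]
    simp
    ring
  · rw [expect_succ_of_true h]
    simp [freq]

/-- The variance never increases and is halved at each of the infinitely many levels with
independent halves. -/
theorem exists_freqVar_lt (hR : ∀ N, ∃ i, N ≤ i ∧ R i = false) (w₀ : Vertex n) {ε : ℝ}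
    (hε : 0 < ε) : ∃ k, freqVar R w₀ k < ε := by
  have hanti : Antitone (freqVar R w₀) := antitone_nat_of_succ_le fun k => by
    rw [freqVar_succ]
    have := freqVar_nonneg (R := R) w₀ k
    split_ifs <;> linarith
  have hj : ∀ j : ℕ, ∃ k, freqVar R w₀ k ≤ (1 / 2) ^ j * freqVar R w₀ 0 := by
    intro j
    induction j with
    | zero => exact ⟨0, by simp⟩
    | succ j ih =>
      obtain ⟨k, hk⟩ := ih
      obtain ⟨i, hi, hiR⟩ := hR (n + k)
      obtain ⟨l, rfl⟩ := Nat.exists_eq_add_of_le ((Nat.le_add_right n k).trans hi)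
      refine ⟨l + 1, ?_⟩
      rw [freqVar_succ, hiR, if_neg (by simp), pow_succ]
      have := hanti (show k ≤ l by omega)
      linarith
  have ht : Tendsto (fun j : ℕ => (1 / 2 : ℝ) ^ j * freqVar R w₀ 0) atTop (𝓝 (0 * _)) :=
    (tendsto_pow_atTop_nhds_zero_of_lt_one (by norm_num) (by norm_num)).mul_const _
  rw [zero_mul] at ht
  obtain ⟨j, hj'⟩ := ((tendsto_order.1 ht).2 ε hε).exists
  obtain ⟨k, hk⟩ := hj j
  exact ⟨k, hk.trans_lt hj'⟩

end PairsGraph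

namespace PairsGraph

/-! ### Binary positions -/

/-- Passing to the next level adds a top binary digit, and xor acts digit by digit. -/
theorem xor_add_two_pow {n a p : ℕ} (ha : a < 2 ^ n) (hp : p < 2 ^ n) (b d : Bool) :
    (a + if b then 2 ^ n else 0) ^^^ (p + if d then 2 ^ n else 0) =
      (a ^^^ p) + if b ^^ d then 2 ^ n else 0 := by
  have hx := Nat.xor_lt_two_pow ha hp
  have h0 : 0 < 2 ^ n := by positivity
  have hdiv : ∀ (b : Bool) {a : ℕ}, a < 2 ^ n → (a + if b then 2 ^ n else 0) / 2 ^ n = b.toNat := by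
    intro b a ha
    cases b
    · simpa using ha
    · simp [Nat.add_div_right _ h0, Nat.div_eq_of_lt ha]
  have hmod : ∀ (b : Bool) {a : ℕ}, a < 2 ^ n → (a + if b then 2 ^ n else 0) % 2 ^ n = a := by
    intro b a ha
    cases b <;> simp [Nat.mod_eq_of_lt ha]
  rw [← Nat.div_add_mod ((a + if b then 2 ^ n else 0) ^^^ (p + if d then 2 ^ n else 0)) (2 ^ n),
    ← Nat.div_add_mod ((a ^^^ p) + if b ^^ d then 2 ^ n else 0) (2 ^ n), Nat.xor_div_two_pow,
    Nat.xor_mod_two_pow, hdiv _ ha, hdiv _ hp, hdiv _ hx, hmod _ ha, hmod _ hp, hmod _ hx]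
  cases b <;> cases d <;> rfl

/-- The number with the binary digits `c 0, …, c (n - 1)`. -/
def posOf (c : ℕ → Bool) : ℕ → ℕ
  | 0 => 0
  | n + 1 => posOf c n + if c n then 2 ^ n else 0

theorem posOf_lt (c : ℕ → Bool) (n : ℕ) : posOf c n < 2 ^ n := by
  induction n with
  | zero => simp [posOf]
  | succ n ih => rw [posOf, pow_succ]; split_ifs <;> omega

theorem posOf_succ_inj {c c' : ℕ → Bool} {n : ℕ} (h : posOf c (n + 1) = posOf c' (n + 1)) :
    posOf c n = posOf c' n ∧ c n = c' n := by
  have h1 := posOf_lt c n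
  have h2 := posOf_lt c' n
  rw [posOf, posOf] at h
  cases hc : c n <;> cases hc' : c' n <;> simp [hc, hc'] at h ⊢ <;> omega

theorem posOf_eq_iff {c c' : ℕ → Bool} {n : ℕ} :
    posOf c n = posOf c' n ↔ ∀ i < n, c i = c' i := by
  induction n with
  | zero => simp [posOf]
  | succ n ih =>
    constructor
    · intro h i hi
      obtain ⟨h1, h2⟩ := posOf_succ_inj h
      rcases Nat.lt_succ_iff_lt_or_eq.1 hi with hi | rfl
      · exact ih.1 h1 i hi
      · exact h2
    · intro h
      rw [posOf, posOf, ih.2 fun i hi => h i (by omega), h n (by omega)]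

theorem posOf_testBit (z n : ℕ) : posOf (fun i => z.testBit i) n = z % 2 ^ n := by
  induction n with
  | zero => simp [posOf, Nat.mod_one]
  | succ n ih =>
    rw [posOf, ih, Nat.mod_pow_succ, ← Nat.toNat_testBit]
    cases z.testBit n <;> simp

/-- Whether the first `n` digits are all `1`. -/
def allOnes (c : ℕ → Bool) : ℕ → Bool
  | 0 => true
  | n + 1 => allOnes c n && c n

/-- Whether the first `n` digits are all `0`. -/
def allZeros (c : ℕ → Bool) : ℕ → Bool
  | 0 => true
  | n + 1 => allZeros c n && !c n

theorem allOnes_iff {c : ℕ → Bool} {n : ℕ} : allOnes c n = true ↔ ∀ i < n, c i = true := by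
  induction n with
  | zero => simp [allOnes]
  | succ n ih =>
    rw [allOnes, Bool.and_eq_true, ih]
    exact ⟨fun h i hi => (Nat.lt_succ_iff_lt_or_eq.1 hi).elim (h.1 i) fun e => e ▸ h.2,
      fun h => ⟨fun i hi => h i (by omega), h n (by omega)⟩⟩

theorem allOnes_mono {c : ℕ → Bool} {m n : ℕ} (hmn : m ≤ n) (h : allOnes c n = true) :
    allOnes c m = true :=
  allOnes_iff.2 fun i hi => allOnes_iff.1 h i (hi.trans_le hmn)

/-- The dyadic odometer. -/
def next (c : ℕ → Bool) : ℕ → Bool := fun i => c i ^^ allOnes c i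

/-- The inverse of the dyadic odometer. -/
def prev (c : ℕ → Bool) : ℕ → Bool := fun i => c i ^^ allZeros c i

theorem allZeros_next (c : ℕ → Bool) (n : ℕ) : allZeros (next c) n = allOnes c n := by
  induction n with
  | zero => rfl
  | succ n ih =>
    rw [allZeros, allOnes, ih, next]
    cases allOnes c n <;> cases c n <;> rfl

theorem allOnes_prev (c : ℕ → Bool) (n : ℕ) : allOnes (prev c) n = allZeros c n := by
  induction n with
  | zero => rfl
  | succ n ih =>
    rw [allZeros, allOnes, ih, prev]
    cases allZeros c n <;> cases c n <;> rfl

theorem prev_next (c : ℕ → Bool) : prev (next c) = c := by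
  funext i
  rw [prev, allZeros_next, next]
  cases allOnes c i <;> cases c i <;> rfl

theorem next_prev (c : ℕ → Bool) : next (prev c) = c := by
  funext i
  rw [next, allOnes_prev, prev]
  cases allZeros c i <;> cases c i <;> rfl

theorem posOf_next (c : ℕ → Bool) (n : ℕ) :
    (allOnes c n = true → posOf c n + 1 = 2 ^ n ∧ posOf (next c) n = 0) ∧
    (allOnes c n = false → posOf (next c) n = posOf c n + 1) := by
  induction n with
  | zero => simp [posOf, allOnes]
  | succ n ih =>
    rw [allOnes, posOf, posOf, next, pow_succ]
    cases h : allOnes c n <;> cases h' : c n <;> simp [h] at ih <;> simp <;> omega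

theorem allOnes_iff_posOf {c : ℕ → Bool} {n : ℕ} :
    allOnes c n = true ↔ posOf c n + 1 = 2 ^ n := by
  refine ⟨fun h => ((posOf_next c n).1 h).1, fun h => ?_⟩
  by_contra hc
  have h1 := (posOf_next c n).2 (by simpa using hc)
  have h2 := posOf_lt (next c) n
  omega

theorem next_apply_of_lt {c : ℕ → Bool} {n i : ℕ} (h : allOnes c n = false) (hi : n ≤ i) :
    next c i = c i := by
  have : allOnes c i = false := by
    by_contra hc
    simp [allOnes_mono hi (by simpa using hc)] at h
  simp [next, this]

/-- The translation by which the odometer changes the positions in all sufficiently long blocks. -/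
noncomputable def carry (c : ℕ → Bool) : ℕ :=
  open Classical in
  -- The value `0` is a convention for the colours that are all `1`, on which the adic
  -- transformation is undefined; it keeps the extension invertible.
  if h : ∃ n, allOnes c n = false then posOf c (Nat.find h) ^^^ posOf (next c) (Nat.find h) else 0

/-- The odometer changes no digit after the first `0`, so the xor of the old and new positions is
stable from then on. -/
theorem posOf_xor_next_eq {c : ℕ → Bool} {m n : ℕ} (h : allOnes c m = false) (hmn : m ≤ n) :
    posOf c n ^^^ posOf (next c) n = posOf c m ^^^ posOf (next c) m := by
  induction n, hmn using Nat.le_induction with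
  | base => rfl
  | succ n hn ih =>
    rw [posOf, posOf, xor_add_two_pow (posOf_lt _ _) (posOf_lt _ _), next_apply_of_lt h hn, ih]
    simp

theorem carry_eq {c : ℕ → Bool} {n : ℕ} (h : allOnes c n = false) :
    carry c = posOf c n ^^^ posOf (next c) n := by
  classical
  have hex : ∃ n, allOnes c n = false := ⟨n, h⟩
  rw [carry, dif_pos hex]
  exact (posOf_xor_next_eq (Nat.find_spec hex) (Nat.find_min' hex h)).symm

theorem measurable_allOnes (n : ℕ) : Measurable fun c => allOnes c n := by
  induction n with
  | zero => exact measurable_const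
  | succ n ih =>
    exact (measurable_of_finite fun p : Bool × Bool => p.1 && p.2).comp
      (ih.prodMk (measurable_pi_apply n))

theorem measurable_allZeros (n : ℕ) : Measurable fun c => allZeros c n := by
  induction n with
  | zero => exact measurable_const
  | succ n ih =>
    exact (measurable_of_finite fun p : Bool × Bool => p.1 && !p.2).comp
      (ih.prodMk (measurable_pi_apply n))

theorem measurable_next : Measurable next := measurable_pi_lambda _ fun n =>
  (measurable_of_finite fun p : Bool × Bool => p.1 ^^ p.2).comp
    ((measurable_pi_apply n).prodMk (measurable_allOnes n))

theorem measurable_prev : Measurable prev := measurable_pi_lambda _ fun n =>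
  (measurable_of_finite fun p : Bool × Bool => p.1 ^^ p.2).comp
    ((measurable_pi_apply n).prodMk (measurable_allZeros n))

theorem measurable_posOf (n : ℕ) : Measurable fun c => posOf c n := by
  induction n with
  | zero => exact measurable_const
  | succ n ih =>
    exact (measurable_of_countable fun p : ℕ × Bool => p.1 + if p.2 then 2 ^ n else 0).comp
      (ih.prodMk (measurable_pi_apply n))

theorem measurable_carry : Measurable carry := by
  classical
  refine measurable_to_countable' fun m => ?_
  have h : carry ⁻¹' {m} = (⋃ n, {c | allOnes c n = false} ∩
      (fun c => posOf c n ^^^ posOf (next c) n) ⁻¹' {m}) ∪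
      ((⋂ n, {c | allOnes c n = true}) ∩ {_c | 0 = m}) := by
    ext c
    simp only [mem_preimage, mem_singleton_iff, mem_union, mem_iUnion, mem_inter_iff,
      mem_iInter, mem_ofPred_eq]
    by_cases hex : ∃ n, allOnes c n = false
    · obtain ⟨n, hn⟩ := hex
      constructor
      · intro h
        exact Or.inl ⟨n, hn, by rw [← carry_eq hn]; exact h⟩
      · rintro (⟨k, hk, hkm⟩ | ⟨h, -⟩)
        · rw [carry_eq hk]; exact hkm
        · simp [h n] at hn
    · rw [carry, dif_neg hex]
      simp only [not_exists, Bool.not_eq_false] at hex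
      simp [hex]
  rw [h]
  refine (MeasurableSet.iUnion fun n => ?_).union ((MeasurableSet.iInter fun n => ?_).inter
    (MeasurableSet.const _))
  · refine (measurable_allOnes n (measurableSet_singleton false)).inter ?_
    exact ((measurable_of_countable fun p : ℕ × ℕ => p.1 ^^^ p.2).comp
      ((measurable_posOf n).prodMk ((measurable_posOf n).comp measurable_next)))
      (measurableSet_singleton m)
  · exact measurable_allOnes n (measurableSet_singleton true)

/-! ### Coordinates on the path space -/

/-- The colours of the edges of a path. -/
def colours (x : PathSpace) : ℕ → Bool := fun n => Edge.colour (x.1 n)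

/-- The vertex of level `n` of a path. -/
def word (n : ℕ) (x : PathSpace) : Vertex n := Edge.source (x.1 n)

/-- The position of a path in its block of level `n`. -/
def pos (n : ℕ) (x : PathSpace) : ℕ := posOf (colours x) n

theorem pos_lt (n : ℕ) (x : PathSpace) : pos n x < 2 ^ n := posOf_lt _ _

theorem word_succ_eq_target (n : ℕ) (x : PathSpace) : word (n + 1) x = Edge.target (x.1 n) := x.2 n

theorem half_word (n : ℕ) (x : PathSpace) : half (colours x n) (word (n + 1) x) = word n x := by
  rw [word_succ_eq_target]
  exact (x.1 n).2.symm

theorem edge_ext {n : ℕ} {e e' : Edge n} (ht : Edge.target e = Edge.target e')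
    (hc : Edge.colour e = Edge.colour e') : e = e' := by
  have hs : e.1.1 = e'.1.1 := by
    rw [e.2, e'.2]
    change half (Edge.colour e) (Edge.target e) = half (Edge.colour e') (Edge.target e')
    rw [ht, hc]
  exact Subtype.ext (Prod.ext hs (Prod.ext ht hc))

theorem measurable_colours : Measurable colours := measurable_pi_lambda _ fun n =>
  (measurable_of_countable (Edge.colour (n := n))).comp
    ((measurable_pi_apply n).comp measurable_subtype_coe)

theorem measurable_word (n : ℕ) : Measurable (word n) :=
  (measurable_of_countable (Edge.source (n := n))).comp
    ((measurable_pi_apply n).comp measurable_subtype_coe)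

theorem measurable_pos (n : ℕ) : Measurable (pos n) :=
  (measurable_posOf n).comp measurable_colours

/-- The words of the path with the given colours and letters. -/
def wordOf (c x : ℕ → Bool) (n : ℕ) : Vertex n := fun q => x (q.val ^^^ posOf c n)

theorem half_wordOf (c x : ℕ → Bool) (n : ℕ) :
    half (c n) (wordOf c x (n + 1)) = wordOf c x n := by
  funext q
  have := xor_add_two_pow q.isLt (posOf_lt c n) (c n) (c n)
  rw [Bool.xor_self, if_neg Bool.false_ne_true] at this
  simp only [half, wordOf, posOf]
  rw [add_comm _ q.val, this, add_zero]

/-- The letter of a path at the place which differs from its present one by the translation `a`. -/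
def letter (x : PathSpace) (a : ℕ) : Bool :=
  word a x ⟨a ^^^ pos a x, Nat.xor_lt_two_pow Nat.lt_two_pow_self (pos_lt a x)⟩

/-- Read by its xor distance from the present position, a letter does not depend on the level: the
colour selecting the half is the same top digit that the position acquires. This makes the letters
level-free coordinates. -/
theorem word_xor_eq_of_le (x : PathSpace) {a m n : ℕ} (ha : a < 2 ^ m) (hmn : m ≤ n) :
    word n x ⟨a ^^^ pos n x, Nat.xor_lt_two_pow
      (ha.trans_le (Nat.pow_le_pow_right two_pos hmn)) (pos_lt n x)⟩ =
    word m x ⟨a ^^^ pos m x, Nat.xor_lt_two_pow ha (pos_lt m x)⟩ := by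
  induction n, hmn using Nat.le_induction with
  | base => rfl
  | succ n hn ih =>
    have ha' := ha.trans_le (Nat.pow_le_pow_right two_pos hn)
    rw [← ih, ← half_word n x, half]
    congr 1
    ext
    have := xor_add_two_pow ha' (pos_lt n x) false (colours x n)
    simp only [Bool.false_eq_true, if_false, add_zero, Bool.false_xor] at this
    exact this.trans (add_comm _ _)

theorem wordOf_letter (x : PathSpace) (n : ℕ) : wordOf (colours x) (letter x) n = word n x := by
  funext q
  have hq := Nat.xor_lt_two_pow q.isLt (posOf_lt (colours x) n)
  have e : (q.val ^^^ posOf (colours x) n) ^^^ pos n x = q.val := by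
    rw [Nat.xor_assoc, pos, Nat.xor_self, Nat.xor_zero]
  rw [wordOf, letter]
  rcases le_total n (q.val ^^^ posOf (colours x) n) with h | h
  · rw [word_xor_eq_of_le x hq h]
    exact congrArg _ (Fin.ext e)
  · rw [← word_xor_eq_of_le x Nat.lt_two_pow_self h]
    exact congrArg _ (Fin.ext e)

/-- The path with the given colours and letters. -/
def pathOf (c x : ℕ → Bool) : PathSpace :=
  ⟨fun n => ⟨(wordOf c x n, wordOf c x (n + 1), c n), (half_wordOf c x n).symm⟩, fun _ => rfl⟩

theorem word_pathOf (c x : ℕ → Bool) (n : ℕ) : word n (pathOf c x) = wordOf c x n := rfl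

theorem path_ext {x y : PathSpace} (hc : colours x = colours y) (hw : ∀ n, word n x = word n y) :
    x = y :=
  Subtype.ext (funext fun n => edge_ext
    (by rw [← word_succ_eq_target, ← word_succ_eq_target, hw]) (congrFun hc n))

/-- The path space is parametrized by the colours and the letters. -/
def pathEquiv : PathSpace ≃ᵐ (ℕ → Bool) × (ℕ → Bool) where
  toFun x := (colours x, letter x)
  invFun p := pathOf p.1 p.2
  left_inv x := path_ext rfl fun n => wordOf_letter x n
  right_inv p := by
    refine Prod.ext rfl (funext fun a => ?_)
    change p.2 ((a ^^^ posOf p.1 a) ^^^ posOf p.1 a) = p.2 a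
    rw [Nat.xor_assoc, Nat.xor_self, Nat.xor_zero]
  measurable_toFun := by
    refine measurable_colours.prodMk (measurable_pi_lambda _ fun a => ?_)
    have h := (measurable_of_countable fun p : Vertex a × ℕ =>
      if h : a ^^^ p.2 < 2 ^ a then p.1 ⟨a ^^^ p.2, h⟩ else false).comp
      ((measurable_word a).prodMk (measurable_pos a))
    convert h using 2 with x
    simp [letter, Nat.xor_lt_two_pow Nat.lt_two_pow_self (pos_lt a x)]
  measurable_invFun := by
    have hw : ∀ n, Measurable fun p : (ℕ → Bool) × (ℕ → Bool) => wordOf p.1 p.2 n := by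
      intro n
      refine measurable_pi_lambda _ fun q => ?_
      have h1 : Measurable fun r : ℕ × (ℕ → Bool) => r.2 (q.val ^^^ r.1) :=
        measurable_from_prod_countable_right fun z => measurable_pi_apply (_ ^^^ z)
      exact h1.comp (((measurable_posOf n).comp measurable_fst).prodMk measurable_snd)
    refine Measurable.subtype_mk (measurable_pi_lambda _ fun n => Measurable.subtype_mk ?_)
    exact (hw n).prodMk ((hw (n + 1)).prodMk ((measurable_pi_apply n).comp measurable_fst))

/-- The adic transformation, extended to the paths all of whose edges have colour `1`, in terms
of colours and letters. -/
noncomputable def adicCoord : (ℕ → Bool) × (ℕ → Bool) ≃ᵐ (ℕ → Bool) × (ℕ → Bool) where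
  toFun p := (next p.1, fun a => p.2 (a ^^^ carry p.1))
  invFun p := (prev p.1, fun a => p.2 (a ^^^ carry (prev p.1)))
  left_inv p := by
    simp [prev_next]
  right_inv p := by
    simp [next_prev]
  measurable_toFun := by
    refine (measurable_next.comp measurable_fst).prodMk (measurable_pi_lambda _ fun a => ?_)
    have h1 : Measurable fun r : ℕ × (ℕ → Bool) => r.2 (a ^^^ r.1) :=
      measurable_from_prod_countable_right fun z => measurable_pi_apply (_ ^^^ z)
    exact h1.comp ((measurable_carry.comp measurable_fst).prodMk measurable_snd)
  measurable_invFun := by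
    refine (measurable_prev.comp measurable_fst).prodMk (measurable_pi_lambda _ fun a => ?_)
    have h1 : Measurable fun r : ℕ × (ℕ → Bool) => r.2 (a ^^^ r.1) :=
      measurable_from_prod_countable_right fun z => measurable_pi_apply (_ ^^^ z)
    exact h1.comp (((measurable_carry.comp measurable_prev).comp measurable_fst).prodMk
      measurable_snd)

/-- The adic transformation. -/
noncomputable def adic : PathSpace ≃ᵐ PathSpace :=
  (pathEquiv.trans adicCoord).trans pathEquiv.symm

theorem adic_eq (x : PathSpace) :
    adic x = pathOf (next (colours x)) fun a => letter x (a ^^^ carry (colours x)) := rfl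

theorem pos_adic_of_lt {n : ℕ} {x : PathSpace} (h : pos n x + 1 < 2 ^ n) :
    pos n (adic x) = pos n x + 1 :=
  (posOf_next (colours x) n).2 (by
    by_contra hc
    have := allOnes_iff_posOf.1 (by simpa using hc : allOnes (colours x) n = true)
    exact h.ne this)

theorem pos_adic_of_eq {n : ℕ} {x : PathSpace} (h : pos n x + 1 = 2 ^ n) : pos n (adic x) = 0 :=
  ((posOf_next _ n).1 (allOnes_iff_posOf.2 h)).2

theorem word_adic_of_allOnes {n : ℕ} {x : PathSpace} (h : allOnes (colours x) n = false) :
    word n (adic x) = word n x := by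
  rw [← wordOf_letter x n, adic_eq, word_pathOf]
  funext q
  simp only [wordOf]
  rw [carry_eq h, Nat.xor_comm (posOf _ _), ← Nat.xor_assoc, Nat.xor_assoc q.val, Nat.xor_self,
    Nat.xor_zero]

theorem word_adic_of_lt {n : ℕ} {x : PathSpace} (h : pos n x + 1 < 2 ^ n) :
    word n (adic x) = word n x :=
  word_adic_of_allOnes (by
    by_contra hc
    have := allOnes_iff_posOf.1 (by simpa using hc : allOnes (colours x) n = true)
    exact h.ne this)

theorem isAdicImage_adic {x : PathSpace} (h : ∃ n, colours x n = false) :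
    IsAdicImage x (adic x) := by
  classical
  set n := Nat.find h with hn
  have h1 : colours x n = false := Nat.find_spec h
  have h2 : ∀ i < n, colours x i = true := fun i hi => by
    simpa using Nat.find_min h hi
  have h3 : allOnes (colours x) n = true := allOnes_iff.2 h2
  have h4 : allOnes (colours x) (n + 1) = false := by simp [allOnes, h1]
  refine ⟨n, h1, h2, fun i hi => edge_ext ?_ ?_, ?_, fun i hi => ?_⟩
  · rw [← word_succ_eq_target, ← word_succ_eq_target]
    refine word_adic_of_allOnes ?_
    by_contra hc
    have := allOnes_mono (show n + 1 ≤ i + 1 by omega)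
      (by simpa using hc : allOnes (colours x) (i + 1) = true)
    rw [h4] at this
    exact Bool.false_ne_true this
  · exact next_apply_of_lt h4 hi
  · change next (colours x) n = true
    simp [next, h1, h3]
  · change next (colours x) i = false
    simp [next, h2 i hi, allOnes_mono hi.le h3]

end PairsGraph

namespace PairsGraph

/-! ### The central measure -/

/-- The number obtained from `a` by clearing the binary digits `i` with `R i = true`. -/
def compress (R : ℕ → Bool) (a : ℕ) : ℕ :=
  ∑ i ∈ Finset.range a, if a.testBit i && !R i then 2 ^ i else 0

theorem compress_eq {R : ℕ → Bool} {a n : ℕ} (ha : a < 2 ^ n) :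
    compress R a = ∑ i ∈ Finset.range n, if a.testBit i && !R i then 2 ^ i else 0 := by
  have key : ∀ {m n : ℕ}, a < 2 ^ m → m ≤ n →
      ∑ i ∈ Finset.range m, (if a.testBit i && !R i then 2 ^ i else 0) =
      ∑ i ∈ Finset.range n, if a.testBit i && !R i then 2 ^ i else 0 := by
    intro m n hm hmn
    refine Finset.sum_subset (Finset.range_mono hmn) fun i _ hi => ?_
    rw [Finset.mem_range, not_lt] at hi
    have : a.testBit i = false :=
      Nat.testBit_lt_two_pow (hm.trans_le (Nat.pow_le_pow_right two_pos hi))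
    simp [this]
  rcases le_total a n with h | h
  · exact key Nat.lt_two_pow_self h
  · exact (key ha h).symm

theorem compress_add {R : ℕ → Bool} {a n : ℕ} (ha : a < 2 ^ n) (b : Bool) :
    compress R (a + if b then 2 ^ n else 0) =
      compress R a + if b && !R n then 2 ^ n else 0 := by
  have ha' : (a + if b then 2 ^ n else 0) < 2 ^ (n + 1) := by
    rw [pow_succ]; split_ifs <;> omega
  have hbit : ∀ i < n, (a + if b then 2 ^ n else 0).testBit i = a.testBit i := by
    intro i hi
    cases b
    · simp
    · rw [if_pos rfl, add_comm]; exact Nat.testBit_two_pow_add_gt hi a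
  have hn : (a + if b then 2 ^ n else 0).testBit n = b := by
    have h0 := Nat.testBit_lt_two_pow ha
    cases b
    · simpa using h0
    · rw [if_pos rfl, add_comm, Nat.testBit_two_pow_add_eq, h0]; rfl
  rw [compress_eq ha, compress_eq ha', Finset.sum_range_succ, hn]
  congr 1
  exact Finset.sum_congr rfl fun i hi => by rw [hbit i (Finset.mem_range.1 hi)]

theorem compress_lt {R : ℕ → Bool} {a n : ℕ} (ha : a < 2 ^ n) : compress R a < 2 ^ n := by
  induction n generalizing a with
  | zero =>
    obtain rfl : a = 0 := by simpa using ha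
    simp [compress]
  | succ n ih =>
    rw [pow_succ] at ha ⊢
    by_cases h : a < 2 ^ n
    · have := ih h; omega
    · have h1 : a - 2 ^ n < 2 ^ n := by omega
      have h2 := compress_add (R := R) h1 true
      have h3 := ih h1
      simp only [if_true, Bool.true_and, Nat.sub_add_cancel (not_lt.1 h)] at h2
      rw [h2]
      split_ifs <;> omega

/-- The distribution of a sequence of independent fair bits. -/
noncomputable def coin : Measure (ℕ → Bool) :=
  Measure.infinitePi fun _ => (PMF.uniformOfFintype Bool).toMeasure

instance : IsProbabilityMeasure coin := by unfold coin; infer_instance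

theorem coin_cylinder (s : Finset ℕ) (w : ℕ → Bool) :
    coin.real {c | ∀ i ∈ s, c i = w i} = (1 / 2) ^ s.card := by
  have h : {c : ℕ → Bool | ∀ i ∈ s, c i = w i} = Set.pi (s : Set ℕ) fun i => {w i} := by
    ext c; simp
  rw [measureReal_def, h, coin, Measure.infinitePi_pi _ fun i _ => measurableSet_singleton _]
  simp

theorem coin_posOf {n z : ℕ} (hz : z < 2 ^ n) : coin.real {c | posOf c n = z} = (1 / 2) ^ n := by
  have h : {c | posOf c n = z} = {c | ∀ i ∈ Finset.range n, c i = z.testBit i} := by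
    ext c
    have := posOf_eq_iff (c := c) (c' := fun i => z.testBit i) (n := n)
    rw [posOf_testBit, Nat.mod_eq_of_lt hz] at this
    simpa using this
  rw [h, coin_cylinder, Finset.card_range]

theorem coin_shift (K : ℕ) : coin.map (fun c i => c (i + K)) = coin := by
  unfold coin
  exact Measure.map_infinitePi_infinitePi_of_inj
    (P := fun _ : ℕ => (PMF.uniformOfFintype Bool).toMeasure) (add_left_injective K)

theorem measurableSet_forall_eq {κ : Type*} [Finite κ] (f : κ → ℕ) (w : κ → Bool) :
    MeasurableSet {c : ℕ → Bool | ∀ q, c (f q) = w q} := by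
  rw [Set.ofPred_forall]
  exact MeasurableSet.iInter fun q =>
    measurableSet_eq_fun (measurable_pi_apply (f q)) measurable_const

/-- The two events depend on bits with indices in the disjoint ranges `[0, K)` and `[K, 2K)`, and
the shift by `K` preserves the law. -/
theorem coin_inter {κ : Type*} [Finite κ] {K : ℕ} {f g : κ → ℕ} (hf : ∀ q, f q < K)
    (hg : ∀ q, g q < K) (w w' : κ → Bool) :
    coin.real ({c | ∀ q, c (f q) = w q} ∩ {c | ∀ q, c (g q + K) = w' q}) =
      coin.real {c | ∀ q, c (f q) = w q} * coin.real {c | ∀ q, c (g q) = w' q} := by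
  have hind : ProbabilityTheory.iIndepFun (fun (i : ℕ) (c : ℕ → Bool) => c i) coin :=
    ProbabilityTheory.iIndepFun_infinitePi (X := fun _ ω => ω) fun _ => measurable_id
  have h := hind.indepFun_finset (Finset.range K) (Finset.Ico K (K + K))
    (by rw [Finset.disjoint_left]; intro a; simp; omega) fun i => measurable_pi_apply i
  let A : Set (Finset.range K → Bool) := {c | ∀ q, c ⟨f q, Finset.mem_range.2 (hf q)⟩ = w q}
  let B : Set (Finset.Ico K (K + K) → Bool) :=
    {c | ∀ q, c ⟨g q + K, Finset.mem_Ico.2 ⟨by omega, by have := hg q; omega⟩⟩ = w' q}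
  have h1 := h.measure_inter_preimage_eq_mul A B (Set.toFinite _).measurableSet
    (Set.toFinite _).measurableSet
  have h2 : coin {c | ∀ q, c (g q + K) = w' q} = coin {c | ∀ q, c (g q) = w' q} := by
    conv_rhs => rw [← coin_shift K]
    rw [Measure.map_apply (by fun_prop) (measurableSet_forall_eq g w')]
    rfl
  rw [measureReal_def, measureReal_def, measureReal_def, ← ENNReal.toReal_mul, ← h2]
  exact congrArg ENNReal.toReal h1

/-- If `R n = true`, digit `n` is cleared and both halves read the same coins. Otherwise one half
reads coins shifted by `2 ^ n`, which are independent of those of the other half. The top digit of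
`z` only decides which half is unshifted, and the law is symmetric in the halves. -/
theorem coin_compress (R : ℕ → Bool) {n z : ℕ} (hz : z < 2 ^ n) (w : Vertex n) :
    coin.real {c | ∀ q : Fin (2 ^ n), c (compress R (q.val ^^^ z)) = w q} = mass R n w := by
  induction n generalizing z with
  | zero =>
    have h : {c : ℕ → Bool | ∀ q : Fin (2 ^ 0), c (compress R (q.val ^^^ z)) = w q} =
        {c | ∀ i ∈ ({0} : Finset ℕ), c i = w 0} := by
      have hz0 : z = 0 := by simpa using hz
      ext c
      simp only [Finset.mem_singleton, forall_eq, mem_ofPred_eq]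
      constructor
      · intro h; simpa [hz0, compress] using h 0
      · intro h q
        obtain rfl : q = 0 := Fin.ext (by have := q.isLt; omega)
        simpa [hz0, compress] using h
    rw [h, coin_cylinder]
    simp [mass]
  | succ n ih =>
    obtain ⟨z', b, hz', rfl⟩ : ∃ (z' : ℕ) (b : Bool), z' < 2 ^ n ∧
        (z' + if b then 2 ^ n else 0) = z := by
      by_cases h : z < 2 ^ n
      · exact ⟨z, false, h, by simp⟩
      · rw [pow_succ] at hz
        exact ⟨z - 2 ^ n, true, by omega, by simp; omega⟩
    have hset : {c : ℕ → Bool | ∀ q : Fin (2 ^ (n + 1)),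
        c (compress R (q.val ^^^ (z' + if b then 2 ^ n else 0))) = w q} =
        {c | ∀ q : Fin (2 ^ n), c (compress R (q.val ^^^ z')) = half b w q} ∩
        {c | ∀ q : Fin (2 ^ n), c (compress R (q.val ^^^ z') + if !R n then 2 ^ n else 0) =
          half (!b) w q} := by
      have hd : ∀ (d : Bool) (q : Fin (2 ^ n)),
          compress R ((halfIdx d q).val ^^^ (z' + if b then 2 ^ n else 0)) =
          compress R (q.val ^^^ z') + if (d ^^ b) && !R n then 2 ^ n else 0 := by
        intro d q
        rw [show (halfIdx d q).val = q.val + if d then 2 ^ n else 0 from add_comm _ _,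
          xor_add_two_pow q.isLt hz',
          compress_add (Nat.xor_lt_two_pow q.isLt hz')]
      ext c
      simp only [mem_ofPred_eq, mem_inter_iff]
      constructor
      · intro h
        refine ⟨fun q => ?_, fun q => ?_⟩
        · have := h (halfIdx b q)
          rw [hd] at this
          simpa [half_apply] using this
        · have := h (halfIdx (!b) q)
          rw [hd] at this
          simpa [half_apply] using this
      · rintro ⟨h1, h2⟩
        refine fun q => ?_
        obtain ⟨d, q', rfl⟩ : ∃ (d : Bool) (q' : Fin (2 ^ n)), q = halfIdx d q' := by
          have hq : q.val < 2 ^ n * 2 := q.isLt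
          by_cases h : q.val < 2 ^ n
          · exact ⟨false, ⟨q, h⟩, Fin.ext (by simp [halfIdx])⟩
          · exact ⟨true, ⟨q - 2 ^ n, by omega⟩, Fin.ext (by simp [halfIdx]; omega)⟩
        rw [hd]
        by_cases hdb : d = b
        · subst hdb
          simpa [half_apply] using h1 q'
        · obtain rfl : d = !b := by cases d <;> cases b <;> simp at hdb ⊢
          simpa [half_apply] using h2 q'
    rw [hset, mass]
    cases hR : R n
    · have hlt : ∀ q : Fin (2 ^ n), compress R (q.val ^^^ z') < 2 ^ n := fun q =>
        compress_lt (Nat.xor_lt_two_pow q.isLt hz')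
      have := coin_inter hlt hlt (half b w) (half (!b) w)
      simp only [Bool.not_false, if_true, Bool.false_eq_true, if_false]
      rw [this, ih hz', ih hz']
      cases b
      · rfl
      · exact mul_comm _ _
    · simp only [Bool.not_true, Bool.false_eq_true, if_false, if_true, add_zero]
      split_ifs with he
      · have he' : ∀ b, half b w = half false w := by intro b; cases b <;> simp [he]
        rw [he' b, he' (!b), inter_self, ih hz']
      · have : {c : ℕ → Bool | ∀ q : Fin (2 ^ n), c (compress R (q.val ^^^ z')) = half b w q} ∩
            {c : ℕ → Bool | ∀ q : Fin (2 ^ n), c (compress R (q.val ^^^ z')) = half (!b) w q} = ∅ := by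
          refine eq_empty_of_forall_notMem fun c ⟨h1, h2⟩ => he ?_
          have : half b w = half (!b) w := funext fun q => (h1 q).symm.trans (h2 q)
          cases b
          · exact this
          · exact this.symm
        rw [this, measureReal_empty]

/-- The central measure with the distributions `mass R` of the words. -/
noncomputable def pathLaw (R : ℕ → Bool) : Measure PathSpace :=
  (coin.prod (coin.map fun c a => c (compress R a))).map pathEquiv.symm

theorem measurable_comp_compress (R : ℕ → Bool) :
    Measurable fun (c : ℕ → Bool) a => c (compress R a) := by fun_prop

instance (R : ℕ → Bool) : IsProbabilityMeasure (pathLaw R) := by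
  have := Measure.isProbabilityMeasure_map (μ := coin) (measurable_comp_compress R).aemeasurable
  exact Measure.isProbabilityMeasure_map pathEquiv.symm.measurable.aemeasurable

/-- The paths with a given position in the block of level `n`, equal to a given word. -/
def block (n z : ℕ) (w : Vertex n) : Set PathSpace := {x | pos n x = z ∧ word n x = w}

theorem measurableSet_pos (n z : ℕ) : MeasurableSet {x | pos n x = z} :=
  measurable_pos n (measurableSet_singleton z)

theorem measurableSet_word (n : ℕ) (w : Vertex n) : MeasurableSet {x | word n x = w} :=
  measurable_word n (measurableSet_singleton w)

theorem measurableSet_block (n z : ℕ) (w : Vertex n) : MeasurableSet (block n z w) :=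
  (measurableSet_pos n z).inter (measurableSet_word n w)

/-- The colours determine the position; given it, the word is read from the independent letters with
a law that does not depend on `z`. Centrality is this independence of `z`. -/
theorem pathLaw_block (R : ℕ → Bool) {n z : ℕ} (hz : z < 2 ^ n) (w : Vertex n) :
    (pathLaw R).real (block n z w) = (1 / 2) ^ n * mass R n w := by
  have hpre : pathEquiv.symm ⁻¹' block n z w = {c | posOf c n = z} ×ˢ
      {x | ∀ q : Fin (2 ^ n), x (q.val ^^^ z) = w q} := by
    ext ⟨c, x⟩
    change (posOf c n = z ∧ wordOf c x n = w) ↔ (posOf c n = z ∧ ∀ q : Fin (2 ^ n), _)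
    refine and_congr_right fun h => ?_
    rw [funext_iff]
    simp only [wordOf, h]
  rw [measureReal_def, pathLaw, pathEquiv.symm.map_apply, hpre, Measure.prod_prod,
    Measure.map_apply (measurable_comp_compress R) (measurableSet_forall_eq _ _),
    ENNReal.toReal_mul, ← coin_posOf hz, ← coin_compress R hz w]
  rfl

theorem pos_word_eq_of_le {x y : PathSpace} {m n : ℕ} (hmn : m ≤ n) (hp : pos n x = pos n y)
    (hw : word n x = word n y) : pos m x = pos m y ∧ word m x = word m y := by
  induction n, hmn using Nat.le_induction with
  | base => exact ⟨hp, hw⟩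
  | succ n hn ih =>
    obtain ⟨h1, h2⟩ := posOf_succ_inj hp
    exact ih h1 (by rw [← half_word, ← half_word n y, hw, h2])

theorem edge_eq_of_lt {x y : PathSpace} {i n : ℕ} (hi : i < n) (hp : pos n x = pos n y)
    (hw : word n x = word n y) : x.1 i = y.1 i := by
  obtain ⟨h1, h2⟩ := pos_word_eq_of_le (Nat.succ_le_of_lt hi) hp hw
  refine edge_ext ?_ (posOf_succ_inj h1).2
  rw [← word_succ_eq_target, ← word_succ_eq_target, h2]

theorem cylinder_eq_block (x : PathSpace) (n : ℕ) :
    cylinder x (n + 1) = block (n + 1) (pos (n + 1) x) (word (n + 1) x) := by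
  ext y
  constructor
  · intro h
    refine ⟨posOf_eq_iff.2 fun i hi => congrArg Edge.colour (h i hi), ?_⟩
    rw [word_succ_eq_target, word_succ_eq_target, h n (Nat.lt_succ_self n)]
  · rintro ⟨h1, h2⟩ i hi
    exact edge_eq_of_lt hi h1 h2

theorem isCentral_pathLaw (R : ℕ → Bool) : IsCentral (pathLaw R) := by
  intro n x y h
  rw [cylinder_eq_block, cylinder_eq_block, ← ENNReal.toReal_eq_toReal_iff'
    (measure_ne_top _ _) (measure_ne_top _ _)]
  change (pathLaw R).real _ = (pathLaw R).real _
  rw [pathLaw_block R (pos_lt _ _), pathLaw_block R (pos_lt _ _), word_succ_eq_target,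
    word_succ_eq_target, h]

/-- The blocks of the levels at least `N`. -/
def blocks (N : ℕ) : Set (Set PathSpace) :=
  {s | ∃ n, N ≤ n ∧ ∃ (z : ℕ) (w : Vertex n), s = block n z w}

theorem isPiSystem_blocks (N : ℕ) : IsPiSystem (blocks N) := by
  have key : ∀ {m n : ℕ} (_ : m ≤ n) (z z' : ℕ) (w : Vertex m) (w' : Vertex n),
      (block m z w ∩ block n z' w').Nonempty → block m z w ∩ block n z' w' = block n z' w' := by
    rintro m n hmn z z' w w' ⟨x, hx, hx'⟩
    refine inter_eq_right.2 fun y hy => ?_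
    obtain ⟨h1, h2⟩ := pos_word_eq_of_le hmn (hy.1.trans hx'.1.symm) (hy.2.trans hx'.2.symm)
    exact ⟨h1.trans hx.1, h2.trans hx.2⟩
  rintro _ ⟨m, hm, z, w, rfl⟩ _ ⟨n, hn, z', w', rfl⟩ hne
  rcases le_total m n with h | h
  · exact ⟨n, hn, z', w', key h z z' w w' hne⟩
  · refine ⟨m, hm, z, w, ?_⟩
    rw [inter_comm] at hne ⊢
    exact key h z' z w' w hne

/-- The high levels suffice, since a block determines all earlier edges. The freedom in `N` allows a
block to lie entirely inside or outside `{pos N = 0}`. -/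
theorem generateFrom_blocks (N : ℕ) :
    (inferInstance : MeasurableSpace PathSpace) = MeasurableSpace.generateFrom (blocks N) := by
  apply le_antisymm
  · have h : ∀ i, @Measurable _ _ (MeasurableSpace.generateFrom (blocks N)) _
        fun x : PathSpace => x.1 i := by
      intro i
      refine @measurable_to_countable' _ _ _ _ (MeasurableSpace.generateFrom (blocks N)) _ fun e => ?_
      set n := max N (i + 1) with hn
      have he : (fun x : PathSpace => x.1 i) ⁻¹' {e} = ⋃ (z : ℕ) (w : Vertex n)
          (_ : ∃ x ∈ block n z w, x.1 i = e), block n z w := by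
        ext y
        simp only [mem_preimage, mem_singleton_iff, mem_iUnion]
        constructor
        · intro hy
          exact ⟨pos n y, word n y, ⟨y, ⟨rfl, rfl⟩, hy⟩, rfl, rfl⟩
        · rintro ⟨z, w, ⟨x, hx, hxe⟩, hy⟩
          rw [← hxe]
          exact edge_eq_of_lt (by omega) (hy.1.trans hx.1.symm) (hy.2.trans hx.2.symm)
      rw [he]
      exact .iUnion fun z => .iUnion fun w => .iUnion fun _ =>
        MeasurableSpace.measurableSet_generateFrom ⟨n, le_max_left _ _, z, w, rfl⟩
    have h2 : @Measurable _ _ (MeasurableSpace.generateFrom (blocks N)) _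
        (Subtype.val : PathSpace → _) :=
      @measurable_pi_lambda _ _ _ (MeasurableSpace.generateFrom (blocks N)) _ _ h
    exact h2.comap_le
  · refine MeasurableSpace.generateFrom_le ?_
    rintro _ ⟨n, -, z, w, rfl⟩
    exact measurableSet_block n z w

theorem sum_measureReal_inter_fiber {X κ : Type*} [MeasurableSpace X] [Fintype κ] {μ : Measure X}
    [IsFiniteMeasure μ] {f : X → κ} (hf : ∀ k, MeasurableSet {x | f x = k})
    (D : Set X) : ∑ k, μ.real (D ∩ {x | f x = k}) = μ.real D := by
  have := sum_measureReal_preimage_singleton (μ := μ.restrict D) (f := f) Finset.univ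
    fun k _ => hf k
  rw [Finset.coe_univ, preimage_univ, measureReal_restrict_apply MeasurableSet.univ,
    univ_inter] at this
  rw [← this]
  refine Finset.sum_congr rfl fun k _ => ?_
  rw [measureReal_restrict_apply (show MeasurableSet (f ⁻¹' {k}) from hf k), inter_comm]
  rfl

theorem sum_measureReal_inter_word {μ : Measure PathSpace} [IsFiniteMeasure μ] (n : ℕ)
    (D : Set PathSpace) :
    ∑ w, μ.real (D ∩ {x | word n x = w}) = μ.real D :=
  sum_measureReal_inter_fiber (measurableSet_word n) D

theorem sum_measureReal_inter_pos {μ : Measure PathSpace} [IsFiniteMeasure μ] (n : ℕ)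
    (D : Set PathSpace) :
    ∑ z ∈ Finset.range (2 ^ n), μ.real (D ∩ {x | pos n x = z}) = μ.real D := by
  have h := sum_measureReal_inter_fiber (μ := μ)
    (f := fun x => (⟨pos n x, pos_lt n x⟩ : Fin (2 ^ n)))
    (fun k => by simpa [Fin.ext_iff] using measurableSet_pos n k) D
  rw [← h, Finset.sum_range]
  simp [Fin.ext_iff]

theorem pathLaw_pos (R : ℕ → Bool) {n z : ℕ} (hz : z < 2 ^ n) :
    (pathLaw R).real {x | pos n x = z} = (1 / 2) ^ n := by
  rw [← sum_measureReal_inter_word n {x | pos n x = z}]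
  refine (Finset.sum_congr rfl fun w _ => pathLaw_block R hz w).trans ?_
  rw [← Finset.mul_sum, sum_mass, mul_one]

theorem pathLaw_word (R : ℕ → Bool) (n : ℕ) (w : Vertex n) :
    (pathLaw R).real {x | word n x = w} = mass R n w := by
  rw [← sum_measureReal_inter_pos n {x | word n x = w}, Finset.sum_congr rfl
    (g := fun _ => (1 / 2) ^ n * mass R n w)]
  · simp
  · intro z hz
    rw [inter_comm]
    exact pathLaw_block R (Finset.mem_range.1 hz) w

theorem eq_zero_of_le_pow {a : ℝ≥0∞} (ha : a ≠ ∞) (h : ∀ n : ℕ, a.toReal ≤ (1 / 2) ^ n) :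
    a = 0 := by
  have := ge_of_tendsto' (tendsto_pow_atTop_nhds_zero_of_lt_one (r := (1 / 2 : ℝ)) (by norm_num)
    (by norm_num)) h
  exact ((ENNReal.toReal_eq_zero_iff a).1 (le_antisymm this ENNReal.toReal_nonneg)).resolve_right ha

theorem pathLaw_singleton (R : ℕ → Bool) (x : PathSpace) : pathLaw R {x} = 0 :=
  eq_zero_of_le_pow (measure_ne_top _ _) fun n => by
    rw [← pathLaw_pos R (pos_lt n x)]
    exact measureReal_mono (fun y (hy : y = x) => by rw [hy]; rfl)

theorem ae_isAdicImage (R : ℕ → Bool) : ∀ᵐ x ∂pathLaw R, IsAdicImage x (adic x) := by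
  have h : pathLaw R {x | ∀ n, colours x n = true} = 0 :=
    eq_zero_of_le_pow (measure_ne_top _ _) fun n => by
      have h2 : 0 < 2 ^ n := by positivity
      rw [← pathLaw_pos R (show 2 ^ n - 1 < 2 ^ n by omega)]
      refine measureReal_mono fun y hy => ?_
      have := allOnes_iff_posOf.1 (allOnes_iff.2 fun i (_ : i < n) => hy i)
      change posOf (colours y) n = 2 ^ n - 1
      omega
  refine measure_mono_null (fun x hx => show ∀ n, colours x n = true from fun n => ?_) h
  by_contra hc
  exact hx (isAdicImage_adic ⟨n, by simpa using hc⟩)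

theorem adic_preimage_block {n z : ℕ} (hz : z + 1 < 2 ^ n) (w : Vertex n) :
    adic ⁻¹' block n (z + 1) w = block n z w := by
  ext x
  simp only [mem_preimage, block, mem_ofPred_eq]
  have h1 := pos_lt n x
  by_cases h : pos n x + 1 < 2 ^ n
  · rw [pos_adic_of_lt h, word_adic_of_lt h]
    simp
  · rw [pos_adic_of_eq (by omega)]
    constructor
    · intro h; omega
    · intro h; omega

/-- A block in position `z + 1` pulls back to the block in position `z`, which has the same measure.
Only position `0`, where the word may change, is not covered; it is removed at level `N`, at the
price of a set of measure `2 ^ (-N)`. -/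
theorem measurePreserving_adic (R : ℕ → Bool) : MeasurePreserving adic (pathLaw R) (pathLaw R) := by
  set μ := pathLaw R with hμ
  have hpm : IsProbabilityMeasure (μ.map adic) :=
    Measure.isProbabilityMeasure_map adic.measurable.aemeasurable
  have hpos : ∀ N, MeasurableSet {x | pos N x ≠ 0} := fun N => (measurableSet_pos N 0).compl
  have hpos0 : ∀ N, (μ.map adic) {x | pos N x = 0} = μ {x | pos N x = 0} := by
    intro N
    have h2 : 0 < 2 ^ N := by positivity
    have : adic ⁻¹' {x | pos N x = 0} = {x | pos N x = 2 ^ N - 1} := by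
      ext x
      simp only [mem_preimage, mem_ofPred_eq]
      have h1 := pos_lt N x
      by_cases h : pos N x + 1 < 2 ^ N
      · rw [pos_adic_of_lt h]; omega
      · rw [pos_adic_of_eq (by omega)]; omega
    rw [adic.map_apply, this, ← ENNReal.toReal_eq_toReal_iff'
      (measure_ne_top _ _) (measure_ne_top _ _)]
    exact (pathLaw_pos R (by omega)).trans (pathLaw_pos R h2).symm
  have key : ∀ N, (μ.map adic).restrict {x | pos N x ≠ 0} = μ.restrict {x | pos N x ≠ 0} := by
    intro N
    refine ext_of_generate_finite _ (generateFrom_blocks N) (isPiSystem_blocks N) ?_ ?_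
    · rintro _ ⟨n, hn, z, w, rfl⟩
      rw [Measure.restrict_apply (measurableSet_block n z w),
        Measure.restrict_apply (measurableSet_block n z w), adic.map_apply]
      rcases (block n z w ∩ {x | pos N x ≠ 0}).eq_empty_or_nonempty with h | ⟨x, hx, hxN⟩
      · rw [h, preimage_empty]
      · have hs : block n z w ∩ {x | pos N x ≠ 0} = block n z w := by
          refine inter_eq_left.2 fun y hy => ?_
          have := (pos_word_eq_of_le hn (hy.1.trans hx.1.symm) (hy.2.trans hx.2.symm)).1
          change pos N y ≠ 0
          rw [this]; exact hxN
        rw [hs]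
        have hz0 : z ≠ 0 := by
          intro h0
          refine hxN ?_
          have : posOf (colours x) n = posOf (fun _ => false) n := by
            have h1 : posOf (fun i => Nat.testBit 0 i) n = 0 := by rw [posOf_testBit]; simp
            simp only [Nat.zero_testBit] at h1
            rw [h1, ← h0]; exact hx.1
          have h2 := posOf_eq_iff.2 fun i (hi : i < N) => posOf_eq_iff.1 this i (hi.trans_le hn)
          have h1 : posOf (fun i => Nat.testBit 0 i) N = 0 := by rw [posOf_testBit]; simp
          simp only [Nat.zero_testBit] at h1
          exact h2.trans h1
        obtain ⟨z', rfl⟩ := Nat.exists_eq_succ_of_ne_zero hz0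
        have hlt : z' + 1 < 2 ^ n := by rw [← Nat.succ_eq_add_one, ← hx.1]; exact pos_lt n x
        rw [adic_preimage_block hlt, ← ENNReal.toReal_eq_toReal_iff'
          (measure_ne_top _ _) (measure_ne_top _ _)]
        exact (pathLaw_block R (by omega) w).trans (pathLaw_block R hlt w).symm
    · have hc : ({x | pos N x ≠ 0} : Set PathSpace) = {x | pos N x = 0}ᶜ := rfl
      simp only [Measure.restrict_apply_univ]
      rw [hc, prob_compl_eq_one_sub (measurableSet_pos N 0),
        prob_compl_eq_one_sub (measurableSet_pos N 0), hpos0]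
  -- For two probability measures one inequality suffices.
  have hle : μ.map adic ≤ μ := by
    refine Measure.le_iff.2 fun B hB => ?_
    have h : ∀ N : ℕ, μ.map adic B ≤ μ B + ENNReal.ofReal ((1 / 2) ^ N) := by
      intro N
      have h1 : μ.map adic (B ∩ {x | pos N x ≠ 0}) = μ (B ∩ {x | pos N x ≠ 0}) := by
        rw [← Measure.restrict_apply hB, key, Measure.restrict_apply hB]
      have h2 : B ⊆ (B ∩ {x | pos N x ≠ 0}) ∪ {x | pos N x = 0} := fun x hx => by
        by_cases h : pos N x = 0
        · exact Or.inr h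
        · exact Or.inl ⟨hx, h⟩
      have h3 : μ {x | pos N x = 0} = ENNReal.ofReal ((1 / 2) ^ N) := by
        rw [← pathLaw_pos R (show 0 < 2 ^ N by positivity), ofReal_measureReal]
      calc μ.map adic B ≤ μ.map adic (B ∩ {x | pos N x ≠ 0}) + μ.map adic {x | pos N x = 0} :=
            (measure_mono h2).trans (measure_union_le _ _)
        _ ≤ μ B + _ := by
            rw [h1, hpos0, h3]
            gcongr
            exact inter_subset_left
    have ht : Tendsto (fun N : ℕ => μ B + ENNReal.ofReal ((1 / 2) ^ N)) atTop (𝓝 (μ B + 0)) := by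
      refine tendsto_const_nhds.add ?_
      rw [← ENNReal.ofReal_zero]
      exact ENNReal.tendsto_ofReal
        (tendsto_pow_atTop_nhds_zero_of_lt_one (by norm_num) (by norm_num))
    rw [add_zero] at ht
    exact ge_of_tendsto' ht h
  exact ⟨adic.measurable, Measure.eq_of_le_of_isProbabilityMeasure hle⟩

end PairsGraph

namespace PairsGraph

/-! ### Ergodicity -/

/-- Given the word of level `n`, membership in `A` is independent of the position. -/
def IsUniform (μ : Measure PathSpace) (n : ℕ) (A : Set PathSpace) : Prop :=
  ∀ (w : Vertex n) (z : ℕ), z < 2 ^ n →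
    μ.real (A ∩ block n z w) = (1 / 2) ^ n * μ.real (A ∩ {x | word n x = w})

variable {μ : Measure PathSpace} [IsFiniteMeasure μ]

theorem isUniform_of_const {n : ℕ} {A : Set PathSpace}
    (a : Vertex n → ℝ) (h : ∀ w z, z < 2 ^ n → μ.real (A ∩ block n z w) = a w) :
    IsUniform μ n A := by
  intro w z hz
  have h1 := sum_measureReal_inter_pos (μ := μ) n (A ∩ {x | word n x = w})
  rw [Finset.sum_congr rfl (g := fun _ => a w)] at h1
  · rw [h w z hz, ← h1]
    simp
  · intro z hz
    rw [← h w z (Finset.mem_range.1 hz), inter_assoc, inter_comm {x | word n x = w}]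
    rfl

/-- Inside a block, `adic` raises the position and keeps both the word and the set `A`. -/
theorem isUniform_of_invariant (hμ : MeasurePreserving adic μ μ) {A : Set PathSpace}
    (hA : MeasurableSet A) (hinv : adic ⁻¹' A = A) (n : ℕ) : IsUniform μ n A := by
  refine isUniform_of_const (fun w => μ.real (A ∩ block n 0 w)) fun w z hz => ?_
  induction z with
  | zero => rfl
  | succ z ih =>
    rw [← ih (by omega), measureReal_def, measureReal_def, ← hμ.measure_preimage
      (hA.inter (measurableSet_block n (z + 1) w)).nullMeasurableSet, preimage_inter, hinv,
      adic_preimage_block hz]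

/-- The part of the space on which the word of level `n + 1` is `w` and the colour of the edge that
leads to it is `b`. -/
def lastEdge (n : ℕ) (b : Bool) (w : Vertex (n + 1)) : Set PathSpace :=
  {x | colours x n = b ∧ word (n + 1) x = w}

theorem word_of_mem_lastEdge {n : ℕ} {b : Bool} {w : Vertex (n + 1)} {x : PathSpace}
    (h : x ∈ lastEdge n b w) : word n x = half b w := by
  rw [← half_word, h.1, h.2]

theorem lastEdge_inter_block {n : ℕ} (b : Bool) (w : Vertex (n + 1)) {z : ℕ} (hz : z < 2 ^ n) :
    lastEdge n b w ∩ block n z (half b w) = block (n + 1) (z + if b then 2 ^ n else 0) w := by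
  ext x
  have hp : pos (n + 1) x = pos n x + if colours x n then 2 ^ n else 0 := rfl
  have hlt := pos_lt n x
  constructor
  · rintro ⟨⟨h1, h2⟩, h3, -⟩
    exact ⟨by rw [hp, h1, h3], h2⟩
  · rintro ⟨h1, h2⟩
    rw [hp] at h1
    have hc : colours x n = b ∧ pos n x = z := by
      cases hcx : colours x n <;> cases b <;> simp [hcx] at h1 ⊢ <;> omega
    exact ⟨⟨hc.1, h2⟩, hc.2, word_of_mem_lastEdge ⟨hc.1, h2⟩⟩

/-- Position `z` of the half `b` is position `z + b * 2 ^ n` of the whole word, so uniformity passes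
to each half. This drives the induction in `IsUniform.measureReal_inter_block`. -/
theorem IsUniform.lastEdge {n : ℕ} {A : Set PathSpace} (h : IsUniform μ (n + 1) A) (b : Bool)
    (w : Vertex (n + 1)) : IsUniform μ n (A ∩ lastEdge n b w) := by
  classical
  refine isUniform_of_const (fun w' => if w' = half b w then
    (1 / 2) ^ (n + 1) * μ.real (A ∩ {x | word (n + 1) x = w}) else 0) fun w' z hz => ?_
  split_ifs with hw
  · rw [hw, inter_assoc, lastEdge_inter_block b w hz]
    refine h w _ ?_
    rw [pow_succ]
    split_ifs <;> omega
  · have : A ∩ PairsGraph.lastEdge n b w ∩ block n z w' = ∅ :=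
      eq_empty_of_forall_notMem fun x hx =>
        hw (hx.2.2.symm.trans (word_of_mem_lastEdge hx.1.2))
    rw [this, measureReal_empty]

theorem IsUniform.measureReal_lastEdge {n : ℕ} {A : Set PathSpace} (h : IsUniform μ (n + 1) A)
    (b : Bool) (w : Vertex (n + 1)) :
    μ.real (A ∩ PairsGraph.lastEdge n b w) = 1 / 2 * μ.real (A ∩ {x | word (n + 1) x = w}) := by
  rw [← sum_measureReal_inter_pos n (A ∩ PairsGraph.lastEdge n b w),
    Finset.sum_congr rfl (g := fun _ => (1 / 2) ^ (n + 1) * μ.real (A ∩ {x | word (n + 1) x = w}))]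
  · simp [pow_succ, mul_assoc]
  · intro z hz
    have hz := Finset.mem_range.1 hz
    rw [← h w (z + if b then 2 ^ n else 0) (by rw [pow_succ]; split_ifs <;> omega),
      ← lastEdge_inter_block b w hz, ← inter_assoc]
    congr 1
    ext x
    exact ⟨fun hx => ⟨hx.1, hx.2, word_of_mem_lastEdge hx.1.2⟩, fun hx => ⟨hx.1, hx.2.1⟩⟩

theorem measureReal_inter_eq_sum_lastEdge (n : ℕ) (D : Set PathSpace) (w : Vertex (n + 1)) :
    μ.real (D ∩ {x | word (n + 1) x = w}) = ∑ b, μ.real (D ∩ lastEdge n b w) := by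
  rw [← sum_measureReal_inter_fiber (f := fun x => colours x n)
    (fun b => ((measurable_pi_apply n).comp measurable_colours) (measurableSet_singleton b))]
  refine Finset.sum_congr rfl fun b _ => ?_
  congr 1
  ext x
  simp only [mem_inter_iff, mem_ofPred_eq, lastEdge]
  tauto

/-- All positions in the large block being equally likely on `A`, the chance of being in a copy of
`w₀` is the proportion of such copies. -/
theorem IsUniform.measureReal_inter_block {n z₀ : ℕ} (hz₀ : z₀ < 2 ^ n) (w₀ : Vertex n) (k : ℕ)
    {A : Set PathSpace} (h : IsUniform μ (n + k) A) (w : Vertex (n + k)) :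
    μ.real (A ∩ block n z₀ w₀ ∩ {x | word (n + k) x = w}) =
      (1 / 2) ^ n * freq w₀ k w * μ.real (A ∩ {x | word (n + k) x = w}) := by
  induction k generalizing A with
  | zero =>
    rw [freq]
    split_ifs with hw
    · subst hw
      rw [mul_one]
      refine Eq.trans ?_ (h w z₀ hz₀)
      congr 1
      ext x
      exact ⟨fun hx => hx.1, fun hx => ⟨hx, hx.2.2⟩⟩
    · have : A ∩ block n z₀ w₀ ∩ {x | word (n + 0) x = w} = ∅ :=
        eq_empty_of_forall_notMem fun x hx => hw (hx.2.symm.trans hx.1.2.2)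
      rw [this, measureReal_empty]
      ring
  | succ k ih =>
    have hb : ∀ b, μ.real (A ∩ block n z₀ w₀ ∩ PairsGraph.lastEdge (n + k) b w) =
        (1 / 2) ^ n * freq w₀ k (half (n := n + k) b w) *
          (1 / 2 * μ.real (A ∩ {x | word (n + (k + 1)) x = w})) := by
      intro b
      have h1 := ih (h.lastEdge (n := n + k) b w) (half (n := n + k) b w)
      have e : ∀ D : Set PathSpace, D ∩ PairsGraph.lastEdge (n + k) b w ∩
          {x | word (n + k) x = half (n := n + k) b w} = D ∩ PairsGraph.lastEdge (n + k) b w :=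
        fun D => inter_eq_left.2 fun x hx => word_of_mem_lastEdge hx.2
      rw [inter_right_comm, e] at h1
      rw [inter_right_comm A (block n z₀ w₀), h1]
      congr 1
      exact h.measureReal_lastEdge (n := n + k) b w
    change μ.real (A ∩ block n z₀ w₀ ∩ {x | word (n + k + 1) x = w}) = _
    rw [measureReal_inter_eq_sum_lastEdge, Fintype.sum_bool, hb, hb, freq]
    ring

/-- Conditionally on a long word, the block has relative weight `freq` in `A`; the frequency is
close in mean square to the constant `mass R n w`, which gives independence. -/
theorem measureReal_inter_block_of_invariant {R : ℕ → Bool} (hR : ∀ N, ∃ i, N ≤ i ∧ R i = false)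
    {A : Set PathSpace} (hA : MeasurableSet A) (hinv : adic ⁻¹' A = A) {n z : ℕ} (hz : z < 2 ^ n)
    (w : Vertex n) : (pathLaw R).real (A ∩ block n z w) =
      (pathLaw R).real A * (pathLaw R).real (block n z w) := by
  set μ := pathLaw R with hμ
  rw [← sub_eq_zero, ← abs_nonpos_iff]
  refine le_of_forall_pos_le_add fun ε hε => ?_
  obtain ⟨k, hk⟩ := exists_freqVar_lt (R := R) hR w (show 0 < ε * ε by positivity)
  have hu := isUniform_of_invariant (measurePreserving_adic R) hA hinv (n + k)
  rw [← sum_measureReal_inter_word (n + k) (A ∩ block n z w),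
    ← sum_measureReal_inter_word (n + k) A, hμ, pathLaw_block R hz, ← hμ, Finset.sum_mul,
    ← Finset.sum_sub_distrib, zero_add]
  calc _ ≤ ∑ w' : Vertex (n + k), mass R (n + k) w' * |freq w k w' - mass R n w| := by
        refine (Finset.abs_sum_le_sum_abs _ _).trans (Finset.sum_le_sum fun w' _ => ?_)
        rw [hu.measureReal_inter_block hz w k w', show (1 / 2) ^ n * freq w k w' *
          μ.real (A ∩ {x | word (n + k) x = w'}) - μ.real (A ∩ {x | word (n + k) x = w'}) *
          ((1 / 2) ^ n * mass R n w) = ((1 / 2) ^ n * μ.real (A ∩ {x | word (n + k) x = w'})) *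
          (freq w k w' - mass R n w) by ring, abs_mul]
        refine mul_le_mul_of_nonneg_right ?_ (abs_nonneg _)
        rw [abs_of_nonneg (by positivity), ← pathLaw_word R (n + k) w']
        calc _ ≤ 1 * μ.real (A ∩ {x | word (n + k) x = w'}) := by
              gcongr
              exact pow_le_one₀ (by norm_num) (by norm_num)
          _ ≤ _ := by rw [one_mul]; exact measureReal_mono inter_subset_right
    _ = expect R (n + k) fun w' => |freq w k w' - mass R n w| := rfl
    -- The inequality `|a| ≤ ε / 2 + a² / (2 ε)` passes from the absolute deviation to the variance,
    -- which is less than `ε²`.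
    _ ≤ expect R (n + k) fun w' => ε / 2 + (freq w k w' - mass R n w) ^ 2 * (1 / (2 * ε)) := by
        refine expect_mono fun w' => ?_
        rw [← sq_abs (freq w k w' - mass R n w), mul_one_div, div_add_div _ _ two_ne_zero
          (by positivity), le_div_iff₀ (by positivity)]
        nlinarith [sq_nonneg (ε - |freq w k w' - mass R n w|)]
    _ = ε / 2 + freqVar R w k * (1 / (2 * ε)) := by
        rw [expect_add, expect_const, expect_mul_const]; rfl
    _ ≤ ε / 2 + ε * ε * (1 / (2 * ε)) := by gcongr
    _ = ε := by field_simp; ring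

/-- An invariant set is independent of a generating π-system, hence of itself. -/
theorem ergodic_adic {R : ℕ → Bool} (hR : ∀ N, ∃ i, N ≤ i ∧ R i = false) :
    Ergodic adic (pathLaw R) := by
  refine { measurePreserving_adic R with aeconst_set := fun A hA hinv => ?_ }
  set μ := pathLaw R with hμ
  have h : μ.restrict A = μ A • μ := by
    refine ext_of_generate_finite _ (generateFrom_blocks 0) (isPiSystem_blocks 0) ?_ ?_
    · rintro _ ⟨n, -, z, w, rfl⟩
      rw [Measure.restrict_apply (measurableSet_block n z w), Measure.smul_apply, smul_eq_mul,
        inter_comm]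
      by_cases hz : z < 2 ^ n
      · rw [← ENNReal.toReal_eq_toReal_iff' (measure_ne_top _ _) (by finiteness),
          ENNReal.toReal_mul]
        exact measureReal_inter_block_of_invariant hR hA hinv hz w
      · have : block n z w = ∅ := eq_empty_of_forall_notMem fun x hx => hz (hx.1 ▸ pos_lt n x)
        simp [this]
    · simp
  have h2 : μ A = μ A * μ A := by
    conv_lhs => rw [← inter_self A, ← Measure.restrict_apply hA, h]
    simp
  rw [eventuallyConst_set']
  rcases eq_or_ne (μ A) 0 with h0 | h0
  · exact Or.inl (ae_eq_empty.2 h0)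
  · right
    rw [ae_eq_univ_iff_measure_eq hA.nullMeasurableSet, measure_univ]
    have := (ENNReal.mul_eq_left h0 (measure_ne_top μ A)).1 h2.symm
    exact this

end PairsGraph

namespace ScalingEntropy

/-! ### Almost invariant sets of integers -/

/-- The number of points that distinguish a set of integers from its translate by `1`. -/
def boundaryCard (S : Finset ℤ) : ℕ := ((S.image (fun m => m + 1)) ∆ S).card

theorem boundaryCard_pos {S : Finset ℤ} (hS : S.Nonempty) : 0 < boundaryCard S := by
  refine Finset.card_pos.2 ⟨S.max' hS + 1, ?_⟩
  rw [Finset.mem_symmDiff]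
  refine Or.inl ⟨Finset.mem_image_of_mem _ (S.max'_mem hS), fun h => ?_⟩
  have := S.le_max' _ h
  omega

/-- On the way from `m` to `m + l` by unit steps there is an exit from `S`, and the exits at a given
step number occur at distinct boundary points. -/
theorem card_add_notMem_le (S : Finset ℤ) (l : ℤ) :
    (S.filter fun m => m + l ∉ S).card ≤ l.natAbs * boundaryCard S := by
  have hinj : ∀ l : ℤ, Set.InjOn (fun m : ℤ => m + l) Set.univ := fun l a _ b _ h => by
    simpa using h
  have hpos : ∀ n : ℕ, (S.filter fun m => m + (n : ℤ) ∉ S).card ≤ n * boundaryCard S := by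
    intro n
    induction n with
    | zero => simp
    | succ n ih =>
      have h1 : (S.filter fun m => m + (n : ℤ) ∈ S ∧ m + (n : ℤ) + 1 ∉ S).card ≤
          boundaryCard S := by
        refine Finset.card_le_card_of_injOn (fun m => m + ((n : ℤ) + 1)) (fun m hm => ?_)
          ((hinj _).mono (subset_univ _))
        simp only [Finset.coe_filter, mem_ofPred_eq] at hm
        simp only [SetLike.mem_coe, Finset.mem_symmDiff, Finset.mem_image]
        exact Or.inl ⟨⟨_, hm.2.1, by ring⟩, by rw [← add_assoc]; exact hm.2.2⟩
      have h2 : (S.filter fun m => m + ((n + 1 : ℕ) : ℤ) ∉ S) ⊆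
          (S.filter fun m => m + (n : ℤ) ∉ S) ∪
            S.filter fun m => m + (n : ℤ) ∈ S ∧ m + (n : ℤ) + 1 ∉ S := by
        intro m hm
        simp only [Finset.mem_union, Finset.mem_filter] at hm ⊢
        rw [show m + ((n + 1 : ℕ) : ℤ) = m + (n : ℤ) + 1 by push_cast; ring] at hm
        tauto
      refine (Finset.card_le_card h2).trans ((Finset.card_union_le _ _).trans ?_)
      rw [add_mul, one_mul]
      exact add_le_add ih h1
  have hneg : ∀ n : ℕ, (S.filter fun m => m + -(n : ℤ) ∉ S).card ≤ n * boundaryCard S := by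
    intro n
    induction n with
    | zero => simp
    | succ n ih =>
      have h1 : (S.filter fun m => m + -(n : ℤ) ∈ S ∧ m + -(n : ℤ) - 1 ∉ S).card ≤
          boundaryCard S := by
        refine Finset.card_le_card_of_injOn (fun m => m + -(n : ℤ)) (fun m hm => ?_)
          ((hinj _).mono (subset_univ _))
        simp only [Finset.coe_filter, mem_ofPred_eq] at hm
        simp only [SetLike.mem_coe, Finset.mem_symmDiff, Finset.mem_image]
        refine Or.inr ⟨hm.2.1, ?_⟩
        rintro ⟨a, ha, hae⟩
        refine hm.2.2 ?_
        rw [← hae]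
        simpa using ha
      have h2 : (S.filter fun m => m + -((n + 1 : ℕ) : ℤ) ∉ S) ⊆
          (S.filter fun m => m + -(n : ℤ) ∉ S) ∪
            S.filter fun m => m + -(n : ℤ) ∈ S ∧ m + -(n : ℤ) - 1 ∉ S := by
        intro m hm
        simp only [Finset.mem_union, Finset.mem_filter] at hm ⊢
        rw [show m + -((n + 1 : ℕ) : ℤ) = m + -(n : ℤ) - 1 by push_cast; ring] at hm
        tauto
      refine (Finset.card_le_card h2).trans ((Finset.card_union_le _ _).trans ?_)
      rw [add_mul, one_mul]
      exact add_le_add ih h1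
  rcases Int.natAbs_eq l with h | h
  · rw [h]; exact hpos _
  · rw [h, Int.natAbs_neg]; exact hneg _

/-- The points of `S` some translate of which by an element of `J` is not in `S`. -/
def fringe (S J : Finset ℤ) : Finset ℤ := S.filter fun m => ∃ l ∈ J, m + l ∉ S

theorem card_fringe_le (S J : Finset ℤ) :
    (fringe S J).card ≤ (∑ l ∈ J, l.natAbs) * boundaryCard S := by
  have h : fringe S J ⊆ J.biUnion fun l => S.filter fun m => m + l ∉ S := by
    intro m hm
    simp only [fringe, Finset.mem_filter, Finset.mem_biUnion] at hm ⊢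
    obtain ⟨hmS, l, hl, hml⟩ := hm
    exact ⟨l, hl, hmS, hml⟩
  refine (Finset.card_le_card h).trans (Finset.card_biUnion_le.trans ?_)
  rw [Finset.sum_mul]
  exact Finset.sum_le_sum fun l _ => card_add_notMem_le S l

theorem card_fringe_Icc_le (S : Finset ℤ) (L : ℕ) :
    (fringe S (Finset.Icc (-2 ^ L) (2 ^ L))).card ≤ 3 * 4 ^ L * boundaryCard S := by
  refine (card_fringe_le _ _).trans (Nat.mul_le_mul_right _ ?_)
  have h1 : ∀ l ∈ Finset.Icc (-2 ^ L : ℤ) (2 ^ L), l.natAbs ≤ 2 ^ L := by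
    intro l hl
    rw [Finset.mem_Icc, ← abs_le, Int.abs_eq_natAbs] at hl
    exact_mod_cast hl
  refine (Finset.sum_le_card_nsmul _ _ _ h1).trans ?_
  have h2 : (2 ^ L + 1 - (-2 ^ L) : ℤ).toNat = 2 * 2 ^ L + 1 := by
    rw [show (2 ^ L + 1 - (-2 ^ L) : ℤ) = ((2 * 2 ^ L + 1 : ℕ) : ℤ) by push_cast; ring,
      Int.toNat_natCast]
  rw [Int.card_Icc, h2, smul_eq_mul, show (4 : ℕ) ^ L = 2 ^ L * 2 ^ L by
    rw [← mul_pow]; norm_num]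
  have : 1 ≤ 2 ^ L := Nat.one_le_two_pow
  nlinarith

/-- The number of blocks of length `2 ^ L` met by a set of integers. -/
theorem card_image_div_le (S : Finset ℤ) (L : ℕ) (P : ℤ) :
    (S.image fun m => (P + m) / 2 ^ L).card * 2 ^ L ≤
      S.card + (fringe S (Finset.Icc (-2 ^ L) (2 ^ L))).card * 2 ^ L := by
  set F := fringe S (Finset.Icc (-2 ^ L) (2 ^ L)) with hF
  have hM : (0 : ℤ) < 2 ^ L := by positivity
  set Q := (S \ F).image fun m => (P + m) / 2 ^ L with hQ
  have h1 : (S.image fun m => (P + m) / 2 ^ L) ⊆ Q ∪ F.image fun m => (P + m) / 2 ^ L := by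
    intro q hq
    obtain ⟨m, hm, rfl⟩ := Finset.mem_image.1 hq
    by_cases hmF : m ∈ F
    · exact Finset.mem_union_right _ (Finset.mem_image_of_mem _ hmF)
    · exact Finset.mem_union_left _ (Finset.mem_image_of_mem _ (Finset.mem_sdiff.2 ⟨hm, hmF⟩))
  -- The blocks in `Q` are met at a point outside the fringe, so all their `2 ^ L` places come from
  -- `S`. The fringe accounts for the other blocks.
  have h2 : Q.card * 2 ^ L ≤ S.card := by
    have hc : (Q ×ˢ Finset.Ico (0 : ℤ) (2 ^ L)).card = Q.card * 2 ^ L := by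
      rw [Finset.card_product, Int.card_Ico, sub_zero]
      congr 1
    rw [← hc]
    refine Finset.card_le_card_of_injOn (fun p => 2 ^ L * p.1 + p.2 - P) (fun p hp => ?_)
      fun p hp p' hp' he => ?_
    · simp only [Finset.coe_product, mem_prod, SetLike.mem_coe, Finset.mem_Ico] at hp
      obtain ⟨m, hm, hmp⟩ := Finset.mem_image.1 hp.1
      obtain ⟨hmS, hmF⟩ := Finset.mem_sdiff.1 hm
      by_contra hc
      refine hmF (Finset.mem_filter.2 ⟨hmS, 2 ^ L * p.1 + p.2 - P - m, ?_, ?_⟩)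
      · have e1 := Int.mul_ediv_add_emod (P + m) (2 ^ L)
        have e2 := Int.emod_nonneg (P + m) hM.ne'
        have e3 := Int.emod_lt_of_pos (P + m) hM
        rw [hmp] at e1
        rw [Finset.mem_Icc]
        constructor <;> linarith
      · rw [add_sub_cancel]; exact hc
    · simp only [Finset.coe_product, mem_prod, SetLike.mem_coe, Finset.mem_Ico] at hp hp'
      have he : 2 ^ L * p.1 + p.2 = 2 ^ L * p'.1 + p'.2 := by simpa using he
      have e1 : p.1 = p'.1 := by
        have h1 := Int.add_mul_ediv_left p.2 p.1 hM.ne'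
        have h2 := Int.add_mul_ediv_left p'.2 p'.1 hM.ne'
        rw [Int.ediv_eq_zero_of_lt hp.2.1 hp.2.2] at h1
        rw [Int.ediv_eq_zero_of_lt hp'.2.1 hp'.2.2] at h2
        rw [add_comm] at h1 h2
        rw [he, h2] at h1
        linarith
      refine Prod.ext e1 ?_
      rw [e1] at he
      linarith
  calc _ ≤ (Q.card + F.card) * 2 ^ L := Nat.mul_le_mul_right _ ((Finset.card_le_card h1).trans
        ((Finset.card_union_le _ _).trans (add_le_add le_rfl Finset.card_image_le)))
    _ ≤ _ := by rw [add_mul]; exact add_le_add h2 le_rfl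

/-! ### Covers given by finite codes -/

theorem hasCover_of_code {X κ : Type*} [MeasurableSpace X] {μ : Measure X} {ρ : X → X → ℝ}
    {ε δ : ℝ} (hδ : 0 ≤ δ) (hδε : δ < ε) {f : X → κ} (hf : ∀ k, MeasurableSet (f ⁻¹' {k}))
    (A : Finset κ) {B : Set X} (hB : MeasurableSet B) (hμ : μ B < ENNReal.ofReal ε)
    (hA : ∀ x ∉ B, f x ∈ A)
    (hρ : ∀ x ∉ B, ∀ y ∉ B, f x = f y → ENNReal.ofReal (ρ x y) ≤ ENNReal.ofReal δ) :
    HasCover μ ρ ε A.card := by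
  refine ⟨fun i => Fin.cases (motive := fun _ => Set X) B
    (fun i => f ⁻¹' {(A.equivFin.symm i).1} \ B) i, fun i => ?_, ?_, hμ, ?_⟩
  · refine Fin.cases hB (fun i => (hf _).diff hB) i
  · refine eq_univ_of_forall fun x => mem_iUnion.2 ?_
    by_cases hx : x ∈ B
    · exact ⟨0, hx⟩
    · refine ⟨(A.equivFin ⟨f x, hA x hx⟩).succ, ?_, hx⟩
      simp
  · intro i
    refine Fin.cases (fun h => absurd rfl h) (fun i _ => ?_) i
    refine lt_of_le_of_lt ?_ ((ENNReal.ofReal_lt_ofReal_iff_of_nonneg hδ).2 hδε)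
    refine iSup₂_le fun x hx => iSup₂_le fun y hy => ?_
    exact hρ x hx.2 y hy.2 (hx.1.trans hy.1.symm)

theorem epsEntropy_le_of_hasCover {X : Type*} [MeasurableSpace X] {μ : Measure X} {ρ : X → X → ℝ}
    {ε : ℝ} {k : ℕ} (hk : 1 ≤ k) (h : HasCover μ ρ ε k) :
    epsEntropy μ ρ ε ≤ ENNReal.ofReal (Real.logb 2 k) :=
  iInf₂_le k ⟨hk, h⟩

/-- The average over `S` of a function along the orbits. -/
noncomputable def averageFun {X : Type*} [MeasurableSpace X] (T : X ≃ᵐ X) (S : Finset ℤ)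
    (w : X → ℝ≥0∞) : X → ℝ≥0∞ := fun x => (S.card : ℝ≥0∞)⁻¹ * ∑ m ∈ S, w (act T m x)

theorem measurable_averageFun {X : Type*} [MeasurableSpace X] {μ : Measure X} {T : X ≃ᵐ X}
    (hT : MeasurePreserving T μ μ) (S : Finset ℤ) {w : X → ℝ≥0∞} (hw : Measurable w) :
    Measurable (averageFun T S w) :=
  (Finset.measurable_fun_sum _ fun m _ =>
    hw.comp (measurePreserving_act T hT m).measurable).const_mul _

theorem lintegral_averageFun {X : Type*} [MeasurableSpace X] {μ : Measure X} {T : X ≃ᵐ X}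
    (hT : MeasurePreserving T μ μ) {S : Finset ℤ} (hS : S.Nonempty) {w : X → ℝ≥0∞}
    (hw : Measurable w) : ∫⁻ x, averageFun T S w x ∂μ = ∫⁻ x, w x ∂μ := by
  have hm : ∀ m, Measurable fun x => w (act T m x) := fun m =>
    hw.comp (measurePreserving_act T hT m).measurable
  unfold averageFun
  rw [lintegral_const_mul _ (Finset.measurable_fun_sum _ fun m _ => hm m),
    lintegral_finsetSum _ fun m _ => hm m]
  simp only [(measurePreserving_act T hT _).lintegral_comp hw, Finset.sum_const, nsmul_eq_mul]
  rw [← mul_assoc, ENNReal.inv_mul_cancel (by simpa using hS.ne_empty) (by simp), one_mul]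

theorem ofReal_average_le {X : Type*} [MeasurableSpace X] {T : X ≃ᵐ X} {S : Finset ℤ}
    (hS : S.Nonempty) {ρ : X → X → ℝ} (hρ : ∀ x y, 0 ≤ ρ x y) {δ : ℝ} {w : X → ℝ≥0∞} {x y : X}
    (h : ∀ m ∈ S, ENNReal.ofReal (ρ (act T m x) (act T m y)) ≤
      ENNReal.ofReal δ + w (act T m x) + w (act T m y)) :
    ENNReal.ofReal (average T S ρ x y) ≤
      ENNReal.ofReal δ + averageFun T S w x + averageFun T S w y := by
  have hc : (0 : ℝ) < S.card := by exact_mod_cast hS.card_pos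
  unfold average averageFun
  rw [ENNReal.ofReal_mul (by positivity), ENNReal.ofReal_sum_of_nonneg fun m _ => hρ _ _,
    ENNReal.ofReal_inv_of_pos hc, ENNReal.ofReal_natCast]
  calc _ ≤ (S.card : ℝ≥0∞)⁻¹ * ∑ m ∈ S, (ENNReal.ofReal δ + w (act T m x) + w (act T m y)) := by
        gcongr with m hm
        exact h m hm
    _ = _ := by
        rw [Finset.sum_add_distrib, Finset.sum_add_distrib, mul_add, mul_add, Finset.sum_const,
          nsmul_eq_mul, ← mul_assoc, ENNReal.inv_mul_cancel (by simpa using hS.ne_empty) (by simp),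
          one_mul]

end ScalingEntropy

namespace PairsGraph

open ScalingEntropy

/-! ### Positions and words along an orbit -/

theorem pos_adic (L : ℕ) (x : PathSpace) :
    (pos L (adic x) : ℤ) = ((pos L x : ℤ) + 1) % 2 ^ L := by
  have h := pos_lt L x
  by_cases h1 : pos L x + 1 < 2 ^ L
  · rw [pos_adic_of_lt h1, Int.emod_eq_of_lt (by positivity) (by exact_mod_cast h1)]
    push_cast
    rfl
  · have h2 : pos L x + 1 = 2 ^ L := by omega
    rw [pos_adic_of_eq h2, show (pos L x : ℤ) + 1 = 2 ^ L by exact_mod_cast h2, Int.emod_self]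
    rfl

theorem pos_act (L : ℕ) (x : PathSpace) (m : ℤ) :
    (pos L (act adic m x) : ℤ) = ((pos L x : ℤ) + m) % 2 ^ L := by
  have hlt : ∀ y : PathSpace, (pos L y : ℤ) % 2 ^ L = pos L y := fun y =>
    Int.emod_eq_of_lt (by positivity) (by exact_mod_cast pos_lt L y)
  induction m using Int.induction_on with
  | zero => rw [add_zero, hlt]; rfl
  | succ n ih =>
    rw [add_comm (n : ℤ) 1, act_add, act_one, pos_adic, ih, Int.emod_add_emod]
    congr 1
    ring
  | pred n ih =>
    have h1 : act adic (-n) x = adic (act adic (-n - 1) x) := by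
      rw [← act_one, ← act_add]; congr 1; ring
    rw [h1, pos_adic] at ih
    rw [← hlt]
    have h2 := Int.ModEq.sub_right 1 (show _ ≡ _ [ZMOD 2 ^ L] from ih)
    rw [add_sub_cancel_right] at h2
    rw [← add_sub_assoc]
    exact h2

/-- The word of level `L` can change only when the position wraps around, and the quotient counts
the wraps. -/
theorem word_act_eq (L : ℕ) (x : PathSpace) {m m' : ℤ}
    (h : ((pos L x : ℤ) + m) / 2 ^ L = ((pos L x : ℤ) + m') / 2 ^ L) :
    word L (act adic m x) = word L (act adic m' x) := by
  have hM : (0 : ℤ) < 2 ^ L := by positivity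
  have key : ∀ (k : ℕ) (m : ℤ), ((pos L x : ℤ) + m) / 2 ^ L = ((pos L x : ℤ) + (m + k)) / 2 ^ L →
      word L (act adic m x) = word L (act adic (m + k) x) := by
    intro k m
    induction k with
    | zero => intro; simp
    | succ k ih =>
      intro h
      have h1 : ((pos L x : ℤ) + m) / 2 ^ L ≤ ((pos L x : ℤ) + (m + k)) / 2 ^ L :=
        Int.ediv_le_ediv hM (by omega)
      have h2 : ((pos L x : ℤ) + (m + k)) / 2 ^ L ≤ ((pos L x : ℤ) + (m + (k + 1 : ℕ))) / 2 ^ L :=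
        Int.ediv_le_ediv hM (by push_cast; omega)
      have h3 : ((pos L x : ℤ) + m) / 2 ^ L = ((pos L x : ℤ) + (m + k)) / 2 ^ L := by omega
      have h4 : ((pos L x : ℤ) + (m + k)) / 2 ^ L =
          ((pos L x : ℤ) + (m + (k + 1 : ℕ))) / 2 ^ L := by omega
      rw [ih h3, show m + ((k + 1 : ℕ) : ℤ) = 1 + (m + k) by push_cast; ring,
        act_add adic 1, act_one]
      refine (word_adic_of_lt ?_).symm
      have e1 := Int.mul_ediv_add_emod ((pos L x : ℤ) + (m + k)) (2 ^ L)
      have e2 := Int.mul_ediv_add_emod ((pos L x : ℤ) + (m + (k + 1 : ℕ))) (2 ^ L)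
      have e3 := Int.emod_lt_of_pos ((pos L x : ℤ) + (m + (k + 1 : ℕ))) hM
      rw [← h4] at e2
      rw [← pos_act] at e1
      push_cast at e2 e3
      have : (pos L (act adic (m + k) x) : ℤ) + 1 < 2 ^ L := by linarith
      exact_mod_cast this
  rcases le_total m m' with hle | hle
  · obtain ⟨k, rfl⟩ := Int.le.dest hle
    exact key k m h
  · obtain ⟨k, rfl⟩ := Int.le.dest hle
    exact (key k m' h.symm).symm

end PairsGraph

namespace PairsGraph

open ScalingEntropy

/-! ### The upper bound for the entropy -/

/-- The colours and the letters of a path, as one sequence. -/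
def coordSeq (x : PathSpace) (i : ℕ) : Bool :=
  if i % 2 = 0 then colours x (i / 2) else letter x (i / 2)

theorem measurable_coordSeq : Measurable coordSeq := by
  refine measurable_pi_lambda _ fun i => ?_
  unfold coordSeq
  split_ifs
  · exact (measurable_pi_apply _).comp measurable_colours
  · exact (measurable_pi_apply (i / 2)).comp (measurable_snd.comp pathEquiv.measurable)

theorem coordSeq_injective : Function.Injective coordSeq := by
  intro x y h
  refine pathEquiv.injective (Prod.ext (funext fun i => ?_) (funext fun i => ?_))
  · have h1 : 2 * i / 2 = i := by omega
    have h2 := congrFun h (2 * i)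
    unfold coordSeq at h2
    rwa [if_pos (by omega), if_pos (by omega), h1] at h2
  · have h1 : (2 * i + 1) / 2 = i := by omega
    have h2 := congrFun h (2 * i + 1)
    unfold coordSeq at h2
    rwa [if_neg (by omega), if_neg (by omega), h1] at h2

theorem coordSeq_eq_of_lt {x y : PathSpace} {L i : ℕ} (hi : i < L) (hp : pos L x = pos L y)
    (hw : word L x = word L y) : coordSeq x i = coordSeq y i := by
  unfold coordSeq
  split_ifs
  · exact congrArg Edge.colour (edge_eq_of_lt (show i / 2 < L by omega) hp hw)
  · obtain ⟨h1, h2⟩ := pos_word_eq_of_le (show i / 2 ≤ L by omega) hp hw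
    simp only [letter, h1, h2]

/-- The position of a path in its block of level `L` together with the words of level `L` seen
along the orbit at the times from `S`. -/
noncomputable def itinerary (L : ℕ) (S : Finset ℤ) (x : PathSpace) : Fin (2 ^ L) × (S → Vertex L) :=
  (⟨pos L x, pos_lt L x⟩, fun m => word L (act adic m x))

theorem measurableSet_itinerary (R : ℕ → Bool) (L : ℕ) (S : Finset ℤ)
    (d : Fin (2 ^ L) × (S → Vertex L)) : MeasurableSet (itinerary L S ⁻¹' {d}) := by
  have h : itinerary L S ⁻¹' {d} = {x | pos L x = d.1} ∩
      ⋂ m : S, act adic m ⁻¹' {x | word L x = d.2 m} := by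
    ext x
    simp only [mem_preimage, mem_singleton_iff, itinerary, Prod.ext_iff, Fin.ext_iff, funext_iff,
      mem_inter_iff, mem_ofPred_eq, mem_iInter]
  rw [h]
  exact (measurableSet_pos _ _).inter (MeasurableSet.iInter fun m =>
    (measurePreserving_act adic (measurePreserving_adic R) m).measurable (measurableSet_word _ _))

/-- The itineraries that are compatible with the block structure. -/
noncomputable def admissibleItineraries (R : ℕ → Bool) (L : ℕ) (S : Finset ℤ) :
    Finset (Fin (2 ^ L) × (S → Vertex L)) :=
  open Classical in
  Finset.univ.filter fun d => (∀ m, mass R L (d.2 m) ≠ 0) ∧ ∀ m m' : S,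
    ((d.1 : ℤ) + m) / 2 ^ L = ((d.1 : ℤ) + m') / 2 ^ L → d.2 m = d.2 m'

/-- Given the position, an itinerary is determined by one word for each block met, and there are at
most `2 ^ height` words of positive mass. -/
theorem card_admissibleItineraries_le (R : ℕ → Bool) (L : ℕ) (S : Finset ℤ) {K : ℕ}
    (hK : ∀ P : Fin (2 ^ L), (S.image fun m => ((P : ℤ) + m) / 2 ^ L).card ≤ K) :
    (admissibleItineraries R L S).card ≤ 2 ^ L * 2 ^ (height R L * K) := by
  classical
  have hfib : ∀ P : Fin (2 ^ L), ((admissibleItineraries R L S).filter fun d => d.1 = P).card ≤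
      2 ^ (height R L * K) := by
    intro P
    set Q := S.image fun m => ((P : ℤ) + m) / 2 ^ L with hQ
    have hrep : ∀ q : Q, ∃ m : S, ((P : ℤ) + m) / 2 ^ L = q := by
      rintro ⟨q, hq⟩
      obtain ⟨m, hm, rfl⟩ := Finset.mem_image.1 hq
      exact ⟨⟨m, hm⟩, rfl⟩
    choose rep hrep using hrep
    let g : {d // d ∈ (admissibleItineraries R L S).filter fun d => d.1 = P} →
        Q → {w : Vertex L // mass R L w ≠ 0} := fun d q => ⟨d.1.2 (rep q), by
      have := d.2
      simp only [admissibleItineraries, Finset.mem_filter] at this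
      exact this.1.2.1 _⟩
    have hg : Function.Injective g := by
      rintro ⟨d, hd⟩ ⟨d', hd'⟩ h
      simp only [admissibleItineraries, Finset.mem_filter, Finset.mem_univ, true_and] at hd hd'
      refine Subtype.ext (Prod.ext (hd.2.trans hd'.2.symm) (funext fun m => ?_))
      have hq : ((P : ℤ) + m) / 2 ^ L ∈ Q := Finset.mem_image_of_mem _ m.2
      have h1 := congrArg Subtype.val (congrFun h ⟨_, hq⟩)
      have h2 := hrep ⟨_, hq⟩
      have e1 := hd.1.2 m (rep ⟨_, hq⟩) (by rw [hd.2, h2])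
      have e2 := hd'.1.2 m (rep ⟨_, hq⟩) (by rw [hd'.2, h2])
      exact e1.trans (h1.trans e2.symm)
    have h1 := Fintype.card_le_of_injective g hg
    rw [Fintype.card_coe, Fintype.card_fun, Fintype.card_coe] at h1
    refine h1.trans ((Nat.pow_le_pow_left (card_support_mass_le L) _).trans ?_)
    rw [← pow_mul]
    exact Nat.pow_le_pow_right two_pos (Nat.mul_le_mul_left _ (hK P))
  rw [Finset.card_eq_sum_card_fiberwise (f := Prod.fst) (t := Finset.univ) (by simp)]
  refine (Finset.sum_le_card_nsmul _ _ _ fun P _ => hfib P).trans ?_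
  simp

/-- The itinerary serves as a code. It fixes the cylinder of level `N` at each time in `S`, so it
controls the average of `ρ` wherever the average of the error `w` is small. -/
theorem epsEntropy_average_le {R : ℕ → Bool} {ρ : PathSpace → PathSpace → ℝ}
    (h : IsMeasurableSemimetric (pathLaw R) ρ) (ha : IsAdmissible (pathLaw R) ρ)
    (hs : IsSummable (pathLaw R) ρ) {ε : ℝ} (hε : 0 < ε) :
    ∃ N : ℕ, ∀ L, N ≤ L → ∀ S : Finset ℤ, S.Nonempty →
      3 * 8 ^ L * boundaryCard S ≤ S.card →
      epsEntropy (pathLaw R) (average adic S ρ) ε ≤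
        ENNReal.ofReal (L + 2 * S.card / mult R L) := by
  set μ := pathLaw R with hμ
  have hT := measurePreserving_adic R
  -- The distance bound will be `3 * δ < ε`: one `δ` for the cylinders and one for the error at each
  -- of the two points.
  set δ := ε / 4 with hδ
  have hδ0 : 0 < δ := by positivity
  -- Below `ε` for the exceptional set of the cover, and below `1` so that at least one itinerary
  -- occurs.
  set κ : ℝ≥0∞ := ENNReal.ofReal (min ε 1 / 2) with hκ
  have hκ0 : κ ≠ 0 := by
    rw [hκ, ne_eq, ENNReal.ofReal_eq_zero, not_le]; positivity
  obtain ⟨N, w, hw, hwint, hwρ⟩ := exists_cylinder_bound h ha hs measurable_coordSeq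
    coordSeq_injective hδ0 (η := ENNReal.ofReal δ * κ) (mul_ne_zero (by simpa using hδ0) hκ0)
  refine ⟨N, fun L hL S hS hbd => ?_⟩
  -- the exceptional set
  have hact := measurePreserving_act adic hT
  set B₁ : Set PathSpace := {x | ENNReal.ofReal δ ≤ averageFun adic S w x} with hB₁
  set B₂ : Set PathSpace := ⋃ m ∈ S, act adic m ⁻¹' {x | mass R L (word L x) = 0} with hB₂
  have hzero : MeasurableSet {x | mass R L (word L x) = 0} :=
    measurable_word L (Set.toFinite {w | mass R L w = 0}).measurableSet
  have hzeroμ : μ {x | mass R L (word L x) = 0} = 0 := by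
    have : {x | mass R L (word L x) = 0} = ⋃ w ∈ {w : Vertex L | mass R L w = 0},
        {x | word L x = w} := by ext x; simp
    rw [this, measure_biUnion_null_iff (Set.to_countable _)]
    intro w hw
    rw [← measureReal_eq_zero_iff, hμ, pathLaw_word]
    exact hw
  have hB₁m : MeasurableSet B₁ := measurableSet_le measurable_const (measurable_averageFun hT S hw)
  have hB₂m : MeasurableSet B₂ := Finset.measurableSet_biUnion _ fun m _ => (hact m).measurable hzero
  have hB₁μ : μ B₁ ≤ κ := by
    have h1 := mul_meas_ge_le_lintegral (μ := μ) (measurable_averageFun hT S hw) (ENNReal.ofReal δ)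
    rw [lintegral_averageFun hT hS hw] at h1
    exact (ENNReal.mul_le_mul_iff_right (by simpa using hδ0) (by simp)).1 (h1.trans hwint)
  have hB₂μ : μ B₂ = 0 := by
    refine (measure_biUnion_null_iff S.countable_toSet).2 fun m _ => ?_
    rw [(hact m).measure_preimage hzero.nullMeasurableSet, hzeroμ]
  have hBμ : μ (B₁ ∪ B₂) ≤ κ := by
    refine (measure_union_le _ _).trans ?_
    rw [hB₂μ, add_zero]
    exact hB₁μ
  have hκε : κ < ENNReal.ofReal ε := by
    rw [hκ, ENNReal.ofReal_lt_ofReal_iff hε]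
    have := min_le_left ε 1
    have : 0 < min ε 1 := by positivity
    linarith
  have hmem : ∀ x ∉ B₁ ∪ B₂, itinerary L S x ∈ admissibleItineraries R L S := by
    intro x hx
    simp only [admissibleItineraries, Finset.mem_filter, Finset.mem_univ, true_and]
    refine ⟨fun m hm => hx (Or.inr ?_), fun m m' hmm => word_act_eq L x hmm⟩
    exact mem_biUnion m.2 hm
  have hcov := hasCover_of_code (μ := μ) (ρ := average adic S ρ) (ε := ε) (δ := 3 * δ)
    (by positivity) (by rw [hδ]; linarith) (measurableSet_itinerary R L S)
    (admissibleItineraries R L S) (hB₁m.union hB₂m) (hBμ.trans_lt hκε) hmem (by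
      intro x hx y hy hxy
      have hx1 : averageFun adic S w x ≤ ENNReal.ofReal δ :=
        le_of_lt (not_le.1 fun hc => hx (Or.inl hc))
      have hy1 : averageFun adic S w y ≤ ENNReal.ofReal δ :=
        le_of_lt (not_le.1 fun hc => hy (Or.inl hc))
      have hpos : pos L x = pos L y := congrArg (fun d => d.1.val) hxy
      have h1 := ofReal_average_le (T := adic) hS h.nonneg (δ := δ) (w := w) (x := x) (y := y) (by
        intro m hm
        refine hwρ _ _ fun i hi => coordSeq_eq_of_lt (hi.trans_le hL) ?_ ?_
        · have e : (pos L (act adic m x) : ℤ) = pos L (act adic m y) := by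
            rw [pos_act, pos_act, hpos]
          exact_mod_cast e
        · exact congrFun (congrArg Prod.snd hxy) ⟨m, hm⟩)
      calc _ ≤ _ := h1
        _ ≤ ENNReal.ofReal δ + ENNReal.ofReal δ + ENNReal.ofReal δ := by gcongr
        _ = ENNReal.ofReal (3 * δ) := by
          rw [← ENNReal.ofReal_add hδ0.le hδ0.le, ← ENNReal.ofReal_add (by positivity) hδ0.le]
          congr 1; ring)
  have hne : 1 ≤ (admissibleItineraries R L S).card := by
    have : (B₁ ∪ B₂)ᶜ.Nonempty := by
      rw [nonempty_compl]
      intro hc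
      rw [hc, measure_univ, hκ, ← ENNReal.ofReal_one] at hBμ
      have h1 := (ENNReal.ofReal_le_ofReal_iff (by positivity)).1 hBμ
      have := min_le_right ε 1
      linarith
    obtain ⟨x, hx⟩ := this
    exact Finset.card_pos.2 ⟨_, hmem x hx⟩
  refine (epsEntropy_le_of_hasCover hne hcov).trans (ENNReal.ofReal_le_ofReal ?_)
  -- counting the itineraries
  set b := (fringe S (Finset.Icc (-2 ^ L) (2 ^ L))).card with hb
  -- Hence the blocks met through the fringe at most double the count `|S| / 2 ^ L`.
  have hb1 : b * 2 ^ L ≤ S.card := by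
    refine le_trans ?_ hbd
    calc b * 2 ^ L ≤ 3 * 4 ^ L * boundaryCard S * 2 ^ L :=
          Nat.mul_le_mul_right _ (card_fringe_Icc_le S L)
      _ = 3 * 8 ^ L * boundaryCard S := by
          rw [show (8 : ℕ) = 4 * 2 by norm_num, mul_pow]; ring
  have hK : ∀ P : Fin (2 ^ L), (S.image fun m => ((P : ℤ) + m) / 2 ^ L).card ≤
      2 * S.card / 2 ^ L := by
    intro P
    rw [Nat.le_div_iff_mul_le (by positivity)]
    have := card_image_div_le S L P
    rw [← hb] at this
    omega
  have h1 := card_admissibleItineraries_le R L S hK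
  have h2 : Real.logb 2 (admissibleItineraries R L S).card ≤
      L + (height R L * (2 * S.card / 2 ^ L) : ℕ) := by
    rw [← pow_add] at h1
    have h3 : ((admissibleItineraries R L S).card : ℝ) ≤
        (2 : ℝ) ^ (L + height R L * (2 * S.card / 2 ^ L)) := by exact_mod_cast h1
    refine (Real.logb_le_logb_of_le (by norm_num) (by exact_mod_cast hne) h3).trans ?_
    rw [Real.logb_pow, Real.logb_self_eq_one (by norm_num)]
    push_cast
    simp
  refine h2.trans (by
    gcongr
    rw [le_div_iff₀ (by exact_mod_cast mult_pos L)]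
    have h4 : 2 * S.card / 2 ^ L * 2 ^ L ≤ 2 * S.card := Nat.div_mul_le_self _ _
    have h5 : height R L * (2 * S.card / 2 ^ L) * mult R L ≤ 2 * S.card := by
      rw [mul_right_comm, height_mul_mult, mul_comm]
      exact h4
    exact_mod_cast h5)

end PairsGraph

namespace PairsGraph

open ScalingEntropy

/-! ### The lower bound for the entropy -/

/-- The letter of a path at its present position. -/
def bit (x : PathSpace) : Bool := word 0 x 0

theorem measurable_bit : Measurable bit :=
  (measurable_of_countable fun v : Vertex 0 => v 0).comp (measurable_word 0)

theorem bit_eq_word (x : PathSpace) (n : ℕ) : bit x = word n x ⟨pos n x, pos_lt n x⟩ := by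
  have h := word_xor_eq_of_le x (a := 0) (m := 0) (n := n) (by simp) (Nat.zero_le n)
  simp only [Nat.zero_xor] at h
  exact h.symm

/-- While the position stays in `[0, 2 ^ n)`, the orbit reads successive letters of one word. -/
theorem bit_act_eq_word {n : ℕ} {x : PathSpace} {q : Fin (2 ^ n)} {m : ℤ}
    (h : (pos n x : ℤ) + m = q) : bit (act adic m x) = word n x q := by
  have hq0 : (0 : ℤ) ≤ q := by positivity
  have hq1 : (q : ℤ) < 2 ^ n := by exact_mod_cast q.isLt
  have h1 : word n (act adic m x) = word n x := by
    rw [← act_zero adic x, ← act_add, add_zero]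
    refine word_act_eq n x ?_
    rw [h, Int.ediv_eq_zero_of_lt hq0 hq1, add_zero, Int.ediv_eq_zero_of_lt (by positivity)
      (by exact_mod_cast pos_lt n x)]
  have h2 : (pos n (act adic m x) : ℤ) = q := by
    rw [pos_act, h, Int.emod_eq_of_lt hq0 hq1]
  rw [bit_eq_word _ n, h1]
  congr 1
  ext
  exact_mod_cast h2

/-- The number of times from `S` at which the letters seen along two orbits differ. -/
noncomputable def bitDist (S : Finset ℤ) (x y : PathSpace) : ℕ :=
  (S.filter fun m => bit (act adic m y) ≠ bit (act adic m x)).card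

/-- Outside the fringe, a point of `S` has its whole block of length `2 ^ L` in `S`, and `hz` places
`S` inside the large block. This supplies the full blocks needed for the Chernoff bound. -/
theorem card_compl_fringe_le {S : Finset ℤ} {L n : ℕ} (z : ℕ)
    (hz : ∀ m ∈ S, 0 ≤ (z : ℤ) + m ∧ (z : ℤ) + m < 2 ^ n) :
    S.card ≤ (Finset.univ.filter fun q : Fin (2 ^ n) => ∀ q' : Fin (2 ^ n),
      q'.val / 2 ^ L = q.val / 2 ^ L → decide ((q' : ℤ) - z ∈ S) = true).card +
      (fringe S (Finset.Icc (-2 ^ L) (2 ^ L))).card := by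
  set F := fringe S (Finset.Icc (-2 ^ L) (2 ^ L)) with hF
  have hFS : F ⊆ S := Finset.filter_subset _ _
  rw [← Finset.card_sdiff_add_card_eq_card hFS]
  gcongr
  have hlt : ∀ m ∈ S, ((z : ℤ) + m).toNat < 2 ^ n := fun m hm => by
    have h1 := (hz m hm).1
    have h2 := (hz m hm).2
    have : (((z : ℤ) + m).toNat : ℤ) < 2 ^ n := by rw [Int.toNat_of_nonneg h1]; exact h2
    exact_mod_cast this
  refine Finset.card_le_card_of_injOn (fun m => if h : ((z : ℤ) + m).toNat < 2 ^ n then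
    ⟨((z : ℤ) + m).toNat, h⟩ else ⟨0, by positivity⟩) (fun m hm => ?_) fun m hm m' hm' he => ?_
  · obtain ⟨hmS, hmF⟩ := Finset.mem_sdiff.1 hm
    simp only [Finset.coe_filter, Finset.mem_univ, true_and, mem_ofPred_eq, dif_pos (hlt m hmS),
      decide_eq_true_eq]
    intro q' hq'
    by_contra hc
    refine hmF (Finset.mem_filter.2 ⟨hmS, (q' : ℤ) - z - m, ?_, ?_⟩)
    · have h1 := Nat.div_add_mod q'.val (2 ^ L)
      have h2 := Nat.div_add_mod ((z : ℤ) + m).toNat (2 ^ L)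
      have h3 := Nat.mod_lt q'.val (show 0 < 2 ^ L by positivity)
      have h4 := Nat.mod_lt ((z : ℤ) + m).toNat (show 0 < 2 ^ L by positivity)
      rw [hq'] at h1
      have h5 := Int.toNat_of_nonneg (hz m hmS).1
      have h6 : ((2 ^ L : ℕ) : ℤ) = 2 ^ L := by push_cast; rfl
      rw [Finset.mem_Icc, ← h6]
      generalize 2 ^ L * (((z : ℤ) + m).toNat / 2 ^ L) = u at *
      omega
    · rw [show m + ((q' : ℤ) - z - m) = q' - z by ring]; exact hc
  · have hmS := (Finset.mem_sdiff.1 hm).1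
    have hmS' := (Finset.mem_sdiff.1 hm').1
    simp only [dif_pos (hlt m hmS), dif_pos (hlt m' hmS'), Fin.mk.injEq] at he
    have h5 := Int.toNat_of_nonneg (hz m hmS).1
    have h5' := Int.toNat_of_nonneg (hz m' hmS').1
    omega

/-- Points whose letters along `S` are close to those of a given point form a set of small
measure. -/
theorem measureReal_bitDist_le {R : ℕ → Bool} {L k : ℕ}
    (hR : ∀ i, L ≤ i → i < L + k → R i = false) {S : Finset ℤ}
    (hbd : 6 * 4 ^ L * boundaryCard S ≤ S.card) {D : Set PathSpace}
    (hD : ∀ y ∈ D, ∀ m ∈ S, 0 ≤ (pos (L + k) y : ℤ) + m ∧ (pos (L + k) y : ℤ) + m < 2 ^ (L + k))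
    {x : PathSpace} (hx : ∀ y ∈ D, 16 * bitDist S x y ≤ S.card) :
    (pathLaw R).real D ≤ (1 / 2 : ℝ) ^ ((S.card : ℝ) / (8 * mult R L)) := by
  classical
  set τ := (1 / 2 : ℝ) ^ ((S.card : ℝ) / (8 * mult R L)) with hτ
  have hτ0 : 0 ≤ τ := by positivity
  set μ := pathLaw R with hμ
  have key : ∀ z ∈ Finset.range (2 ^ (L + k)),
      μ.real (D ∩ {y | pos (L + k) y = z}) ≤ (1 / 2) ^ (L + k) * τ := by
    intro z hz
    have hz := Finset.mem_range.1 hz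
    rcases (D ∩ {y | pos (L + k) y = z}).eq_empty_or_nonempty with he | ⟨y₀, hy₀, hy₀z⟩
    · rw [he, measureReal_empty]; positivity
    have hzS : ∀ m ∈ S, 0 ≤ (z : ℤ) + m ∧ (z : ℤ) + m < 2 ^ (L + k) := by
      intro m hm
      have := hD y₀ hy₀ m hm
      rwa [show pos (L + k) y₀ = z from hy₀z] at this
    -- The set of times and the letters of `x`, transported to the block seen from position `z`. The
    -- path `x` may lie in another block, as the estimate is uniform in `t`.
    let A : Vertex (L + k) := fun q => decide ((q : ℤ) - z ∈ S)
    let t : Vertex (L + k) := fun q => bit (act adic ((q : ℤ) - z) x)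
    let V : Finset (Vertex (L + k)) := Finset.univ.filter fun w => 16 * mismatch A t w ≤ S.card
    have hsub : D ∩ {y | pos (L + k) y = z} ⊆ ⋃ w ∈ V, block (L + k) z w := by
      rintro y ⟨hy, hyz⟩
      refine mem_biUnion (x := word (L + k) y) ?_ ⟨hyz, rfl⟩
      refine Finset.mem_coe.2 (Finset.mem_filter.2 ⟨Finset.mem_univ _, le_trans ?_ (hx y hy)⟩)
      refine Nat.mul_le_mul_left _ (Finset.card_le_card_of_injOn
        (fun q : Fin (2 ^ (L + k)) => (q : ℤ) - z) (fun q hq => ?_) fun q _ q' _ he => ?_)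
      · simp only [Finset.coe_filter, Finset.mem_univ, true_and, mem_ofPred_eq, A, t,
          decide_eq_true_eq] at hq ⊢
        refine ⟨hq.1, ?_⟩
        rw [bit_act_eq_word (n := L + k) (q := q)
          (by rw [show pos (L + k) y = z from hyz]; ring)]
        exact hq.2
      · have he : (q : ℤ) - z = q' - z := he
        ext
        omega
    have hE := expect_mismatch_le hR A t (s := S.card) (by
      have h1 := card_compl_fringe_le (L := L) z hzS
      have h2 := card_fringe_Icc_le S L
      have h3 : 2 * (3 * 4 ^ L * boundaryCard S) ≤ S.card := by rw [← mul_assoc, ← mul_assoc]; exact hbd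
      change S.card ≤ 2 * (Finset.univ.filter fun q : Fin (2 ^ (L + k)) => ∀ q' : Fin (2 ^ (L + k)),
        q'.val / 2 ^ L = q.val / 2 ^ L → decide ((q' : ℤ) - z ∈ S) = true).card
      omega)
    calc μ.real (D ∩ {y | pos (L + k) y = z}) ≤ ∑ w ∈ V, μ.real (block (L + k) z w) :=
          (measureReal_mono hsub (measure_ne_top _ _)).trans (measureReal_biUnion_finset_le _ _)
      _ = (1 / 2) ^ (L + k) * expect R (L + k)
          (fun w => if 16 * mismatch A t w ≤ S.card then 1 else 0) := by
          simp only [hμ, pathLaw_block R hz, expect, mul_ite, mul_one, mul_zero, V]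
          rw [← Finset.sum_filter, Finset.mul_sum]
      _ ≤ _ := mul_le_mul_of_nonneg_left hE (by positivity)
  rw [← sum_measureReal_inter_pos (L + k) D]
  refine (Finset.sum_le_sum key).trans (le_of_eq ?_)
  simp

/-- The exceptional set and the complement of `Y` cover at most half of the space, so the `k` other
sets satisfy `k * 2 ^ (-u) ≥ 1 / 2`. -/
theorem le_epsEntropy_of_measure_le {X : Type*} [MeasurableSpace X] {μ : Measure X}
    [IsProbabilityMeasure μ] {ρ : X → X → ℝ} {ε : ℝ} (hε : ε ≤ 1 / 4) {Y : Set X}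
    (hY : μ.real Yᶜ ≤ 1 / 4) {u : ℝ}
    (h : ∀ D ⊆ Y, (∀ x ∈ D, ∀ y ∈ D, ρ x y < ε) → μ.real D ≤ (1 / 2 : ℝ) ^ u) :
    ENNReal.ofReal (u - 1) ≤ epsEntropy μ ρ ε := by
  refine le_iInf₂ fun k hk => ENNReal.ofReal_le_ofReal ?_
  obtain ⟨hk1, A, hAm, hAu, hA0, hAd⟩ := hk
  have hk0 : (0 : ℝ) < k := by exact_mod_cast hk1
  have hε0 : 0 < ε := ENNReal.ofReal_pos.1 (lt_of_le_of_lt zero_le hA0)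
  have hA0' : μ.real (A 0) ≤ 1 / 4 := by
    refine le_trans ?_ hε
    exact ENNReal.toReal_le_of_le_ofReal hε0.le hA0.le
  have hAi : ∀ i : Fin k, μ.real (A i.succ ∩ Y) ≤ (1 / 2 : ℝ) ^ u := by
    intro i
    refine h _ inter_subset_right fun x hx y hy => ?_
    have h1 : ENNReal.ofReal (ρ x y) ≤ diam ρ (A i.succ) :=
      (le_iSup₂_of_le x hx.1 (le_iSup₂_of_le y hy.1 le_rfl))
    exact (ENNReal.ofReal_lt_ofReal_iff hε0).1 (h1.trans_lt (hAd _ (Fin.succ_ne_zero i)))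
  have hcov : (univ : Set X) ⊆ (A 0 ∪ Yᶜ) ∪ ⋃ i ∈ (Finset.univ : Finset (Fin k)),
      (A i.succ ∩ Y) := by
    intro x _
    by_cases hxY : x ∈ Y
    · obtain ⟨i, hi⟩ := mem_iUnion.1 (hAu.symm ▸ mem_univ x : x ∈ ⋃ i, A i)
      rcases Fin.eq_zero_or_eq_succ i with rfl | ⟨j, rfl⟩
      · exact Or.inl (Or.inl hi)
      · exact Or.inr (mem_biUnion (Finset.mem_coe.2 (Finset.mem_univ j)) ⟨hi, hxY⟩)
    · exact Or.inl (Or.inr hxY)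
  have h1 : (1 : ℝ) ≤ 1 / 4 + 1 / 4 + k * (1 / 2 : ℝ) ^ u := by
    calc (1 : ℝ) = μ.real univ := by simp
      _ ≤ (μ.real (A 0) + μ.real Yᶜ) + ∑ i : Fin k, μ.real (A i.succ ∩ Y) :=
          (measureReal_mono hcov).trans ((measureReal_union_le _ _).trans
            (add_le_add (measureReal_union_le _ _) (measureReal_biUnion_finset_le _ _)))
      _ ≤ 1 / 4 + 1 / 4 + ∑ i : Fin k, (1 / 2 : ℝ) ^ u :=
          add_le_add (add_le_add hA0' hY) (Finset.sum_le_sum fun i _ => hAi i)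
      _ = _ := by simp
  rw [Real.le_logb_iff_rpow_le (by norm_num) hk0, Real.rpow_sub_one (by norm_num)]
  rw [show (1 / 2 : ℝ) ^ u = (2 ^ u)⁻¹ by rw [one_div, Real.inv_rpow (by norm_num)],
    ← div_eq_mul_inv] at h1
  have h2 : (0 : ℝ) < 2 ^ u := by positivity
  have h3 : 1 / 2 ≤ (k : ℝ) / 2 ^ u := by linarith
  rw [le_div_iff₀ h2] at h3
  linarith

/-- Letters of `x` and `y` can differ at a time `m` for four reasons: either orbit is outside the
good set `G`, a shift of `m` leaves `S`, or `ρ` is at least `r` at a shifted time in `S`. Each is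
allowed at most `|S| / 64` times, which gives the `|S| / 16` required by `measureReal_bitDist_le`.
-/
theorem le_epsEntropy_average {R : ℕ → Bool} {ρ : PathSpace → PathSpace → ℝ}
    (h : IsMeasurableSemimetric (pathLaw R) ρ) (ha : IsAdmissible (pathLaw R) ρ)
    (hg : IsGenerating (pathLaw R) adic ρ) :
    ∃ (ε₀ : ℝ) (C : ℕ), 0 < ε₀ ∧ ∀ ε ≤ ε₀, ∀ (L k M : ℕ) (S : Finset ℤ), S.Nonempty →
      (∀ i, L ≤ i → i < L + k → R i = false) → (∀ m ∈ S, m.natAbs ≤ M) →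
      16 * M ≤ 2 ^ (L + k) → C * boundaryCard S ≤ S.card →
      6 * 4 ^ L * boundaryCard S ≤ S.card →
      ENNReal.ofReal ((S.card : ℝ) / (8 * mult R L) - 1) ≤
        epsEntropy (pathLaw R) (average adic S ρ) ε := by
  classical
  set μ := pathLaw R with hμ
  have hT := measurePreserving_adic R
  -- The value `1 / 512 = 1 / 8 * 1 / 64` is fixed by Markov's inequality: outside a set of measure
  -- `1 / 8`, at most `1 / 64` of the times in `S` are bad.
  obtain ⟨J, r, G, hr, hGm, hGμ, hG⟩ := exists_separating_shifts hT h ha hg measurable_bit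
    (δ := ENNReal.ofReal (1 / 512)) (by simp)
  refine ⟨min (1 / 4) (r / (64 * (J.card + 1))), 64 * ∑ l ∈ J, l.natAbs, by positivity,
    fun ε hε L k M S hS hR hM hMk hC hbd => ?_⟩
  have hS0 : (0 : ℝ) < S.card := by exact_mod_cast hS.card_pos
  set Y₁ : Set PathSpace := {y | averageFun adic S (Gᶜ.indicator 1) y ≤ ENNReal.ofReal (1 / 64)}
  set Y₂ : Set PathSpace := {y | ∀ m ∈ S, 0 ≤ (pos (L + k) y : ℤ) + m ∧
    (pos (L + k) y : ℤ) + m < 2 ^ (L + k)}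
  have hY₁ : μ.real Y₁ᶜ ≤ 1 / 8 := by
    have hw : Measurable (Gᶜ.indicator (1 : PathSpace → ℝ≥0∞)) := measurable_one.indicator hGm.compl
    have h1 := mul_meas_ge_le_lintegral (μ := μ) (measurable_averageFun hT S hw)
      (ENNReal.ofReal (1 / 64))
    rw [lintegral_averageFun hT hS hw, lintegral_indicator_one hGm.compl] at h1
    have h2 : ENNReal.ofReal (1 / 64) * μ Y₁ᶜ ≤ ENNReal.ofReal (1 / 512) := by
      refine le_trans ?_ (h1.trans hGμ)
      gcongr
      intro y (hy : ¬ averageFun adic S (Gᶜ.indicator 1) y ≤ ENNReal.ofReal (1 / 64))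
      exact le_of_lt (not_le.1 hy)
    have h3 := ENNReal.toReal_mono (by simp) h2
    rw [ENNReal.toReal_mul, ENNReal.toReal_ofReal (by norm_num),
      ENNReal.toReal_ofReal (by norm_num)] at h3
    rw [measureReal_def]
    linarith
  -- The orbit can leave its block during `S` only from the first or last `M` positions, whose total
  -- measure is `2 M / 2 ^ (L + k)`.
  have hY₂ : μ.real Y₂ᶜ ≤ 1 / 8 := by
    have hsub : Y₂ᶜ ⊆ ⋃ z ∈ Finset.range M ∪ Finset.Ico (2 ^ (L + k) - M) (2 ^ (L + k)),
        {y | pos (L + k) y = z} := by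
      intro y hy
      simp only [Y₂, mem_compl_iff, mem_ofPred_eq, not_forall] at hy
      obtain ⟨m, hm, hmy⟩ := hy
      have h1 := hM m hm
      have h2 := pos_lt (L + k) y
      have h3 : ((2 ^ (L + k) : ℕ) : ℤ) = 2 ^ (L + k) := by push_cast; rfl
      rw [← h3] at hmy
      refine mem_biUnion (x := pos (L + k) y) ?_ rfl
      simp only [Finset.coe_union, mem_union, SetLike.mem_coe, Finset.mem_range, Finset.mem_Ico]
      omega
    have h1 : μ.real Y₂ᶜ ≤ ((M + M : ℕ) : ℝ) * (1 / 2) ^ (L + k) := by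
      refine (measureReal_mono hsub (measure_ne_top _ _)).trans ((measureReal_biUnion_finset_le _ _).trans ?_)
      rw [Finset.sum_congr rfl (g := fun _ => (1 / 2 : ℝ) ^ (L + k)), Finset.sum_const,
        nsmul_eq_mul]
      · refine mul_le_mul_of_nonneg_right ?_ (by positivity)
        have := Finset.card_union_le (Finset.range M) (Finset.Ico (2 ^ (L + k) - M) (2 ^ (L + k)))
        rw [Finset.card_range, Nat.card_Ico] at this
        exact_mod_cast this.trans (by omega)
      · intro z hz
        refine pathLaw_pos R ?_
        simp only [Finset.mem_union, Finset.mem_range, Finset.mem_Ico] at hz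
        have : 0 < 2 ^ (L + k) := by positivity
        omega
    have h2 : (16 : ℝ) * M ≤ 2 ^ (L + k) := by exact_mod_cast hMk
    refine h1.trans ?_
    rw [one_div, inv_pow, ← div_eq_mul_inv, div_le_iff₀ (by positivity)]
    push_cast
    linarith
  refine le_epsEntropy_of_measure_le (hε.trans (min_le_left _ _)) (Y := Y₁ ∩ Y₂) ?_
    fun D hDY hD => ?_
  · rw [compl_inter]
    refine (measureReal_union_le _ _).trans ?_
    linarith
  rcases D.eq_empty_or_nonempty with rfl | ⟨x, hx⟩
  · rw [measureReal_empty]; positivity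
  refine measureReal_bitDist_le hR hbd (fun y hy => (hDY hy).2) (x := x) fun y hy => ?_
  -- comparison of the distances
  have hcount : ∀ y ∈ D, 64 * (S.filter fun m => act adic m y ∉ G).card ≤ S.card := by
    intro y hy
    have h1 := (hDY hy).1
    simp only [Y₁, mem_ofPred_eq, averageFun] at h1
    have h2 : ∑ m ∈ S, Gᶜ.indicator (1 : PathSpace → ℝ≥0∞) (act adic m y) =
        ((S.filter fun m => act adic m y ∉ G).card : ℝ≥0∞) := by
      rw [Finset.card_filter]
      push_cast
      exact Finset.sum_congr rfl fun m _ => by simp [indicator_apply]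
    rw [h2] at h1
    have h3 := ENNReal.toReal_mono (by simp) h1
    rw [ENNReal.toReal_mul, ENNReal.toReal_inv, ENNReal.toReal_natCast, ENNReal.toReal_natCast,
      ENNReal.toReal_ofReal (by norm_num), inv_mul_le_iff₀ hS0] at h3
    have : (64 : ℝ) * (S.filter fun m => act adic m y ∉ G).card ≤ S.card := by linarith
    exact_mod_cast this
  set H := S.filter fun m => ∃ l ∈ J, m + l ∈ S ∧ r ≤ ρ (act adic (m + l) x) (act adic (m + l) y)
    with hH
  -- For each `l ∈ J` the shifted times are distinct elements of `S`, so the sum of `ρ` over them is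
  -- at most `|S| * ε`. The choice of `ε₀` absorbs the factor `64 * J.card`.
  have hHcard : 64 * H.card ≤ S.card := by
    have h1 : (H.card : ℝ) * r ≤ J.card * (S.card * ε) := by
      have h2 : (H.card : ℝ) * r ≤ ∑ l ∈ J, ∑ m ∈ S, ρ (act adic m x) (act adic m y) := by
        calc (H.card : ℝ) * r ≤ ∑ m ∈ H, ∑ l ∈ J,
              if m + l ∈ S then ρ (act adic (m + l) x) (act adic (m + l) y) else 0 := by
              rw [← nsmul_eq_mul]
              refine Finset.card_nsmul_le_sum _ _ _ fun m hm => ?_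
              obtain ⟨-, l, hl, hlS, hlr⟩ := Finset.mem_filter.1 hm
              refine le_trans (by rw [if_pos hlS]; exact hlr) (Finset.single_le_sum
                (f := fun l => if m + l ∈ S then ρ (act adic (m + l) x) (act adic (m + l) y) else 0)
                (fun l _ => ?_) hl)
              split_ifs
              · exact h.nonneg _ _
              · exact le_rfl
          _ = ∑ l ∈ J, ∑ m ∈ H.filter fun m => m + l ∈ S,
              ρ (act adic (m + l) x) (act adic (m + l) y) := by
              rw [Finset.sum_comm]
              exact Finset.sum_congr rfl fun l _ => (Finset.sum_filter _ _).symm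
          _ ≤ _ := by
              refine Finset.sum_le_sum fun l _ => ?_
              rw [← Finset.sum_image (s := H.filter fun m => m + l ∈ S) (g := fun m => m + l)
                (f := fun m => ρ (act adic m x) (act adic m y)) (fun a _ b _ hab => by simpa using hab)]
              refine Finset.sum_le_sum_of_subset_of_nonneg ?_ fun _ _ _ => h.nonneg _ _
              intro m hm
              obtain ⟨m', hm', rfl⟩ := Finset.mem_image.1 hm
              exact (Finset.mem_filter.1 hm').2
      refine h2.trans ?_
      rw [Finset.sum_const, nsmul_eq_mul]
      have h3 := hD x hx y hy
      rw [ScalingEntropy.average, inv_mul_lt_iff₀ hS0] at h3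
      gcongr
    have h2 : ε ≤ r / (64 * (J.card + 1)) := hε.trans (min_le_right _ _)
    rw [le_div_iff₀ (by positivity)] at h2
    have h3 : (64 * H.card : ℝ) * r ≤ S.card * r := by
      have h4 : (J.card : ℝ) * (64 * ε) ≤ r := by
        rcases le_total 0 ε with h0 | h0
        · nlinarith
        · have : (0 : ℝ) ≤ J.card := by positivity
          nlinarith
      nlinarith
    have := le_of_mul_le_mul_right h3 hr
    exact_mod_cast this
  have hsub : (S.filter fun m => bit (act adic m y) ≠ bit (act adic m x)) ⊆
      ((S.filter fun m => act adic m x ∉ G) ∪ (S.filter fun m => act adic m y ∉ G)) ∪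
        (fringe S J ∪ H) := by
    intro m hm
    obtain ⟨hmS, hmb⟩ := Finset.mem_filter.1 hm
    by_cases hxG : act adic m x ∈ G
    · by_cases hyG : act adic m y ∈ G
      · refine Finset.mem_union_right _ ?_
        obtain ⟨l, hl, hlr⟩ := hG _ hxG _ hyG hmb.symm
        rw [← act_add, ← act_add, add_comm l m] at hlr
        by_cases hlS : m + l ∈ S
        · exact Finset.mem_union_right _ (Finset.mem_filter.2 ⟨hmS, l, hl, hlS, hlr⟩)
        · exact Finset.mem_union_left _ (Finset.mem_filter.2 ⟨hmS, l, hl, hlS⟩)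
      · exact Finset.mem_union_left _ (Finset.mem_union_right _ (Finset.mem_filter.2 ⟨hmS, hyG⟩))
    · exact Finset.mem_union_left _ (Finset.mem_union_left _ (Finset.mem_filter.2 ⟨hmS, hxG⟩))
  have hc := (Finset.card_le_card hsub).trans ((Finset.card_union_le _ _).trans
    (add_le_add (Finset.card_union_le _ _) (Finset.card_union_le _ _)))
  have h1 := hcount x hx
  have h2 := hcount y hy
  have h3 := card_fringe_le S J
  have h4 : 64 * ((∑ l ∈ J, l.natAbs) * boundaryCard S) ≤ S.card := by rw [← mul_assoc]; exact hC
  unfold bitDist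
  omega

end PairsGraph

namespace PairsGraph

open ScalingEntropy

/-! ### The choice of the levels -/

/-- Levels `r j` and indices `n j`, each of them large in terms of the preceding ones. -/
theorem exists_levels {φ : ℕ → ℝ} (hφ : Tendsto φ atTop atTop) (M : ℕ → ℕ) :
    ∃ r n : ℕ → ℕ, StrictMono n ∧ r 0 = 0 ∧ (∀ j, r j + 2 ≤ r (j + 1)) ∧
      (∀ j, 4 ^ j ≤ φ (n j)) ∧ (∀ j, (j + 1) * (6 * 8 ^ (r j + 1)) ≤ n j) ∧
      ∀ j, 16 * M (n j) ≤ 2 ^ r (j + 1) := by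
  have hex : ∀ B j : ℕ, ∃ n, B ≤ n ∧ (4 : ℝ) ^ j ≤ φ n := fun B j =>
    ((eventually_ge_atTop B).and (hφ.eventually_ge_atTop _)).exists
  choose f hfB hfφ using hex
  let b : ℕ → ℕ → ℕ := fun j r => (j + 1) * (6 * 8 ^ (r + 1))
  -- The choices alternate: `r (j + 1)` is taken large in terms of the sets with index `n j`, then
  -- `n (j + 1)` large in terms of `r (j + 1)`. The summand `2` leaves a level without repetition
  -- after each `r j`.
  let s : ℕ → ℕ × ℕ := fun j => Nat.rec (0, f (b 0 0) 0) (fun j p =>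
    (p.1 + 2 + 16 * M p.2, f (p.2 + 1 + b (j + 1) (p.1 + 2 + 16 * M p.2)) (j + 1))) j
  have hs1 : ∀ j, (s (j + 1)).1 = (s j).1 + 2 + 16 * M (s j).2 := fun j => rfl
  have hs2 : ∀ j, (s (j + 1)).2 = f ((s j).2 + 1 + b (j + 1) (s (j + 1)).1) (j + 1) := fun j => rfl
  refine ⟨fun j => (s j).1, fun j => (s j).2, strictMono_nat_of_lt_succ fun j => ?_, rfl,
    fun j => ?_, fun j => ?_, fun j => ?_, fun j => ?_⟩
  · have h1 := hfB ((s j).2 + 1 + b (j + 1) (s (j + 1)).1) (j + 1)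
    have h2 := hs2 j
    omega
  · have := hs1 j
    change (s j).1 + 2 ≤ (s (j + 1)).1
    omega
  · cases j with
    | zero => exact hfφ _ _
    | succ j => exact hfφ _ _
  · cases j with
    | zero => exact hfB _ _
    | succ j => exact le_trans (Nat.le_add_left _ _) (hfB _ _)
  · have h1 := Nat.lt_two_pow_self (n := (s (j + 1)).1)
    have h2 := hs1 j
    change 16 * M (s j).2 ≤ 2 ^ (s (j + 1)).1
    omega

/-- The indicator of the set of levels `r j`. -/
noncomputable def levelSet (r : ℕ → ℕ) (i : ℕ) : Bool :=
  open Classical in decide (∃ j, r j = i)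

theorem levelSet_self (r : ℕ → ℕ) (j : ℕ) : levelSet r (r j) = true := by
  simp [levelSet]

theorem levelSet_of_between {r : ℕ → ℕ} (hr : StrictMono r) {i j : ℕ} (h1 : r j < i)
    (h2 : i < r (j + 1)) : levelSet r i = false := by
  simp only [levelSet, decide_eq_false_iff_not]
  rintro ⟨j', rfl⟩
  have := hr.lt_iff_lt.1 h1
  have := hr.lt_iff_lt.1 h2
  omega

/-- Exactly the `j + 1` levels `r 0, …, r j` below `r j + 1` double the multiplicity. -/
theorem mult_levelSet {r : ℕ → ℕ} (hr : StrictMono r) (h0 : r 0 = 0) (j : ℕ) :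
    mult (levelSet r) (r j + 1) = 2 ^ (j + 1) := by
  have key : ∀ j, mult (levelSet r) (r j) = 2 ^ j → mult (levelSet r) (r j + 1) = 2 ^ (j + 1) := by
    intro j hj
    rw [mult, levelSet_self, if_pos rfl, hj, pow_succ, mul_comm]
  induction j with
  | zero => exact key 0 (by rw [h0]; rfl)
  | succ j ih =>
    obtain ⟨k, hk⟩ := Nat.exists_eq_add_of_le
      (show r j + 1 ≤ r (j + 1) from hr (Nat.lt_succ_self j))
    refine key (j + 1) ?_
    rw [← ih, show r (j + 1) = r j + 1 + k from hk]
    exact mult_add fun i h1 h2 => levelSet_of_between hr (j := j) (by omega) (by omega)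

theorem boundaryCard_mul_le {n : ℕ} (hn : 1 ≤ n) {S : Finset ℤ}
    (hS : IsInvariantUpTo (1 / (n : ℝ)) S) : n * boundaryCard S ≤ S.card := by
  have hn0 : (0 : ℝ) < n := by exact_mod_cast hn
  have h : (boundaryCard S : ℝ) < 1 / n * S.card := hS
  rw [one_div, inv_mul_eq_div, lt_div_iff₀ hn0] at h
  have : (n : ℝ) * boundaryCard S ≤ S.card := by linarith
  exact_mod_cast this

theorem IsInvariantUpTo.nonempty {ε : ℝ} {S : Finset ℤ} (hS : IsInvariantUpTo ε S) :
    S.Nonempty := by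
  by_contra h
  rw [Finset.not_nonempty_iff_eq_empty] at h
  simp [IsInvariantUpTo, h] at hS

theorem uniformlyNegligible_of_le {ι : ℕ → Type*} {a b : (j : ℕ) → ι j → ℝ≥0∞} {c : ℕ → ℝ}
    (hc : Tendsto c atTop (𝓝 0)) (h : ∀ᶠ j in atTop, ∀ i, a j i / b j i ≤ ENNReal.ofReal (c j)) :
    UniformlyNegligible a b := by
  intro η hη
  filter_upwards [h, (tendsto_order.1 hc).2 η hη] with j hj hcj i
  exact (hj i).trans_lt ((ENNReal.ofReal_lt_ofReal_iff hη).2 hcj)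

end PairsGraph

/-! ### Assembly of the two entropy bounds. -/

open PairsGraph ScalingEntropy in
theorem mainTheorem6
    (k : ℕ → ℕ) (S : (n : ℕ) → Fin (k n) → Finset ℤ)
    (hS : ∀ n : ℕ, 1 ≤ n → ∀ i, ScalingEntropy.IsInvariantUpTo (1 / (n : ℝ)) (S n i))
    (φ : ℕ → ℝ) (hφ_pos : ∀ n : ℕ, 1 ≤ n → 0 < φ n) (hφ : Tendsto φ atTop atTop) :
    ∃ (μ : Measure PairsGraph.PathSpace) (T : PairsGraph.PathSpace ≃ᵐ PairsGraph.PathSpace)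
      (n : ℕ → ℕ),
      IsProbabilityMeasure μ ∧ (∀ x, μ {x} = 0) ∧ PairsGraph.IsCentral μ ∧
      (∀ᵐ x ∂μ, PairsGraph.IsAdicImage x (T x)) ∧
      Ergodic T μ ∧
      StrictMono n ∧ (∀ j, 1 ≤ n j) ∧
      ∀ ρ : PairsGraph.PathSpace → PairsGraph.PathSpace → ℝ,
        ScalingEntropy.IsMeasurableSemimetric μ ρ → ScalingEntropy.IsAdmissible μ ρ →
        ScalingEntropy.IsSummable μ ρ → ScalingEntropy.IsGenerating μ T ρ →
        ∃ ε₀ : ℝ, 0 < ε₀ ∧ ∀ ε : ℝ, 0 < ε → ε < ε₀ →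
          ScalingEntropy.UniformlyNegligible (ι := fun j => Fin (k (n j)))
            (fun j i => ENNReal.ofReal (((S (n j) i).card : ℝ) / φ (n j)))
            (fun j i => ScalingEntropy.epsEntropy μ
              (ScalingEntropy.average T (S (n j) i) ρ) ε) ∧
          ScalingEntropy.UniformlyNegligible (ι := fun j => Fin (k (n j)))
            (fun j i => ScalingEntropy.epsEntropy μ
              (ScalingEntropy.average T (S (n j) i) ρ) ε)
            (fun j i => ((S (n j) i).card : ℝ≥0∞)) := by
  -- The sum of all `|m|` is a crude bound for the extent of every set with index `n`.
  obtain ⟨r, n, hn, hr0, hr2, hnφ, hn8, hM⟩ := exists_levels hφ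
    fun n => ∑ i, ∑ m ∈ S n i, m.natAbs
  have hr : StrictMono r := strictMono_nat_of_lt_succ fun j => by have := hr2 j; omega
  have hn1 : ∀ j, 1 ≤ n j := fun j => le_trans (Nat.succ_le_of_lt (by positivity)) (hn8 j)
  have hRfalse : ∀ N, ∃ i, N ≤ i ∧ levelSet r i = false := fun N =>
    ⟨r N + 1, by have := hr.le_apply (x := N); omega,
      levelSet_of_between hr (j := N) (by omega) (by have := hr2 N; omega)⟩
  refine ⟨pathLaw (levelSet r), adic, n, inferInstance, pathLaw_singleton _, isCentral_pathLaw _,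
    ae_isAdicImage _, ergodic_adic hRfalse, hn, hn1, fun ρ h ha hs hg => ?_⟩
  obtain ⟨ε₀, C, hε₀, hlow⟩ := le_epsEntropy_average h ha hg
  refine ⟨ε₀, hε₀, fun ε hε hεε₀ => ?_⟩
  have hbd : ∀ j i, n j * boundaryCard (S (n j) i) ≤ (S (n j) i).card := fun j i =>
    boundaryCard_mul_le (hn1 j) (hS _ (hn1 j) i)
  have hne : ∀ j i, (S (n j) i).Nonempty := fun j i =>
    PairsGraph.IsInvariantUpTo.nonempty (hS _ (hn1 j) i)
  have h6 : ∀ j, 6 * 8 ^ (r j + 1) ≤ n j := fun j =>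
    le_trans (Nat.le_mul_of_pos_left _ (Nat.succ_pos j)) (hn8 j)
  -- A nonempty finite set of integers has a boundary point, so almost invariance forces it to be
  -- large.
  have hcard : ∀ j i, n j ≤ (S (n j) i).card := fun j i =>
    le_trans (Nat.le_mul_of_pos_right _ (boundaryCard_pos (hne j i))) (hbd j i)
  have hrj : ∀ j, j ≤ r j := fun j => hr.le_apply
  constructor
  -- The numerator is at most `s / 4 ^ j` and the entropy at least `s / 2 ^ (j + 5)`.
  · refine uniformlyNegligible_of_le (c := fun j => 32 * (1 / 2) ^ j) ?_ ?_
    · rw [← mul_zero (32 : ℝ)]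
      exact (tendsto_pow_atTop_nhds_zero_of_lt_one (by norm_num) (by norm_num)).const_mul _
    · filter_upwards [eventually_ge_atTop C] with j hj i
      have hCn : C ≤ n j := hj.trans hn.le_apply
      obtain ⟨l, hl⟩ := Nat.exists_eq_add_of_le
        (show r j + 1 ≤ r (j + 1) from hr (Nat.lt_succ_self j))
      have h1 := hlow ε hεε₀.le (r j + 1) l (∑ i, ∑ m ∈ S (n j) i, m.natAbs) (S (n j) i) (hne j i)
        (fun i h1 h2 => levelSet_of_between hr (j := j) (by omega) (by omega))
        (fun m hm => (Finset.single_le_sum (f := fun m : ℤ => m.natAbs) (fun _ _ => Nat.zero_le _)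
          hm).trans (Finset.single_le_sum (f := fun i => ∑ m ∈ S (n j) i, m.natAbs)
            (fun _ _ => Nat.zero_le _) (Finset.mem_univ i)))
        (by rw [← hl]; exact hM j)
        ((Nat.mul_le_mul_right _ hCn).trans (hbd j i))
        (le_trans (Nat.mul_le_mul_right _ (le_trans (Nat.mul_le_mul_left _
          (Nat.pow_le_pow_left (by norm_num) _)) (h6 j))) (hbd j i))
      rw [mult_levelSet hr hr0] at h1
      set s : ℝ := ((S (n j) i).card : ℝ) with hs'
      have hs8 : (6 * 8 ^ (j + 1) : ℝ) ≤ s := by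
        have := ((Nat.mul_le_mul_left 6 (Nat.pow_le_pow_right (by norm_num : 0 < 8)
          (Nat.succ_le_succ (hrj j)))).trans (h6 j)).trans (hcard j i)
        rw [hs']
        exact_mod_cast this
      have hs0 : 0 < s := lt_of_lt_of_le (by positivity) hs8
      -- As `8 * 2 ^ (j + 1) = 2 ^ (j + 4)`, half of the main term absorbs the `-1`, because `s ≥ 6
      -- * 8 ^ (j + 1) ≥ 2 ^ (j + 5)`.
      have h2 : s / 2 ^ (j + 5) ≤ s / (8 * ((2 ^ (j + 1) : ℕ) : ℝ)) - 1 := by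
        have e1 : s / (8 * ((2 ^ (j + 1) : ℕ) : ℝ)) = 2 * (s / 2 ^ (j + 5)) := by
          push_cast
          rw [pow_add, pow_add]
          field_simp
          norm_num
        have e2 : 1 ≤ s / 2 ^ (j + 5) := by
          rw [le_div_iff₀ (by positivity), one_mul]
          refine le_trans ?_ hs8
          have e3 : (2 : ℝ) ^ j ≤ 8 ^ j := pow_le_pow_left₀ (by norm_num) (by norm_num) j
          have e4 : (8 : ℝ) ^ (j + 1) = 8 * 8 ^ j := by ring
          have e5 : (2 : ℝ) ^ (j + 5) = 32 * 2 ^ j := by ring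
          have e6 : (0 : ℝ) < 8 ^ j := by positivity
          rw [e4, e5]
          linarith
        rw [e1]
        linarith
      calc _ ≤ ENNReal.ofReal (s / 4 ^ j) / ENNReal.ofReal (s / 2 ^ (j + 5)) := by
            refine ENNReal.div_le_div (ENNReal.ofReal_le_ofReal ?_)
              ((ENNReal.ofReal_le_ofReal h2).trans h1)
            exact div_le_div_of_nonneg_left hs0.le (by positivity) (hnφ j)
        _ = ENNReal.ofReal (s / 4 ^ j / (s / 2 ^ (j + 5))) :=
            (ENNReal.ofReal_div_of_pos (by positivity)).symm
        _ = _ := by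
            congr 1
            rw [show (4 : ℝ) = 2 * 2 by norm_num, mul_pow, pow_add, one_div, inv_pow]
            field_simp
            norm_num
  · obtain ⟨N, hup⟩ := epsEntropy_average_le h ha hs hε
    -- The first term bounds `(r j + 1) / |S|`, by the size of `n j`; the second equals `2 / mult =
    -- 2 / 2 ^ (j + 1)`.
    refine uniformlyNegligible_of_le (c := fun j => 1 / ((j : ℝ) + 1) + (1 / 2) ^ j) ?_ ?_
    · rw [← add_zero (0 : ℝ)]
      exact tendsto_one_div_add_atTop_nhds_zero_nat.add
        (tendsto_pow_atTop_nhds_zero_of_lt_one (by norm_num) (by norm_num))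
    · filter_upwards [eventually_ge_atTop N] with j hj i
      have h1 := hup (r j + 1) (hj.trans ((hrj j).trans (Nat.le_succ _))) (S (n j) i) (hne j i)
        (le_trans (Nat.mul_le_mul_right _ (le_trans (Nat.mul_le_mul_right _ (by norm_num)) (h6 j)))
          (hbd j i))
      rw [mult_levelSet hr hr0] at h1
      have hs0 : (0 : ℝ) < (S (n j) i).card := by exact_mod_cast (hne j i).card_pos
      rw [← ENNReal.ofReal_natCast (S (n j) i).card]
      refine (ENNReal.div_le_div_right h1 _).trans ?_
      rw [← ENNReal.ofReal_div_of_pos hs0]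
      refine ENNReal.ofReal_le_ofReal ?_
      rw [add_div]
      refine add_le_add ?_ (le_of_eq ?_)
      · rw [div_le_div_iff₀ hs0 (by positivity), one_mul]
        have h3 : (r j + 1) * (j + 1) ≤ (S (n j) i).card := by
          refine le_trans ?_ ((hn8 j).trans (hcard j i))
          rw [mul_comm]
          refine Nat.mul_le_mul_left _ ?_
          have := Nat.lt_pow_self (n := r j + 1) (show 1 < 8 by norm_num)
          omega
        exact_mod_cast h3
      · push_cast
        rw [pow_succ, one_div, inv_pow]
        field_simp
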